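/- Let $\mathbb T^2=\mathbb R^2/\mathbb Z^2$, $e_m(x)=e^{2\pi i m\cdot x}$ for $m\in\mathbb Z^2$, and for $s\in\mathbb R$ let $\mathcal H^{s}$ be the Sobolev space of distributions $f$ on $\mathbb T^2$ with $\|f\|_{\mathcal H^s}^2=\sum_{m\in\mathbb Z^2}(1+4\pi^2|m|^2)^{s}|\hat f(m)|^2<\infty$. Let $X$ be a massive Gaussian free field on $\mathbb T^2$, that is, a random real distribution such that $(\langle X,\varphi\rangle)_{\varphi\in C^\infty(\mathbb T^2;\mathbb R)}$ is a centered Gaussian family with $$\mathbb E[\langle X,\varphi\rangle\langle X,\psi\rangle]=\int_{\mathbb T^2}\int_{\mathbb T^2}\mathcal G(x,y)\varphi(x)\psi(y)\,dx\,dy,\qquad \mathcal G(x,y)=\frac12\sum_{m\in\mathbb Z^2}\frac{e_m(x)\overline{e_m(y)}}{1+4\pi^2|m|^2},$$ where the series converges in $L^2$. Let $0<|\gamma|<\sqrt{8\pi}$ and $\beta\in\left(\frac{\gamma^2}{8\pi},1\right)$. Put $X_n=\sum_{|m|\le n}\hat X(m)e_m$ and $\mathcal R_n=\mathbb E[X_n(x)^2]$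 (which does not depend on $x$). Then $e^{\gamma X_n-\frac{\gamma^2}{2}\mathcal R_n}$ converges in $L^2(\mathbb P;\mathcal H^{-\beta})$ as $n\to\infty$, and its limit $:\!e^{\gamma X}\!:$, the Gaussian multiplicative chaos, satisfies $$\operatorname{Supp}\{\operatorname{Law}(:\!e^{\gamma X}\!:)\}=\{f\in\mathcal H^{-\beta} : f\ge 0\},$$ where the support of a measure $\mu$ on $\mathcal H^{-\beta}$ is the set of all $f$ such that $\mu(U)>0$ for every neighborhood $U$ of $f$, and $f\ge0$ means $\langle f,\varphi\rangle\ge0$ for every nonnegative $\varphi\in C^\infty(\mathbb T^2)$. -/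

import Mathlib

open MeasureTheory ProbabilityTheory Filter UnitAddTorus
open scoped Topology ENNReal ComplexOrder

noncomputable section

namespace TorusGMC

/-! ## The torus, its characters, test functions and distributions -/

/-- The two-dimensional torus `ℝ² / ℤ²`. -/
abbrev T2 : Type := UnitAddTorus (Fin 2)

/-- The index set `ℤ²` of the characters `e_m(x) = exp(2 π i m · x)`, which are
`UnitAddTorus.mFourier m` in Mathlib. -/
abbrev Freq : Type := Fin 2 → ℤ

/-- Lebesgue (Haar probability) measure on the torus. -/
abbrev torusMeasure : Measure T2 := Measure.pi fun _ => AddCircle.haarAddCircle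

/-- A function on the torus, seen as a `ℤ²`-periodic function on the plane. -/
def lift (φ : C(T2, ℂ)) : (Fin 2 → ℝ) → ℂ := fun x => φ fun i => (x i : UnitAddCircle)

lemma lift_add (φ ψ : C(T2, ℂ)) : lift (φ + ψ) = lift φ + lift ψ := rfl

lemma lift_smul (c : ℂ) (φ : C(T2, ℂ)) : lift (c • φ) = c • lift φ := rfl

/-- The space `C^∞(T²)` of (complex-valued) test functions. -/
def TestFunction : Submodule ℂ C(T2, ℂ) where
  carrier := {φ | ContDiff ℝ (⊤ : ℕ∞) (lift φ)}
  add_mem' := by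
    intro φ ψ hφ hψ
    simp only [Set.mem_ofPred_eq, lift_add] at *
    exact hφ.add hψ
  zero_mem' := by
    change ContDiff ℝ (⊤ : ℕ∞) (fun _ => (0 : ℂ))
    exact contDiff_const
  smul_mem' := by
    intro c φ hφ
    simp only [Set.mem_ofPred_eq, lift_smul] at *
    exact contDiff_const.smul hφ

/-- The space `D'(T²)` of distributions: linear functionals on `C^∞(T²)` that are continuous for
the Fréchet topology, i.e. bounded by a `C^k` norm: if all derivatives of `φ` up to order `k` are
at most `B` in norm, then `|u(φ)| ≤ C B`. -/
def Distr : Submodule ℂ (TestFunction →ₗ[ℂ] ℂ) where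
  carrier := {u | ∃ (k : ℕ) (C : ℝ), ∀ (φ : TestFunction) (B : ℝ),
    (∀ j ≤ k, ∀ x, ‖iteratedFDeriv ℝ j (lift φ) x‖ ≤ B) → ‖u φ‖ ≤ C * B}
  add_mem' := by
    rintro u v ⟨k, C, hu⟩ ⟨l, D, hv⟩
    refine ⟨max k l, C + D, fun φ B h => ?_⟩
    have h1 := hu φ B fun j hj => h j (hj.trans (le_max_left _ _))
    have h2 := hv φ B fun j hj => h j (hj.trans (le_max_right _ _))
    calc ‖(u + v) φ‖ ≤ ‖u φ‖ + ‖v φ‖ := norm_add_le _ _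
      _ ≤ (C + D) * B := by linarith
  zero_mem' := ⟨0, 0, fun φ B _ => by simp⟩
  smul_mem' := by
    rintro c u ⟨k, C, hu⟩
    refine ⟨k, ‖c‖ * C, fun φ B h => ?_⟩
    have h1 := hu φ B h
    calc ‖(c • u) φ‖ = ‖c‖ * ‖u φ‖ := by simp
      _ ≤ ‖c‖ * (C * B) := by gcongr
      _ = ‖c‖ * C * B := by ring

/-- The pairing `φ ↦ ∫ f φ dx` of a continuous function `f` with test functions. -/
def ofContinuous (f : C(T2, ℂ)) : Distr :=
  ⟨{ toFun := fun φ => ∫ x, f x * (φ : C(T2, ℂ)) x ∂torusMeasure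
     map_add' := by
      intro φ ψ
      rw [← integral_add]
      · refine integral_congr_ae (.of_forall fun x => ?_)
        simp [mul_add]
      · exact ((f * (φ : C(T2, ℂ))).continuous.integrable_of_hasCompactSupport
          (HasCompactSupport.of_compactSpace _))
      · exact ((f * (ψ : C(T2, ℂ))).continuous.integrable_of_hasCompactSupport
          (HasCompactSupport.of_compactSpace _))
     map_smul' := by
      intro c φ
      simp only [RingHom.id_apply, smul_eq_mul]
      rw [← integral_const_mul]
      refine integral_congr_ae (.of_forall fun x => ?_)
      simp only [Submodule.coe_smul, ContinuousMap.coe_smul, Pi.smul_apply, smul_eq_mul]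
      ring },
   by
    refine ⟨0, ‖f‖, fun φ B h => ?_⟩
    have hB : ∀ x : T2, ‖(φ : C(T2, ℂ)) x‖ ≤ B := by
      intro x
      choose y hy using fun i => QuotientAddGroup.mk_surjective (x i)
      have h0 := h 0 le_rfl y
      rw [norm_iteratedFDeriv_zero] at h0
      have hx : (fun i => ((y i : ℝ) : UnitAddCircle)) = x := funext hy
      simpa [lift, hx] using h0
    have := norm_integral_le_of_norm_le_const (μ := torusMeasure) (C := ‖f‖ * B)
      (f := fun x => f x * (φ : C(T2, ℂ)) x) (.of_forall fun x => by
        rw [norm_mul]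
        exact mul_le_mul (f.norm_coe_le_norm x) (hB x) (norm_nonneg _) (norm_nonneg _))
    simpa using this⟩

/-- The character `e_m` as a test function. -/
def char (m : Freq) : TestFunction :=
  ⟨mFourier m, by
    have h : lift (mFourier m) =
        fun x => ∏ i, Complex.exp (2 * Real.pi * Complex.I * (m i : ℂ) * (x i : ℂ)) := by
      funext x
      simp only [lift, mFourier, ContinuousMap.coe_mk]
      refine Finset.prod_congr rfl fun i _ => ?_
      rw [fourier_coe_apply]
      congr 1
      push_cast
      ring
    change ContDiff ℝ (⊤ : ℕ∞) (lift (mFourier m))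
    rw [h]
    refine contDiff_prod fun i _ => ContDiff.cexp (contDiff_const.mul ?_)
    exact Complex.ofRealCLM.contDiff.comp (contDiff_apply ℝ ℝ i)⟩

/-- The Fourier coefficient `û(m) = u(e_{-m})`, i.e. `∫ f(x) exp(-2 π i m · x) dx` for a
function `f`. -/
def fourierCoeff (u : Distr) (m : Freq) : ℂ := (u : TestFunction →ₗ[ℂ] ℂ) (char (-m))

/-- A distribution is nonnegative if it is nonnegative (in particular real) on nonnegative test
functions. -/
def IsNonneg (u : Distr) : Prop :=
  ∀ φ : TestFunction, (∀ x, 0 ≤ (φ : C(T2, ℂ)) x) → 0 ≤ (u : TestFunction →ₗ[ℂ] ℂ) φ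

/-! ## Sobolev spaces -/

/-- The squared Euclidean norm `|m|²`. -/
def freqSq (m : Freq) : ℤ := m 0 ^ 2 + m 1 ^ 2

/-- The eigenvalue `1 + 4 π² |m|²` of `1 - Δ` at `e_m`. -/
def eigen (m : Freq) : ℝ := 1 + 4 * Real.pi ^ 2 * (freqSq m : ℝ)

lemma one_le_eigen (m : Freq) : 1 ≤ eigen m := by
  have : (0 : ℝ) ≤ (freqSq m : ℝ) := by
    unfold freqSq; push_cast; positivity
  unfold eigen
  have := mul_nonneg (by positivity : (0 : ℝ) ≤ 4 * Real.pi ^ 2) this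
  linarith

/-- The sequence `(1 + 4 π² |m|²)^{s/2} û(m)`. -/
def weightedCoeff (s : ℝ) (u : Distr) (m : Freq) : ℂ :=
  ((eigen m ^ (s / 2) : ℝ) : ℂ) * fourierCoeff u m

lemma weightedCoeff_add (s : ℝ) (u v : Distr) :
    weightedCoeff s (u + v) = weightedCoeff s u + weightedCoeff s v := by
  funext m
  simp [weightedCoeff, fourierCoeff, mul_add]

lemma weightedCoeff_smul (s : ℝ) (c : ℂ) (u : Distr) :
    weightedCoeff s (c • u) = c • weightedCoeff s u := by
  funext m
  simp [weightedCoeff, fourierCoeff]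
  ring

/-- The Sobolev space `H^s(T²)`: the distributions `u` with
`∑_m (1 + 4 π² |m|²)^s |û(m)|² < ∞`. -/
def Sobolev (s : ℝ) : Submodule ℂ Distr where
  carrier := {u | Memℓp (weightedCoeff s u) 2}
  add_mem' := by
    intro u v hu hv
    simp only [Set.mem_ofPred_eq, weightedCoeff_add] at *
    exact hu.add hv
  zero_mem' := by
    have h : weightedCoeff s 0 = 0 := by
      funext m
      simp [weightedCoeff, fourierCoeff]
    simp only [Set.mem_ofPred_eq, h]
    exact zero_memℓp
  smul_mem' := by
    intro c u hu
    simp only [Set.mem_ofPred_eq, weightedCoeff_smul] at *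
    exact hu.const_smul c

/-- The linear map `u ↦ ((1 + 4 π² |m|²)^{s/2} û(m))_m` from `H^s` to `ℓ²(ℤ²)`. -/
def Sobolev.toEll2 (s : ℝ) : Sobolev s →ₗ[ℂ] lp (fun _ : Freq => ℂ) 2 where
  toFun u := ⟨weightedCoeff s u, u.2⟩
  map_add' u v := Subtype.ext (weightedCoeff_add s u v)
  map_smul' c u := Subtype.ext (weightedCoeff_smul s c u)

/-- The norm of `H^s`: `‖u‖² = ∑_m (1 + 4 π² |m|²)^s |û(m)|²`. -/
instance Sobolev.instSeminormedAddCommGroup (s : ℝ) : SeminormedAddCommGroup (Sobolev s) :=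
  SeminormedAddCommGroup.induced (Sobolev s) (lp (fun _ : Freq => ℂ) 2) (Sobolev.toEll2 s)

/-- `H^s` carries its Borel σ-algebra. -/
instance Sobolev.instMeasurableSpace (s : ℝ) : MeasurableSpace (Sobolev s) := borel _

instance Sobolev.instBorelSpace (s : ℝ) : BorelSpace (Sobolev s) := ⟨rfl⟩

/-! ## The massive Gaussian free field -/

lemma sq_norm_le_eigen (m : Freq) : ‖m‖ ^ 2 ≤ 2 * eigen m := by
  have h : ∀ i, (m i : ℝ) ^ 2 ≤ (m 0 : ℝ) ^ 2 + (m 1 : ℝ) ^ 2 := by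
    intro i
    fin_cases i
    · simpa using sq_nonneg (m 1 : ℝ)
    · simpa using sq_nonneg (m 0 : ℝ)
  have h1 : ‖m‖ ≤ Real.sqrt ((m 0 : ℝ) ^ 2 + (m 1 : ℝ) ^ 2) := by
    refine (pi_norm_le_iff_of_nonneg (Real.sqrt_nonneg _)).2 fun i => ?_
    rw [Int.norm_eq_abs]
    exact Real.abs_le_sqrt (h i)
  have h2 : ‖m‖ ^ 2 ≤ (m 0 : ℝ) ^ 2 + (m 1 : ℝ) ^ 2 :=
    (Real.le_sqrt (norm_nonneg _) (by positivity)).1 h1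
  have h3 : eigen m = 1 + 4 * Real.pi ^ 2 * ((m 0 : ℝ) ^ 2 + (m 1 : ℝ) ^ 2) := by
    simp [eigen, freqSq]
  have h4 : (9 : ℝ) ≤ Real.pi ^ 2 := by nlinarith [Real.pi_gt_three]
  rw [h3]
  nlinarith [mul_nonneg (sub_nonneg.2 h4)
    (by positivity : (0 : ℝ) ≤ (m 0 : ℝ) ^ 2 + (m 1 : ℝ) ^ 2),
    (by positivity : (0 : ℝ) ≤ (m 0 : ℝ) ^ 2 + (m 1 : ℝ) ^ 2)]

lemma memℓp_green : Memℓp (fun m : Freq => ((1 / (2 * eigen m) : ℝ) : ℂ)) 2 := by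
  refine memℓp_gen ?_
  have hs := EisensteinSeries.summable_one_div_norm_rpow (k := 4) (by norm_num)
  refine hs.of_norm_bounded_eventually ?_
  have h0 : ∀ᶠ m : Freq in cofinite, m ≠ 0 := (Set.finite_singleton (0 : Freq)).compl_mem_cofinite
  filter_upwards [h0] with m hm
  have hpos : 0 < ‖m‖ := norm_pos_iff.2 hm
  have he : 0 < eigen m := lt_of_lt_of_le one_pos (one_le_eigen m)
  have h1 : (1 / (2 * eigen m)) ≤ (‖m‖ ^ 2)⁻¹ := by
    rw [one_div]
    exact inv_anti₀ (by positivity) (sq_norm_le_eigen m)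
  have h2 : ‖m‖ ^ (-4 : ℝ) = ((‖m‖ ^ 2)⁻¹) ^ 2 := by
    rw [Real.rpow_neg hpos.le, inv_pow, ← pow_mul, ← Real.rpow_natCast]
    norm_num
  have h3 : ‖‖((1 / (2 * eigen m) : ℝ) : ℂ)‖ ^ (2 : ℝ≥0∞).toReal‖ = (1 / (2 * eigen m)) ^ 2 := by
    rw [Complex.norm_real, Real.norm_of_nonneg (by positivity), ENNReal.toReal_ofNat,
      Real.rpow_two, Real.norm_of_nonneg (by positivity)]
  rw [h2, h3]
  gcongr

/-- The function `x ↦ ½ ∑_m e_m(x) / (1 + 4 π² |m|²)` in `L²(T²)`, the series being convergent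
in `L²`. -/
def greenFunction : Lp ℂ 2 torusMeasure :=
  (mFourierBasis (d := Fin 2)).repr.symm ⟨_, memℓp_green⟩

/-- The Green's function
`𝒢(x, y) = ½ ∑_m e_m(x) conj(e_m(y)) / (1 + 4 π² |m|²) = ½ ∑_m e_m(x - y) / (1 + 4 π² |m|²)`. -/
def greenKernel (x y : T2) : ℂ := greenFunction (x - y)

/-- The real-valued test functions. -/
abbrev RealTestFunction : Type :=
  {φ : TestFunction // ∀ x, ((φ : C(T2, ℂ)) x).im = 0}

variable {Ω : Type*} [MeasurableSpace Ω]

/-- `X` is a massive Gaussian free field on the torus: a random real distribution such that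
`(⟨X, φ⟩)_φ`, `φ` ranging over the real test functions, is a centered Gaussian family with
`𝔼[⟨X, φ⟩ ⟨X, ψ⟩] = ∫∫ 𝒢(x, y) φ(x) ψ(y) dx dy`. -/
structure IsMassiveGFF (X : Ω → Distr) (P : Measure Ω) : Prop where
  isReal : ∀ φ : RealTestFunction, ∀ᵐ ω ∂P, ((X ω : TestFunction →ₗ[ℂ] ℂ) φ).im = 0
  gaussian : IsGaussianProcess
    (fun (φ : RealTestFunction) ω => ((X ω : TestFunction →ₗ[ℂ] ℂ) φ).re) P
  centered : ∀ φ : RealTestFunction, ∫ ω, ((X ω : TestFunction →ₗ[ℂ] ℂ) φ).re ∂P = 0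
  covariance : ∀ φ ψ : RealTestFunction,
    ((∫ ω, ((X ω : TestFunction →ₗ[ℂ] ℂ) φ).re * ((X ω : TestFunction →ₗ[ℂ] ℂ) ψ).re ∂P : ℝ) : ℂ) =
      ∫ x, ∫ y, greenKernel x y * (φ.1 : C(T2, ℂ)) x * (ψ.1 : C(T2, ℂ)) y
        ∂torusMeasure ∂torusMeasure

/-! ## The Gaussian multiplicative chaos -/

/-- The frequencies `m` with `|m| ≤ n`. -/
def freqBall (n : ℕ) : Finset Freq :=
  (Fintype.piFinset fun _ : Fin 2 => Finset.Icc (-(n : ℤ)) n).filter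
    fun m => freqSq m ≤ (n : ℤ) ^ 2

/-- The truncation `Π_n u = ∑_{|m| ≤ n} û(m) e_m`. -/
def truncate (n : ℕ) (u : Distr) : C(T2, ℂ) :=
  ∑ m ∈ freqBall n, fourierCoeff u m • mFourier m

/-- The variance `ℛ_n = 𝔼[X_n(x)²]` of `X_n = Π_n X`. For the massive Gaussian free field it does
not depend on the point `x`, which is taken to be `0` here. -/
def truncVariance (X : Ω → Distr) (P : Measure Ω) (n : ℕ) : ℂ :=
  ∫ ω, (truncate n (X ω) 0) ^ 2 ∂P

/-- The truncated Wick exponential `exp(γ X_n - (γ² / 2) ℛ_n)`, a function on the torus. -/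
def wickExp (X : Ω → Distr) (P : Measure Ω) (γ : ℝ) (n : ℕ) (ω : Ω) : C(T2, ℂ) where
  toFun x := Complex.exp (γ * truncate n (X ω) x - γ ^ 2 / 2 * truncVariance X P n)
  continuous_toFun := by fun_prop

/-- `M` is the Gaussian multiplicative chaos `:e^{γX}:`, i.e. the limit in `L²(P; H^s)` of the
truncated Wick exponentials. -/
def IsGMC (X : Ω → Distr) (P : Measure Ω) (γ s : ℝ) (M : Ω → Sobolev s) : Prop :=
  MemLp M 2 P ∧
  ∃ W : ℕ → Ω → Sobolev s,
    (∀ n ω, (W n ω : Distr) = ofContinuous (wickExp X P γ n ω)) ∧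
    (∀ n, MemLp (W n) 2 P) ∧
    Tendsto (fun n => eLpNorm (W n - M) 2 P) atTop (𝓝 0)

end TorusGMC

end

open MeasureTheory ProbabilityTheory Filter UnitAddTorus
open scoped Topology ENNReal ComplexOrder

noncomputable section

namespace TorusGMC

/-! In the real orthonormal system of Hartley functions cos(2πm·x) + sin(2πm·x) the field has
independent centered Gaussian coefficients of variance 1/(2(1+4π²|m|²)) (`exists_gaussianCoeffs`).
Hence the truncated chaos W_F is almost surely an explicit positive function of these coefficients,
and it factorizes into independent pieces over disjoint blocks of frequencies.

Existence is a second moment computation. For F and F' symmetric under m ↦ -m, the expectation of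
Ŵ_F(m) Ŵ_F'(-m) is the m-th Fourier coefficient of exp(γ² G), where G is the Green's function
truncated to F ∩ F' (`IsGaussianCoeffs.integral_coef_mul`). Increments are therefore orthogonal, and
the squared distance in L²(P; H^s) between W_F and W_F', F ⊆ F', is a difference of the masses
`chaosMass`. Functions with nonnegative Fourier coefficients form a cone stable under products and
exponentials, so the mass increases with F, and only a uniform bound is missing
(`exists_sum_chaosCoef_le`). By positivity γ² G can be replaced by 8πa times the heat-regularized
Green's function, with γ²/8π < a < β. The heat kernel is a product of circle heat kernels, and the
arithmetic-geometric mean inequality bounds the regularized Green's function by a constant minus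
(8π)⁻¹(log|x₀| + log|x₁|); its exponential is at most a constant times |x₀|^{-a} |x₁|^{-a}. Writing
the weight λ^{-β} as a Gamma integral of e^{-tλ} turns the mass into an integral of t^{β-1-a} near
0, finite because a < β.

The support lies in the nonnegative cone because that cone is closed and contains every truncated
chaos. Conversely, the functions exp(γp), p a real trigonometric polynomial, are dense in the cone:
Fejér means of a nonnegative distribution are nonnegative functions, adding a small constant makes
them positive, and their logarithms are approximated uniformly (`mem_closure_expTrig`). Each exp(γp)
is in the support (`IsGaussianCoeffs.exists_le_measure`). Cut the chaos at a large n. With positive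
probability the finitely many low coefficients are so close to prescribed values that the low part
is nearly exp(γp). Independently, with probability at least 1/2, the high-frequency factor is close
to 1 in H^s, uniformly in the final truncation; this uses that (e^f - 1)(e^g - 1) has nonnegative
coefficients. Multiplication by exponentials of trigonometric polynomials is bounded on H^s, so the
product is close to exp(γp), and the uniform lower bound on the probability passes to the limit. -/

/-! ## Fourier coefficients on the torus -/

/-- The Fourier coefficient `∫ f(x) e_{-m}(x) dx` of a function. -/
def coef (f : T2 → ℂ) (m : Freq) : ℂ := ∫ x, f x * mFourier (-m) x ∂torusMeasure

lemma fourierCoeff_ofContinuous (f : C(T2, ℂ)) (m : Freq) :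
    fourierCoeff (ofContinuous f) m = coef f m := rfl

lemma coef_eq_mFourierCoeff (f : T2 → ℂ) : coef f = mFourierCoeff f := by
  funext m
  simp only [coef, mFourierCoeff, smul_eq_mul, mul_comm]
  rfl

lemma integrable_continuousMap (f : C(T2, ℂ)) : Integrable f torusMeasure :=
  f.continuous.integrable_of_hasCompactSupport (HasCompactSupport.of_compactSpace _)

lemma mFourier_add_apply (m : Freq) (x y : T2) :
    mFourier m (x + y) = mFourier m x * mFourier m y := by
  simp [mFourier, fourier_apply, smul_add, AddCircle.toCircle_add]
  ring

lemma norm_mFourier_apply (m : Freq) (x : T2) : ‖mFourier m x‖ = 1 := by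
  simp only [mFourier, fourier_apply, ContinuousMap.coe_mk, norm_prod, Circle.norm_coe,
    Finset.prod_const_one]

lemma mFourier_neg_apply (m : Freq) (x : T2) : mFourier m (-x) = mFourier (-m) x := by
  simp [mFourier, fourier_apply]

lemma mFourier_mul_mFourier (m l : Freq) : mFourier m * mFourier l = mFourier (m + l) := by
  ext x
  rw [ContinuousMap.mul_apply, mFourier_add]

/-- The half period `1 / (2 m_i)` in direction `i`. -/
def halfShift (m : Freq) (i : Fin 2) : Fin 2 → ℝ := Pi.single i (1 / (2 * (m i : ℝ)))

/-- The projection of the plane onto the torus. -/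
def toTorus (y : Fin 2 → ℝ) : T2 := fun i => (y i : UnitAddCircle)

lemma toTorus_surjective : Function.Surjective toTorus := by
  intro x
  choose y hy using fun i => QuotientAddGroup.mk_surjective (x i)
  exact ⟨y, funext hy⟩

lemma mFourier_toTorus (m : Freq) (y : Fin 2 → ℝ) :
    mFourier m (toTorus y) =
      Complex.exp (2 * Real.pi * Complex.I * (m 0 * y 0 + m 1 * y 1 : ℝ)) := by
  simp only [mFourier, ContinuousMap.coe_mk, Fin.prod_univ_two, toTorus, fourier_coe_apply]
  rw [← Complex.exp_add]
  congr 1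
  push_cast
  ring

/-- A half-period translation flips the sign of e_m. Differencing along it multiplies the m-th
coefficient by -2, which replaces integration by parts below. -/
lemma mFourier_halfShift (m : Freq) (i : Fin 2) (h : m i ≠ 0) :
    mFourier m (toTorus (halfShift m i)) = -1 := by
  have h' : (m i : ℝ) ≠ 0 := by exact_mod_cast h
  rw [mFourier_toTorus]
  have : (m 0 * halfShift m i 0 + m 1 * halfShift m i 1 : ℝ) = 1 / 2 := by
    fin_cases i <;> simp [halfShift] at h' ⊢ <;> field_simp
  rw [this, ← Complex.exp_pi_mul_I]
  congr 1
  push_cast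
  ring

lemma coef_shift (f : C(T2, ℂ)) (τ : T2) (m : Freq) :
    coef (fun x => f (x + τ)) m = mFourier m τ * coef f m := by
  have h1 : ∀ x, f (x + τ) * mFourier (-m) x =
      mFourier m τ * (f (x + τ) * mFourier (-m) (x + τ)) := by
    intro x
    have h2 : mFourier m τ * mFourier (-m) τ = 1 := by
      rw [← mFourier_add]; simp [mFourier_zero]
    rw [mFourier_add_apply]
    linear_combination (-(f (x + τ) * mFourier (-m) x)) * h2
  simp only [coef, h1]
  rw [integral_const_mul,
    integral_add_right_eq_self (μ := torusMeasure) (fun x => f x * mFourier (-m) x) τ]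

lemma coef_add (f g : C(T2, ℂ)) (m : Freq) : coef (f + g : C(T2, ℂ)) m = coef f m + coef g m := by
  simp only [coef, ContinuousMap.add_apply, add_mul]
  exact integral_add (integrable_continuousMap (f * mFourier (-m)))
    (integrable_continuousMap (g * mFourier (-m)))

lemma coef_smul (c : ℂ) (f : C(T2, ℂ)) (m : Freq) : coef (c • f : C(T2, ℂ)) m = c * coef f m := by
  simp only [coef, ContinuousMap.smul_apply, smul_eq_mul, mul_assoc]
  exact integral_const_mul _ _

lemma coef_sub (f g : C(T2, ℂ)) (m : Freq) : coef (f - g : C(T2, ℂ)) m = coef f m - coef g m := by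
  simp only [coef, ContinuousMap.sub_apply, sub_mul]
  exact integral_sub (integrable_continuousMap (f * mFourier (-m)))
    (integrable_continuousMap (g * mFourier (-m)))

lemma norm_coef_le {f : T2 → ℂ} {B : ℝ} (h : ∀ x, ‖f x‖ ≤ B) (m : Freq) : ‖coef f m‖ ≤ B := by
  have := norm_integral_le_of_norm_le_const (μ := torusMeasure) (C := B)
    (f := fun x => f x * mFourier (-m) x) (.of_forall fun x => by
      rw [norm_mul, norm_mFourier_apply, mul_one]; exact h x)
  simpa only [coef, probReal_univ, mul_one] using this

lemma integral_mFourier (m : Freq) :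
    ∫ x, mFourier m x ∂torusMeasure = if m = 0 then 1 else 0 := by
  split_ifs with h
  · subst h
    simp [mFourier_zero]
  · obtain ⟨i, hi⟩ := Function.ne_iff.1 h
    have h1 := coef_shift 1 (toTorus (halfShift (-m) i)) (-m)
    rw [mFourier_halfShift (-m) i (by simpa using hi)] at h1
    simp only [coef, ContinuousMap.one_apply, neg_neg, one_mul] at h1
    exact self_eq_neg.1 (by linear_combination h1)

lemma coef_mFourier (l m : Freq) : coef (mFourier l) m = if l = m then 1 else 0 := by
  simp only [coef, ← mFourier_add, integral_mFourier, ← sub_eq_add_neg, sub_eq_zero]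

/-! ## Decay of the Fourier coefficients of test functions -/

/-- Mean value inequality, k times: each difference with step `w` gains a factor `‖w‖` and costs one
derivative. -/
lemma norm_diff_iterate_le (k : ℕ) (w : Fin 2 → ℝ) (B : ℝ) :
    ∀ F : (Fin 2 → ℝ) → ℂ, ContDiff ℝ (⊤ : ℕ∞) F → (∀ y, ‖iteratedFDeriv ℝ k F y‖ ≤ B) →
    ∀ y, ‖((fun G : (Fin 2 → ℝ) → ℂ => fun y => G (y + w) - G y)^[k]) F y‖ ≤ ‖w‖ ^ k * B := by
  induction k generalizing B with
  | zero =>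
    intro F hF h y
    simpa using h y
  | succ k ih =>
    intro F hF h y
    rw [Function.iterate_succ_apply, pow_succ, mul_assoc]
    have hsh : ContDiff ℝ (⊤ : ℕ∞) (fun y => F (y + w)) :=
      hF.comp (contDiff_id.add contDiff_const)
    -- The induction hypothesis is applied to the first difference of `F`, whose k-th derivative is
    -- controlled by the (k+1)-st derivative of `F`.
    refine ih (‖w‖ * B) _ (hsh.sub hF) (fun z => ?_) y
    have hk : ((k : ℕ∞) : WithTop ℕ∞) ≤ ((⊤ : ℕ∞) : WithTop ℕ∞) := by exact_mod_cast le_top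
    have hsub : iteratedFDeriv ℝ k (fun y => F (y + w) - F y) z =
        iteratedFDeriv ℝ k F (z + w) - iteratedFDeriv ℝ k F z := by
      have := iteratedFDeriv_sub_apply (i := k) (x := z) (𝕜 := ℝ) (f := fun y => F (y + w)) (g := F)
        (hsh.of_le hk).contDiffAt (hF.of_le hk).contDiffAt
      rw [iteratedFDeriv_comp_add_right] at this
      exact this
    rw [hsub, mul_comm]
    have hd : ∀ x ∈ (Set.univ : Set (Fin 2 → ℝ)), DifferentiableAt ℝ (iteratedFDeriv ℝ k F) x :=
      fun x _ => (hF.differentiable_iteratedFDeriv (by exact_mod_cast ENat.natCast_lt_top k)) x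
    have := Convex.norm_image_sub_le_of_norm_fderiv_le (s := Set.univ) hd (C := B)
      (fun x _ => by rw [norm_fderiv_iteratedFDeriv]; exact h x) convex_univ
      (Set.mem_univ z) (Set.mem_univ (z + w))
    simpa using this

/-- The difference operator `f ↦ f(· + τ) - f` on the torus. -/
def diffOp (τ : T2) (f : C(T2, ℂ)) : C(T2, ℂ) :=
  f.comp ⟨fun x => x + τ, by fun_prop⟩ - f

lemma lift_diffOp (w : Fin 2 → ℝ) (f : C(T2, ℂ)) :
    lift (diffOp (toTorus w) f) = fun y => lift f (y + w) - lift f y := by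
  funext y
  simp only [lift, diffOp, ContinuousMap.sub_apply, ContinuousMap.comp_apply, ContinuousMap.coe_mk,
    Pi.add_apply, AddCircle.coe_add]
  rfl

lemma lift_diffOp_iterate (w : Fin 2 → ℝ) (k : ℕ) : ∀ f : C(T2, ℂ),
    lift ((diffOp (toTorus w))^[k] f) =
      ((fun G : (Fin 2 → ℝ) → ℂ => fun y => G (y + w) - G y)^[k]) (lift f) := by
  induction k with
  | zero => intro f; rfl
  | succ k ih => intro f; rw [Function.iterate_succ_apply, Function.iterate_succ_apply, ih,
      lift_diffOp]

lemma coef_diffOp_iterate (τ : T2) (m : Freq) (k : ℕ) : ∀ f : C(T2, ℂ),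
    coef ((diffOp τ)^[k] f) m = (mFourier m τ - 1) ^ k * coef f m := by
  induction k with
  | zero => intro f; simp
  | succ k ih =>
    intro f
    rw [Function.iterate_succ_apply, ih, diffOp, coef_sub]
    have := coef_shift f τ m
    rw [show coef (f.comp ⟨fun x => x + τ, by fun_prop⟩ : C(T2, ℂ)) m = _ from this]
    ring

/-- Taking k differences along the half period multiplies the coefficient by (-2)^k, while the
result has size at most (2‖m‖)^{-k} times the bound of the k-th derivative. -/
lemma norm_coef_testFunction_le (φ : TestFunction) (k : ℕ) (B : ℝ)
    (h : ∀ x, ‖iteratedFDeriv ℝ k (lift φ) x‖ ≤ B) (m : Freq) :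
    ‖m‖ ^ k * ‖coef (φ : C(T2, ℂ)) m‖ ≤ B := by
  have hB : 0 ≤ B := (norm_nonneg _).trans (h 0)
  by_cases hm : m = 0
  · subst hm
    rcases Nat.eq_zero_or_pos k with rfl | hk
    · rw [pow_zero, one_mul]
      refine norm_coef_le (fun x => ?_) 0
      obtain ⟨y, rfl⟩ := toTorus_surjective x
      have := h y
      rwa [norm_iteratedFDeriv_zero] at this
    · simpa [hk.ne'] using hB
  -- Choosing a coordinate where the sup norm is attained makes the half period equal to 1/(2‖m‖).
  obtain ⟨i, hi⟩ : ∃ i, ‖m‖ = ‖m i‖ := by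
    obtain ⟨i, -, hi⟩ := Finset.exists_mem_eq_sup' (Finset.univ_nonempty (α := Fin 2))
      (fun i => ‖m i‖₊)
    exact ⟨i, by rw [Pi.norm_def, ← Finset.sup'_eq_sup Finset.univ_nonempty, hi]; rfl⟩
  have hmi : m i ≠ 0 := by
    intro h0
    rw [h0, norm_zero, norm_eq_zero] at hi
    exact hm hi
  have hpos : 0 < ‖m i‖ := norm_pos_iff.2 hmi
  set w := halfShift m i with hw
  have hwn : ‖w‖ = 1 / (2 * ‖m‖) := by
    rw [hi, hw, halfShift, Pi.norm_single, norm_div, norm_mul]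
    simp [Int.norm_eq_abs]
  have h1 := norm_coef_le (f := ((diffOp (toTorus w))^[k] (φ : C(T2, ℂ)))) (B := ‖w‖ ^ k * B)
    (fun x => by
      obtain ⟨y, rfl⟩ := toTorus_surjective x
      have := norm_diff_iterate_le k w B _ φ.2 h y
      rw [← lift_diffOp_iterate] at this
      exact this) m
  rw [coef_diffOp_iterate, mFourier_halfShift m i hmi, norm_mul, norm_pow, hwn, hi] at h1
  rw [hi]
  have h2 : ‖(-1 - 1 : ℂ)‖ = 2 := by norm_num
  rw [h2, div_pow, one_pow, div_mul_eq_mul_div, one_mul, le_div_iff₀ (by positivity)] at h1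
  refine le_trans ?_ h1
  have h3 : (1 : ℝ) ≤ 2 ^ k * 2 ^ k := by
    have := one_le_pow₀ (a := (2 : ℝ)) (n := k) (by norm_num)
    nlinarith
  calc ‖m i‖ ^ k * ‖coef (φ : C(T2, ℂ)) m‖
      ≤ (2 ^ k * 2 ^ k) * (‖m i‖ ^ k * ‖coef (φ : C(T2, ℂ)) m‖) :=
        le_mul_of_one_le_left (by positivity) h3
    _ = _ := by rw [mul_pow]; ring

/-- By periodicity it suffices to bound the continuous derivative on the compact unit square. -/
lemma exists_bound_iteratedFDeriv (φ : TestFunction) (k : ℕ) :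
    ∃ B, ∀ x, ‖iteratedFDeriv ℝ k (lift φ) x‖ ≤ B := by
  have hk : ((k : ℕ∞) : WithTop ℕ∞) ≤ ((⊤ : ℕ∞) : WithTop ℕ∞) := by exact_mod_cast le_top
  have hc : Continuous (iteratedFDeriv ℝ k (lift φ)) := φ.2.continuous_iteratedFDeriv hk
  obtain ⟨B, hB⟩ := (isCompact_Icc (a := (0 : Fin 2 → ℝ)) (b := 1)).exists_bound_of_continuousOn
    hc.continuousOn
  refine ⟨B, fun x => ?_⟩
  let y : Fin 2 → ℝ := fun i => -(⌊x i⌋ : ℝ)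
  have hper : ∀ z, lift φ (z + y) = lift φ z := by
    intro z
    simp only [lift]
    congr 1
    funext i
    have : (((⌊x i⌋ : ℤ) : ℝ) : UnitAddCircle) = 0 := by
      have := AddCircle.coe_eq_zero_iff (p := (1 : ℝ)) (x := ((⌊x i⌋ : ℤ) : ℝ))
      exact this.2 ⟨⌊x i⌋, by simp⟩
    simp [y]
  have h1 : iteratedFDeriv ℝ k (lift φ) x = iteratedFDeriv ℝ k (lift φ) (x + y) := by
    rw [← iteratedFDeriv_comp_add_right]
    congr 1
    exact (funext hper).symm
  rw [h1]
  refine hB _ ⟨fun i => ?_, fun i => ?_⟩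
  · simpa [y] using Int.floor_le (x i)
  · have := (Int.fract_lt_one (x i)).le
    rw [Int.fract] at this
    simpa [y, ← sub_eq_add_neg] using this

/-! ## Fourier series of test functions and Sobolev spaces -/

lemma summable_inv_one_add_norm : Summable fun m : Freq => ((1 + ‖m‖) ^ 3)⁻¹ := by
  have hs := EisensteinSeries.summable_one_div_norm_rpow (k := 3) (by norm_num)
  refine hs.of_norm_bounded_eventually ?_
  have h0 : ∀ᶠ m : Freq in cofinite, m ≠ 0 := (Set.finite_singleton (0 : Freq)).compl_mem_cofinite
  filter_upwards [h0] with m hm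
  have hpos : 0 < ‖m‖ := norm_pos_iff.2 hm
  rw [Real.rpow_neg hpos.le, Real.norm_of_nonneg (by positivity)]
  refine inv_anti₀ (by positivity) ?_
  rw [show (3 : ℝ) = ((3 : ℕ) : ℝ) by norm_num, Real.rpow_natCast]
  gcongr
  linarith

lemma norm_coef_testFunction_le' (φ : TestFunction) (k : ℕ) (B : ℝ)
    (h0 : ∀ x, ‖iteratedFDeriv ℝ 0 (lift φ) x‖ ≤ B)
    (h : ∀ x, ‖iteratedFDeriv ℝ k (lift φ) x‖ ≤ B) (m : Freq) :
    ‖coef (φ : C(T2, ℂ)) m‖ ≤ 2 ^ (k + 1) * B * ((1 + ‖m‖) ^ k)⁻¹ := by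
  have h1 := norm_coef_testFunction_le φ 0 B h0 m
  have h2 := norm_coef_testFunction_le φ k B h m
  rw [pow_zero, one_mul] at h1
  rw [← div_eq_mul_inv, le_div_iff₀ (by positivity)]
  have h3 : (1 + ‖m‖) ^ k ≤ 2 ^ k * (1 + ‖m‖ ^ k) := by
    rcases Nat.eq_zero_or_pos k with rfl | hk
    · simp
    have := add_pow_le (zero_le_one (α := ℝ)) (norm_nonneg m) k
    rw [one_pow] at this
    refine this.trans ?_
    gcongr
    · norm_num
    · omega
  calc ‖coef (φ : C(T2, ℂ)) m‖ * (1 + ‖m‖) ^ k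
      ≤ ‖coef (φ : C(T2, ℂ)) m‖ * (2 ^ k * (1 + ‖m‖ ^ k)) := by gcongr
    _ = 2 ^ k * (‖coef (φ : C(T2, ℂ)) m‖ + ‖m‖ ^ k * ‖coef (φ : C(T2, ℂ)) m‖) := by ring
    _ ≤ 2 ^ k * (B + B) := by gcongr
    _ = 2 ^ (k + 1) * B := by ring

lemma eigen_pos (m : Freq) : 0 < eigen m := one_pos.trans_le (one_le_eigen m)

lemma eigen_neg (m : Freq) : eigen (-m) = eigen m := by
  simp [eigen, freqSq]

lemma eigen_le (m : Freq) : eigen m ≤ 80 * (1 + ‖m‖) ^ 2 := by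
  have h : ∀ i, (m i : ℝ) ^ 2 ≤ ‖m‖ ^ 2 := fun i => by
    have h1 : |(m i : ℝ)| ≤ ‖m‖ := norm_le_pi_norm m i
    exact sq_le_sq' (neg_le_of_abs_le h1) (le_of_abs_le h1)
  have h4 : Real.pi ^ 2 ≤ 10 := by nlinarith [Real.pi_lt_d2, Real.pi_pos]
  have h5 : (freqSq m : ℝ) ≤ 2 * ‖m‖ ^ 2 := by
    have := h 0; have := h 1
    simp only [freqSq]; push_cast; linarith
  have h6 : (0 : ℝ) ≤ (freqSq m : ℝ) := by unfold freqSq; push_cast; positivity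
  have : 4 * Real.pi ^ 2 * (freqSq m : ℝ) ≤ 4 * 10 * (2 * ‖m‖ ^ 2) := by gcongr
  unfold eigen
  nlinarith [norm_nonneg m]

lemma contDiff_lift (φ : TestFunction) : ContDiff ℝ (⊤ : ℕ∞) (lift φ) := φ.2

lemma contDiff_lift_mFourier (m : Freq) (n : ℕ∞) : ContDiff ℝ n (lift (mFourier m)) :=
  (contDiff_lift (char m)).of_le (by exact_mod_cast le_top)

lemma lift_mFourier (m : Freq) : lift (mFourier m) =
    (fun z : ℝ => Complex.exp ((2 * Real.pi * Complex.I) * z)) ∘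
      ((m 0 : ℝ) • ContinuousLinearMap.proj (R := ℝ) (φ := fun _ : Fin 2 => ℝ) 0 +
        (m 1 : ℝ) • ContinuousLinearMap.proj (R := ℝ) (φ := fun _ : Fin 2 => ℝ) 1) := by
  funext y
  exact mFourier_toTorus m y

lemma iteratedDeriv_cexp_ofReal (n : ℕ) (c : ℂ) :
    iteratedDeriv n (fun z : ℝ => Complex.exp (c * z)) = fun z : ℝ => c ^ n * Complex.exp (c * z) := by
  induction n with
  | zero => simp
  | succ n ih =>
    rw [iteratedDeriv_succ, ih]
    funext z
    have h1 : HasDerivAt (fun z : ℝ => c * (z : ℂ)) c z := by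
      simpa using (Complex.ofRealCLM.hasDerivAt (x := z)).const_mul c
    rw [((h1.cexp).const_mul (c ^ n)).deriv]
    ring

/-- The character is z ↦ exp(2πiz) composed with a linear form of norm at most 2‖m‖. -/
lemma norm_iteratedFDeriv_lift_mFourier_le (m : Freq) (j : ℕ) (x : Fin 2 → ℝ) :
    ‖iteratedFDeriv ℝ j (lift (mFourier m)) x‖ ≤ (4 * Real.pi * ‖m‖) ^ j := by
  rw [lift_mFourier]
  set L := ((m 0 : ℝ) • ContinuousLinearMap.proj (R := ℝ) (φ := fun _ : Fin 2 => ℝ) 0 +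
        (m 1 : ℝ) • ContinuousLinearMap.proj (R := ℝ) (φ := fun _ : Fin 2 => ℝ) 1) with hL
  have hLn : ‖L‖ ≤ 2 * ‖m‖ := by
    refine L.opNorm_le_bound (by positivity) fun y => ?_
    have h0 : |(m 0 : ℝ)| ≤ ‖m‖ := norm_le_pi_norm m 0
    have h1 : |(m 1 : ℝ)| ≤ ‖m‖ := norm_le_pi_norm m 1
    have h2 : |y 0| ≤ ‖y‖ := norm_le_pi_norm y 0
    have h3 : |y 1| ≤ ‖y‖ := norm_le_pi_norm y 1
    calc ‖L y‖ = |m 0 * y 0 + m 1 * y 1| := by simp [hL]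
      _ ≤ |(m 0 : ℝ)| * |y 0| + |(m 1 : ℝ)| * |y 1| := by
        rw [← abs_mul, ← abs_mul]; exact abs_add_le _ _
      _ ≤ ‖m‖ * ‖y‖ + ‖m‖ * ‖y‖ := by gcongr
      _ = 2 * ‖m‖ * ‖y‖ := by ring
  have hf : ContDiff ℝ (j : WithTop ℕ∞)
      (fun z : ℝ => Complex.exp ((2 * Real.pi * Complex.I) * z)) :=
    (contDiff_const.mul Complex.ofRealCLM.contDiff).cexp
  rw [L.iteratedFDeriv_comp_right hf x le_rfl]
  refine (ContinuousMultilinearMap.norm_compContinuousLinearMap_le _ _).trans ?_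
  rw [norm_iteratedFDeriv_eq_norm_iteratedDeriv, iteratedDeriv_cexp_ofReal, norm_mul, norm_pow,
    Finset.prod_const, Finset.card_univ, Fintype.card_fin, Complex.norm_exp]
  have hre : ((2 * Real.pi * Complex.I) * ((L x : ℝ) : ℂ)).re = 0 := by simp
  have hn : ‖(2 * Real.pi * Complex.I : ℂ)‖ = 2 * Real.pi := by
    simp [abs_of_pos Real.pi_pos]
  rw [hre, Real.exp_zero, mul_one, hn, ← mul_pow]
  refine pow_le_pow_left₀ (by positivity) ?_ _
  nlinarith [Real.pi_pos]

lemma norm_sub_sum_le {E ι : Type*} [NormedAddCommGroup E] [CompleteSpace E] {f : ι → E} {v : ι → ℝ}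
    (hv : Summable v) (h : ∀ i, ‖f i‖ ≤ v i) (s : Finset ι) :
    ‖∑' i, f i - ∑ i ∈ s, f i‖ ≤ ∑' i : {i // i ∉ s}, v i := by
  have hf : Summable f := .of_norm_bounded hv h
  have h1 := hf.sum_add_tsum_subtype_compl s
  rw [← h1, add_sub_cancel_left]
  exact tsum_of_norm_bounded (hv.subtype _).hasSum fun i => h i

/-- The Fourier series of a test function converges with all derivatives, in particular in the C^k
norm that controls `u`, so `u` may be applied term by term. Thus a distribution is determined by its
Fourier coefficients. -/
lemma hasSum_coef_mul (u : Distr) (φ : TestFunction) :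
    HasSum (fun m => coef (φ : C(T2, ℂ)) m * (u : TestFunction →ₗ[ℂ] ℂ) (char m))
      ((u : TestFunction →ₗ[ℂ] ℂ) φ) := by
  obtain ⟨k, C, hu⟩ := u.2
  obtain ⟨B0, hB0⟩ := exists_bound_iteratedFDeriv φ 0
  -- Of the k + 3 orders of decay, k absorb the derivatives of the characters and 3 make the sum
  -- over ℤ² converge.
  obtain ⟨B1, hB1⟩ := exists_bound_iteratedFDeriv φ (k + 3)
  set A := 2 ^ (k + 3 + 1) * max B0 B1 with hA
  have hdec : ∀ m, ‖coef (φ : C(T2, ℂ)) m‖ ≤ A * ((1 + ‖m‖) ^ (k + 3))⁻¹ :=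
    norm_coef_testFunction_le' φ (k + 3) (max B0 B1) (fun x => (hB0 x).trans (le_max_left _ _))
      (fun x => (hB1 x).trans (le_max_right _ _))
  have hB : 0 ≤ max B0 B1 := ((norm_nonneg _).trans (hB0 0)).trans (le_max_left _ _)
  have hpi : 1 ≤ 4 * Real.pi := by nlinarith [Real.pi_gt_three]
  set v : Freq → ℝ := fun m => A * (4 * Real.pi) ^ k * ((1 + ‖m‖) ^ 3)⁻¹ with hv
  have hvs : Summable v := summable_inv_one_add_norm.mul_left _
  have hterm : ∀ j ≤ k, ∀ m x,
      ‖iteratedFDeriv ℝ j (coef (φ : C(T2, ℂ)) m • lift (mFourier m)) x‖ ≤ v m := by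
    intro j hj m x
    rw [iteratedFDeriv_const_smul_apply (contDiff_lift_mFourier m j).contDiffAt,
      norm_smul]
    have h1 : (4 * Real.pi * ‖m‖) ^ j ≤ (4 * Real.pi) ^ k * (1 + ‖m‖) ^ k := by
      rw [← mul_pow]
      calc (4 * Real.pi * ‖m‖) ^ j ≤ (4 * Real.pi * (1 + ‖m‖)) ^ j := by
            gcongr; linarith
        _ ≤ _ := by
          refine pow_le_pow_right₀ ?_ hj
          nlinarith [norm_nonneg m]
    calc _ ≤ (A * ((1 + ‖m‖) ^ (k + 3))⁻¹) * ((4 * Real.pi) ^ k * (1 + ‖m‖) ^ k) := by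
          refine mul_le_mul (hdec m) ((norm_iteratedFDeriv_lift_mFourier_le m j x).trans h1)
            (norm_nonneg _) (by positivity)
      _ = v m := by
        have : (1 + ‖m‖) ≠ 0 := by positivity
        simp only [hv]
        field_simp
        ring
  have hsum : Summable (coef (φ : C(T2, ℂ))) := by
    refine .of_norm_bounded hvs fun m => ?_
    have := hterm 0 (Nat.zero_le _) m 0
    rw [norm_iteratedFDeriv_zero, Pi.smul_apply, norm_smul] at this
    rwa [show ‖lift (mFourier m) 0‖ = 1 from norm_mFourier_apply m _, mul_one] at this
  have hpt : lift φ = fun y => ∑' m, (coef (φ : C(T2, ℂ)) m • lift (mFourier m)) y := by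
    funext y
    rw [coef_eq_mFourierCoeff] at hsum ⊢
    exact (hasSum_mFourier_series_apply_of_summable hsum (toTorus y)).tsum_eq.symm
  have hcd : ∀ m, ContDiff ℝ ((k : ℕ∞) : WithTop ℕ∞)
      (coef (φ : C(T2, ℂ)) m • lift (mFourier m)) := fun m =>
    contDiff_const.smul (contDiff_lift_mFourier m k)
  have hrem : ∀ s : Finset Freq,
      ‖(u : TestFunction →ₗ[ℂ] ℂ) (φ - ∑ m ∈ s, coef (φ : C(T2, ℂ)) m • char m)‖ ≤
        |C| * ∑' m : {m // m ∉ s}, v m := by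
    intro s
    refine (hu _ (∑' m : {m // m ∉ s}, v m) fun j hj x => ?_).trans ?_
    · have hl : lift (φ - ∑ m ∈ s, coef (φ : C(T2, ℂ)) m • char m : TestFunction) =
          fun y => lift φ y - ∑ m ∈ s, (coef (φ : C(T2, ℂ)) m • lift (mFourier m)) y := by
        funext y
        simp [lift, char]
      have hjk : ((j : ℕ∞) : WithTop ℕ∞) ≤ ((k : ℕ∞) : WithTop ℕ∞) := by exact_mod_cast hj
      have hsd : ContDiff ℝ ((j : ℕ∞) : WithTop ℕ∞)
          (fun y => ∑ m ∈ s, (coef (φ : C(T2, ℂ)) m • lift (mFourier m)) y) :=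
        ContDiff.sum fun m _ => (hcd m).of_le hjk
      have h1 := iteratedFDeriv_sub_apply (i := j) (x := x) (𝕜 := ℝ) (f := lift φ)
        (g := fun y => ∑ m ∈ s, (coef (φ : C(T2, ℂ)) m • lift (mFourier m)) y)
        ((contDiff_lift φ).of_le (by exact_mod_cast le_top)).contDiffAt hsd.contDiffAt
      have h2 : iteratedFDeriv ℝ j (lift φ) x =
          ∑' m, iteratedFDeriv ℝ j (coef (φ : C(T2, ℂ)) m • lift (mFourier m)) x := by
        conv_lhs => rw [hpt]
        exact iteratedFDeriv_tsum_apply (N := (k : ℕ∞)) (v := fun _ => v) hcd (fun _ _ => hvs)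
          (fun i m x hi => hterm i (by exact_mod_cast hi) m x) (by exact_mod_cast hj) x
      have h3 : iteratedFDeriv ℝ j
            (fun y => ∑ m ∈ s, (coef (φ : C(T2, ℂ)) m • lift (mFourier m)) y) x =
          ∑ m ∈ s, iteratedFDeriv ℝ j (coef (φ : C(T2, ℂ)) m • lift (mFourier m)) x := by
        exact iteratedFDeriv_fun_sum_apply fun m _ => ((hcd m).of_le hjk).contDiffAt
      rw [hl]
      refine (congrArg norm h1).le.trans ?_
      rw [h2, h3]
      exact norm_sub_sum_le hvs (fun m => hterm j hj m x) s
    · exact mul_le_mul_of_nonneg_right (le_abs_self C) (tsum_nonneg fun m => by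
        simp only [hv]; positivity)
  rw [HasSum, SummationFilter.unconditional_filter, tendsto_iff_norm_sub_tendsto_zero]
  refine squeeze_zero (fun _ => norm_nonneg _) (fun s => ?_)
    ((tendsto_tsum_compl_atTop_zero v).const_mul |C| |>.trans (by rw [mul_zero]))
  have h1 : (u : TestFunction →ₗ[ℂ] ℂ) (φ - ∑ m ∈ s, coef (φ : C(T2, ℂ)) m • char m) =
      (u : TestFunction →ₗ[ℂ] ℂ) φ -
        ∑ m ∈ s, coef (φ : C(T2, ℂ)) m * (u : TestFunction →ₗ[ℂ] ℂ) (char m) := by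
    refine (LinearMap.map_sub (u : TestFunction →ₗ[ℂ] ℂ) φ _).trans ?_
    rw [map_sum]
    simp
  rw [norm_sub_rev, ← h1]
  exact hrem s

/-! ## The Sobolev spaces of order `s ∈ [-2, 0]` -/

/-- The Hilbert space `ℓ²(ℤ²)`. -/
abbrev Ell2 : Type := lp (fun _ : Freq => ℂ) 2

lemma ell2_norm_sq (b : Ell2) : HasSum (fun m => ‖b m‖ ^ 2) (‖b‖ ^ 2) := by
  have := lp.hasSum_norm (p := 2) (by norm_num) b
  simpa using this

/-- Five derivatives suffice: since -s ≤ 2 the weight grows at most quadratically in ‖m‖, and three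
further orders of decay give summability. -/
lemma norm_coeff_synthesis_le {s : ℝ} (hs : -2 ≤ s) (b : Ell2) (φ : TestFunction) (B : ℝ)
    (h : ∀ j ≤ 5, ∀ x, ‖iteratedFDeriv ℝ j (lift φ) x‖ ≤ B) (m : Freq) :
    ‖((eigen m ^ (-s / 2) : ℝ) : ℂ) * b m * coef (φ : C(T2, ℂ)) (-m)‖ ≤
      80 * ‖b‖ * 2 ^ 6 * B * ((1 + ‖m‖) ^ 3)⁻¹ := by
  have h1 := norm_coef_testFunction_le' φ 5 B (h 0 (by norm_num)) (h 5 le_rfl) (-m)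
  have h2 : eigen m ^ (-s / 2) ≤ 80 * (1 + ‖m‖) ^ 2 := by
    refine le_trans ?_ (eigen_le m)
    conv_rhs => rw [← Real.rpow_one (eigen m)]
    exact Real.rpow_le_rpow_of_exponent_le (one_le_eigen m) (by linarith)
  have h3 : ‖b m‖ ≤ ‖b‖ := lp.norm_apply_le_norm (by norm_num) b m
  have h0 : 0 ≤ eigen m ^ (-s / 2) := Real.rpow_nonneg (eigen_pos m).le _
  rw [norm_neg] at h1
  rw [norm_mul, norm_mul, Complex.norm_real, Real.norm_of_nonneg h0]
  calc eigen m ^ (-s / 2) * ‖b m‖ * ‖coef (φ : C(T2, ℂ)) (-m)‖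
      ≤ (80 * (1 + ‖m‖) ^ 2) * ‖b‖ * (2 ^ (5 + 1) * B * ((1 + ‖m‖) ^ 5)⁻¹) := by gcongr
    _ = _ := by
      have : (1 + ‖m‖) ≠ 0 := by positivity
      field_simp
      ring

lemma exists_bound_iteratedFDeriv_le (φ : TestFunction) (k : ℕ) :
    ∃ B, ∀ j ≤ k, ∀ x, ‖iteratedFDeriv ℝ j (lift φ) x‖ ≤ B := by
  choose B hB using exists_bound_iteratedFDeriv φ
  refine ⟨∑ j ∈ Finset.range (k + 1), B j, fun j hj x => (hB j x).trans ?_⟩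
  exact Finset.single_le_sum (f := B) (fun i _ => (norm_nonneg _).trans (hB i 0))
    (Finset.mem_range.2 (by omega))

lemma summable_synthesis {s : ℝ} (hs : -2 ≤ s) (b : Ell2) (φ : TestFunction) :
    Summable fun m => ((eigen m ^ (-s / 2) : ℝ) : ℂ) * b m * coef (φ : C(T2, ℂ)) (-m) := by
  obtain ⟨B, hB⟩ := exists_bound_iteratedFDeriv_le φ 5
  exact .of_norm_bounded (summable_inv_one_add_norm.mul_left _)
    (norm_coeff_synthesis_le hs b φ B hB)

/-- The distribution with Fourier coefficients `(1 + 4 π² |m|²)^{-s/2} b_m`. -/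
def synthesis (s : ℝ) (hs : -2 ≤ s) (b : Ell2) : Distr :=
  ⟨{ toFun := fun φ =>
      ∑' m, ((eigen m ^ (-s / 2) : ℝ) : ℂ) * b m * coef (φ : C(T2, ℂ)) (-m)
     map_add' := fun φ ψ => by
      rw [← (summable_synthesis hs b φ).tsum_add (summable_synthesis hs b ψ)]
      refine tsum_congr fun m => ?_
      rw [← mul_add, ← coef_add]
      rfl
     map_smul' := fun c φ => by
      rw [RingHom.id_apply, smul_eq_mul, ← tsum_mul_left]
      refine tsum_congr fun m => ?_
      rw [show coef ((c • φ : TestFunction) : C(T2, ℂ)) (-m) = c * coef (φ : C(T2, ℂ)) (-m) from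
        coef_smul c φ (-m)]
      ring },
   by
    refine ⟨5, 80 * ‖b‖ * 2 ^ 6 * ∑' m : Freq, ((1 + ‖m‖) ^ 3)⁻¹, fun φ B h => ?_⟩
    refine (tsum_of_norm_bounded (summable_inv_one_add_norm.mul_left _).hasSum
      (norm_coeff_synthesis_le hs b φ B h)).trans (le_of_eq ?_)
    rw [tsum_mul_left]
    ring⟩

lemma fourierCoeff_synthesis (s : ℝ) (hs : -2 ≤ s) (b : Ell2) (m : Freq) :
    fourierCoeff (synthesis s hs b) m = ((eigen m ^ (-s / 2) : ℝ) : ℂ) * b m := by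
  change ∑' l, ((eigen l ^ (-s / 2) : ℝ) : ℂ) * b l * coef (mFourier (-m)) (-l) = _
  simp only [coef_mFourier]
  rw [tsum_eq_single m]
  · simp
  · intro l hl
    rw [if_neg (fun h => hl (neg_injective h).symm), mul_zero]

lemma weightedCoeff_synthesis (s : ℝ) (hs : -2 ≤ s) (b : Ell2) :
    weightedCoeff s (synthesis s hs b) = b := by
  funext m
  rw [weightedCoeff, fourierCoeff_synthesis, ← mul_assoc, ← Complex.ofReal_mul,
    ← Real.rpow_add (eigen_pos m)]
  simp [neg_div]

/-- Surjectivity of the isometry onto ℓ², through which completeness of ℓ² becomes available for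
limits in H^s. -/
lemma exists_toEll2_eq {s : ℝ} (hs : -2 ≤ s) (b : Ell2) : ∃ u, Sobolev.toEll2 s u = b :=
  ⟨⟨synthesis s hs b, by
    change Memℓp (weightedCoeff s (synthesis s hs b)) 2
    rw [weightedCoeff_synthesis]; exact b.2⟩, Subtype.ext (weightedCoeff_synthesis s hs b)⟩

/-- A right inverse of the isometry `H^s → ℓ²`. -/
def ofEll2 {s : ℝ} (hs : -2 ≤ s) (b : Ell2) : Sobolev s := (exists_toEll2_eq hs b).choose

lemma toEll2_ofEll2 {s : ℝ} (hs : -2 ≤ s) (b : Ell2) : Sobolev.toEll2 s (ofEll2 hs b) = b :=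
  (exists_toEll2_eq hs b).choose_spec

lemma norm_toEll2 {s : ℝ} (u : Sobolev s) : ‖Sobolev.toEll2 s u‖ = ‖u‖ := rfl

lemma isometry_toEll2 (s : ℝ) : Isometry (Sobolev.toEll2 s) :=
  AddMonoidHomClass.isometry_of_norm _ fun u => norm_toEll2 u

lemma fourierCoeff_eq_toEll2 {s : ℝ} (u : Sobolev s) (m : Freq) :
    fourierCoeff u m = ((eigen m ^ (-s / 2) : ℝ) : ℂ) * Sobolev.toEll2 s u m := by
  change _ = _ * weightedCoeff s u m
  rw [weightedCoeff, ← mul_assoc, ← Complex.ofReal_mul, ← Real.rpow_add (eigen_pos m)]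
  simp [neg_div]

lemma apply_eq_synthesis {s : ℝ} (hs : -2 ≤ s) (u : Sobolev s) (φ : TestFunction) :
    ((u : Distr) : TestFunction →ₗ[ℂ] ℂ) φ =
      ((synthesis s hs (Sobolev.toEll2 s u) : Distr) : TestFunction →ₗ[ℂ] ℂ) φ := by
  rw [← (hasSum_coef_mul u φ).tsum_eq, ← (Equiv.neg Freq).tsum_eq]
  refine tsum_congr fun m => ?_
  rw [← fourierCoeff_eq_toEll2, mul_comm]
  rfl

lemma continuous_apply_sobolev {s : ℝ} (hs : -2 ≤ s) (φ : TestFunction) :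
    Continuous fun u : Sobolev s => ((u : Distr) : TestFunction →ₗ[ℂ] ℂ) φ := by
  obtain ⟨B, hB⟩ := exists_bound_iteratedFDeriv_le φ 5
  set K := 80 * 2 ^ 6 * B * ∑' m : Freq, ((1 + ‖m‖) ^ 3)⁻¹ with hK
  have hle : ∀ u : Sobolev s, ‖((u : Distr) : TestFunction →ₗ[ℂ] ℂ) φ‖ ≤ K * ‖u‖ := by
    intro u
    rw [apply_eq_synthesis hs]
    refine (tsum_of_norm_bounded (summable_inv_one_add_norm.mul_left _).hasSum
      (norm_coeff_synthesis_le hs _ φ B hB)).trans (le_of_eq ?_)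
    rw [tsum_mul_left, norm_toEll2]
    ring
  exact AddMonoidHomClass.continuous_of_bound
    ({ toFun := fun u : Sobolev s => ((u : Distr) : TestFunction →ₗ[ℂ] ℂ) φ
       map_zero' := rfl
       map_add' := fun u v => rfl } : Sobolev s →+ ℂ) K hle

lemma isClosed_isNonneg {s : ℝ} (hs : -2 ≤ s) : IsClosed {f : Sobolev s | IsNonneg f} := by
  have : {f : Sobolev s | IsNonneg f} = ⋂ φ : TestFunction, ⋂ _ : ∀ x, 0 ≤ (φ : C(T2, ℂ)) x,
      {f : Sobolev s | 0 ≤ ((f : Distr) : TestFunction →ₗ[ℂ] ℂ) φ} := by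
    ext f
    simp [IsNonneg]
  rw [this]
  exact isClosed_iInter fun φ => isClosed_iInter fun _ =>
    isClosed_le continuous_const (continuous_apply_sobolev hs φ)

lemma hasSum_sq_coef (w : C(T2, ℂ)) :
    HasSum (fun m => ‖coef w m‖ ^ 2) (∫ x, ‖w x‖ ^ 2 ∂torusMeasure) := by
  have h := hasSum_sq_mFourierCoeff (w.toLp 2 torusMeasure ℂ)
  have h1 : ∀ m, mFourierCoeff (w.toLp 2 torusMeasure ℂ) m = coef w m := fun m => by
    rw [coef_eq_mFourierCoeff]
    exact mFourierCoeff_toLp w m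
  have h2 : ∫ x, ‖w.toLp 2 torusMeasure ℂ x‖ ^ 2 ∂torusMeasure =
      ∫ x, ‖w x‖ ^ 2 ∂torusMeasure := by
    refine integral_congr_ae ?_
    filter_upwards [w.coeFn_toLp (p := 2) (𝕜 := ℂ) torusMeasure] with x hx
    rw [hx]
  simp only [h1] at h
  rw [← h2]
  exact h

lemma norm_weightedCoeff_ofContinuous_le {s : ℝ} (hs : s ≤ 0) (w : C(T2, ℂ)) (m : Freq) :
    ‖weightedCoeff s (ofContinuous w) m‖ ≤ ‖coef w m‖ := by
  have h0 : 0 ≤ eigen m ^ (s / 2) := Real.rpow_nonneg (eigen_pos m).le _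
  rw [weightedCoeff, fourierCoeff_ofContinuous, norm_mul, Complex.norm_real, Real.norm_of_nonneg h0]
  exact mul_le_of_le_one_left (norm_nonneg _)
    (Real.rpow_le_one_of_one_le_of_nonpos (one_le_eigen m) (by linarith))

lemma ofContinuous_mem_sobolev {s : ℝ} (hs : s ≤ 0) (w : C(T2, ℂ)) :
    ofContinuous w ∈ Sobolev s := by
  refine memℓp_gen ?_
  refine (hasSum_sq_coef w).summable.of_nonneg_of_le (fun m => by positivity) fun m => ?_
  simp only [ENNReal.toReal_ofNat, Real.rpow_two]
  exact pow_le_pow_left₀ (norm_nonneg _) (norm_weightedCoeff_ofContinuous_le hs w m) 2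

/-- A continuous function as an element of `H^s`, `s ≤ 0`. -/
def toSobolev {s : ℝ} (hs : s ≤ 0) (w : C(T2, ℂ)) : Sobolev s :=
  ⟨ofContinuous w, ofContinuous_mem_sobolev hs w⟩

lemma toEll2_toSobolev_apply {s : ℝ} (hs : s ≤ 0) (w : C(T2, ℂ)) (m : Freq) :
    Sobolev.toEll2 s (toSobolev hs w) m = ((eigen m ^ (s / 2) : ℝ) : ℂ) * coef w m := rfl

lemma ofContinuous_add (v w : C(T2, ℂ)) :
    ofContinuous (v + w) = ofContinuous v + ofContinuous w := by
  refine Subtype.ext (LinearMap.ext fun φ => ?_)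
  change ∫ x, (v x + w x) * (φ : C(T2, ℂ)) x ∂torusMeasure = _
  simp only [add_mul]
  exact integral_add (integrable_continuousMap (v * (φ : C(T2, ℂ))))
    (integrable_continuousMap (w * (φ : C(T2, ℂ))))

lemma ofContinuous_smul (c : ℂ) (w : C(T2, ℂ)) :
    ofContinuous (c • w) = c • ofContinuous w := by
  refine Subtype.ext (LinearMap.ext fun φ => ?_)
  change ∫ x, (c * w x) * (φ : C(T2, ℂ)) x ∂torusMeasure = _
  simp only [mul_assoc]
  exact integral_const_mul _ _

/-- The embedding of the continuous functions into `H^s`, `s ≤ 0`, as a linear map. -/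
def toSobolevₗ {s : ℝ} (hs : s ≤ 0) : C(T2, ℂ) →ₗ[ℂ] Sobolev s where
  toFun := toSobolev hs
  map_add' v w := Subtype.ext (ofContinuous_add v w)
  map_smul' c w := Subtype.ext (ofContinuous_smul c w)

lemma hasSum_norm_toSobolev_sq {s : ℝ} (hs : s ≤ 0) (w : C(T2, ℂ)) :
    HasSum (fun m => eigen m ^ s * ‖coef w m‖ ^ 2) (‖toSobolev hs w‖ ^ 2) := by
  have h := ell2_norm_sq (Sobolev.toEll2 s (toSobolev hs w))
  rw [norm_toEll2] at h
  refine h.congr_fun fun m => ?_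
  have h0 : 0 ≤ eigen m ^ (s / 2) := Real.rpow_nonneg (eigen_pos m).le _
  rw [toEll2_toSobolev_apply, norm_mul, Complex.norm_real, Real.norm_of_nonneg h0, mul_pow,
    ← Real.rpow_mul_natCast (eigen_pos m).le]
  norm_num

lemma norm_toSobolev_le {s : ℝ} (hs : s ≤ 0) (w : C(T2, ℂ)) : ‖toSobolev hs w‖ ≤ ‖w‖ := by
  rw [← sq_le_sq₀ (norm_nonneg _) (norm_nonneg _)]
  calc ‖toSobolev hs w‖ ^ 2 ≤ ∫ x, ‖w x‖ ^ 2 ∂torusMeasure := by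
        refine hasSum_le (fun m => ?_) (hasSum_norm_toSobolev_sq hs w) (hasSum_sq_coef w)
        exact mul_le_of_le_one_left (by positivity)
          (Real.rpow_le_one_of_one_le_of_nonpos (one_le_eigen m) hs)
    _ ≤ ∫ x : T2, ‖w‖ ^ 2 ∂torusMeasure := by
        refine integral_mono_of_nonneg (.of_forall fun x => by positivity) (integrable_const _)
          (.of_forall fun x => ?_)
        exact pow_le_pow_left₀ (norm_nonneg _) (w.norm_coe_le_norm x) 2
    _ = ‖w‖ ^ 2 := by simp

lemma toSobolev_sub {s : ℝ} (hs : s ≤ 0) (v w : C(T2, ℂ)) :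
    toSobolev hs (v - w) = toSobolev hs v - toSobolev hs w :=
  map_sub (toSobolevₗ hs) v w

lemma toSobolev_add {s : ℝ} (hs : s ≤ 0) (v w : C(T2, ℂ)) :
    toSobolev hs (v + w) = toSobolev hs v + toSobolev hs w :=
  map_add (toSobolevₗ hs) v w

lemma continuous_toSobolev {s : ℝ} (hs : s ≤ 0) : Continuous (toSobolev hs) :=
  AddMonoidHomClass.continuous_of_bound (toSobolevₗ hs) 1 fun w => by
    rw [one_mul]; exact norm_toSobolev_le hs w

/-! ## Exponentials of continuous functions -/

/-- The pointwise exponential of a continuous function. -/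
def expC (g : C(T2, ℂ)) : C(T2, ℂ) := ⟨fun x => Complex.exp (g x), by fun_prop⟩

@[simp] lemma expC_apply (g : C(T2, ℂ)) (x : T2) : expC g x = Complex.exp (g x) := rfl

lemma expC_add (f g : C(T2, ℂ)) : expC (f + g) = expC f * expC g := by
  ext x
  simp [Complex.exp_add]

lemma expC_zero : expC 0 = 1 := by
  ext x
  simp

lemma hasSum_expC (g : C(T2, ℂ)) : HasSum (fun n : ℕ => ((n.factorial : ℂ))⁻¹ • g ^ n) (expC g) := by
  have h := NormedSpace.exp_series_hasSum_exp' (𝕂 := ℂ) g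
  have h1 : NormedSpace.exp g = expC g := by
    ext x
    have h2 := (ContinuousMap.evalCLM ℂ x).hasSum h
    have h3 := NormedSpace.exp_series_hasSum_exp' (𝕂 := ℂ) (g x)
    rw [← Complex.exp_eq_exp_ℂ] at h3
    refine h2.unique ?_
    simpa using h3
  rwa [h1] at h

lemma continuous_expC : Continuous expC :=
  ContinuousMap.continuous_postcomp ⟨Complex.exp, by fun_prop⟩

/-! ## Multiplication by smooth functions in `H^s` -/

lemma coef_mFourier_mul (l : Freq) (w : C(T2, ℂ)) (m : Freq) :
    coef (mFourier l * w : C(T2, ℂ)) m = coef w (m - l) := by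
  simp only [coef, ContinuousMap.mul_apply]
  refine integral_congr_ae (.of_forall fun x => ?_)
  simp only
  rw [show -(m - l) = -m + l by abel, mFourier_add]
  ring

/-- Peetre's inequality, from |m|² ≤ 2|m+l|² + 2|l|². -/
lemma eigen_le_mul (m l : Freq) : eigen m ≤ 2 * eigen l * eigen (m + l) := by
  have h1 : (freqSq m : ℝ) ≤ 2 * (freqSq (m + l) : ℝ) + 2 * (freqSq l : ℝ) := by
    simp only [freqSq, Pi.add_apply]
    push_cast
    nlinarith [sq_nonneg ((m 0 : ℝ) + 2 * l 0), sq_nonneg ((m 1 : ℝ) + 2 * l 1)]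
  have h2 : (0 : ℝ) ≤ (freqSq l : ℝ) := by unfold freqSq; push_cast; positivity
  have h3 : (0 : ℝ) ≤ (freqSq (m + l) : ℝ) := by unfold freqSq; push_cast; positivity
  have h4 : 0 < 4 * Real.pi ^ 2 := by positivity
  unfold eigen
  nlinarith [mul_le_mul_of_nonneg_left h1 h4.le, mul_nonneg (mul_nonneg h4.le h2)
    (mul_nonneg h4.le h3)]

/-- Multiplying by a character translates the coefficients; Peetre's inequality, raised to the power
-s ∈ [0, 2], bounds the change of the weights. -/
lemma norm_toSobolev_mFourier_mul_le {s : ℝ} (hs : s ≤ 0) (hs2 : -2 ≤ s) (l : Freq)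
    (w : C(T2, ℂ)) : ‖toSobolev hs (mFourier l * w)‖ ≤ 2 * eigen l * ‖toSobolev hs w‖ := by
  have hl := one_le_eigen l
  rw [← sq_le_sq₀ (norm_nonneg _) (by positivity), mul_pow]
  have h1 := hasSum_norm_toSobolev_sq hs (mFourier l * w)
  rw [← (Equiv.addRight l).hasSum_iff] at h1
  refine hasSum_le (fun m => ?_) h1 ((hasSum_norm_toSobolev_sq hs w).mul_left ((2 * eigen l) ^ 2))
  have hm := eigen_pos m
  have hml := eigen_pos (m + l)
  simp only [Function.comp_apply, Equiv.coe_addRight, coef_mFourier_mul, add_sub_cancel_right]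
  rw [← mul_assoc]
  gcongr
  have h2 : eigen m ^ (-s) ≤ (2 * eigen l) ^ (-s) * eigen (m + l) ^ (-s) := by
    rw [← Real.mul_rpow (by positivity) hml.le]
    exact Real.rpow_le_rpow hm.le (eigen_le_mul m l) (by linarith)
  have h3 : (2 * eigen l) ^ (-s) ≤ (2 * eigen l) ^ 2 := by
    rw [← Real.rpow_two]
    exact Real.rpow_le_rpow_of_exponent_le (by linarith) (by linarith)
  have h4 : eigen m ^ (-s) * eigen m ^ s = 1 := by
    rw [← Real.rpow_add hm]; simp
  have h5 : eigen (m + l) ^ (-s) * eigen (m + l) ^ s = 1 := by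
    rw [← Real.rpow_add hml]; simp
  have p1 : 0 < eigen m ^ s := by positivity
  have p2 : 0 < eigen (m + l) ^ s := by positivity
  have p3 : 0 < eigen (m + l) ^ (-s) := by positivity
  calc eigen (m + l) ^ s = (eigen m ^ (-s) * eigen m ^ s) * eigen (m + l) ^ s := by
        rw [h4, one_mul]
    _ ≤ (((2 * eigen l) ^ 2 * eigen (m + l) ^ (-s)) * eigen m ^ s) * eigen (m + l) ^ s := by
        gcongr
        exact h2.trans (by gcongr)
    _ = (2 * eigen l) ^ 2 * eigen m ^ s * (eigen (m + l) ^ (-s) * eigen (m + l) ^ s) := by ring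
    _ = _ := by rw [h5, mul_one]

lemma norm_toSobolev_smul {s : ℝ} (hs : s ≤ 0) (c : ℂ) (w : C(T2, ℂ)) :
    ‖toSobolev hs (c • w)‖ = ‖c‖ * ‖toSobolev hs w‖ := by
  rw [show toSobolev hs (c • w) = c • toSobolev hs w from map_smul (toSobolevₗ hs) _ _,
    ← norm_toEll2, map_smul, norm_smul, norm_toEll2]

lemma hasSum_toSobolev_expC_mul {s : ℝ} (hs : s ≤ 0) (g w : C(T2, ℂ)) :
    HasSum (fun n : ℕ => toSobolev hs (((n.factorial : ℂ))⁻¹ • (g ^ n * w)))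
      (toSobolev hs (expC g * w)) := by
  have h := ((hasSum_expC g).mul_right w).map (toSobolevₗ hs) (continuous_toSobolev hs)
  simp only [smul_mul_assoc] at h
  exact h

lemma norm_toSobolev_pow_mul_le {s : ℝ} (hs : s ≤ 0) {g : C(T2, ℂ)} {K : ℝ}
    (hg : ∀ w, ‖toSobolev hs (g * w)‖ ≤ K * ‖toSobolev hs w‖) (hK : 0 ≤ K) (n : ℕ) (w : C(T2, ℂ)) :
    ‖toSobolev hs (g ^ n * w)‖ ≤ K ^ n * ‖toSobolev hs w‖ := by
  induction n with
  | zero => simp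
  | succ n ih =>
    rw [pow_succ', mul_assoc, pow_succ', mul_assoc]
    exact (hg _).trans (by gcongr)

lemma norm_toSobolev_term_le {s : ℝ} (hs : s ≤ 0) {g : C(T2, ℂ)} {K : ℝ}
    (hg : ∀ w, ‖toSobolev hs (g * w)‖ ≤ K * ‖toSobolev hs w‖) (hK : 0 ≤ K) (w : C(T2, ℂ)) (n : ℕ) :
    ‖toSobolev hs (((n.factorial : ℂ))⁻¹ • (g ^ n * w))‖ ≤
      K ^ n / n.factorial * ‖toSobolev hs w‖ := by
  rw [norm_toSobolev_smul, norm_inv, Complex.norm_natCast, div_mul_eq_mul_div, inv_mul_eq_div]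
  gcongr
  exact norm_toSobolev_pow_mul_le hs hg hK n w

lemma hasSum_real_exp (K : ℝ) : HasSum (fun n : ℕ => K ^ n / n.factorial) (Real.exp K) := by
  rw [Real.exp_eq_exp_ℝ]
  exact NormedSpace.expSeries_div_hasSum_exp K

lemma norm_toSobolev_expC_mul_le {s : ℝ} (hs : s ≤ 0) {g : C(T2, ℂ)} {K : ℝ}
    (hg : ∀ w, ‖toSobolev hs (g * w)‖ ≤ K * ‖toSobolev hs w‖) (hK : 0 ≤ K) (w : C(T2, ℂ)) :
    ‖toSobolev hs (expC g * w)‖ ≤ Real.exp K * ‖toSobolev hs w‖ :=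
  (hasSum_toSobolev_expC_mul hs g w).norm_le_of_bounded ((hasSum_real_exp K).mul_right _)
    (norm_toSobolev_term_le hs hg hK w)

/-- The exponential series without its constant term, estimated termwise. It shows that
multiplication by e^g is close to the identity of H^s when multiplication by g has small norm. -/
lemma norm_toSobolev_expC_sub_one_mul_le {s : ℝ} (hs : s ≤ 0) {g : C(T2, ℂ)} {K : ℝ}
    (hg : ∀ w, ‖toSobolev hs (g * w)‖ ≤ K * ‖toSobolev hs w‖) (hK : 0 ≤ K) (w : C(T2, ℂ)) :
    ‖toSobolev hs ((expC g - 1) * w)‖ ≤ (Real.exp K - 1) * ‖toSobolev hs w‖ := by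
  have h1 := (hasSum_nat_add_iff' 1).2 (hasSum_toSobolev_expC_mul hs g w)
  have h2 := (hasSum_nat_add_iff' 1).2 (hasSum_real_exp K)
  simp only [Finset.range_one, Finset.sum_singleton, Nat.factorial_zero, Nat.cast_one, inv_one,
    pow_zero, one_mul, one_smul, div_one] at h1 h2
  rw [sub_mul, one_mul, toSobolev_sub]
  exact h1.norm_le_of_bounded (h2.mul_right _)
    (fun n => norm_toSobolev_term_le hs hg hK w (n + 1))

/-! ## Functions with nonnegative Fourier coefficients -/

/-- The closed subsemiring of `C(T²)` generated by the functions `r e_m`, `r ≥ 0`. -/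
def posCone : Subsemiring C(T2, ℂ) :=
  (Subsemiring.closure
    {f : C(T2, ℂ) | ∃ r : ℝ, 0 ≤ r ∧ ∃ m, f = (r : ℂ) • mFourier m}).topologicalClosure

lemma isClosed_posCone : IsClosed (posCone : Set C(T2, ℂ)) :=
  Subsemiring.isClosed_topologicalClosure _

lemma smul_mFourier_mem_posCone {r : ℝ} (hr : 0 ≤ r) (m : Freq) :
    (r : ℂ) • mFourier m ∈ posCone :=
  Subsemiring.le_topologicalClosure _ (Subsemiring.subset_closure ⟨r, hr, m, rfl⟩)

lemma smul_mem_posCone {r : ℝ} (hr : 0 ≤ r) {f : C(T2, ℂ)} (hf : f ∈ posCone) :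
    (r : ℂ) • f ∈ posCone := by
  have := mul_mem (smul_mFourier_mem_posCone hr 0) hf
  rwa [mFourier_zero, smul_mul_assoc, one_mul] at this

lemma hasSum_mem_posCone {ι : Type*} {f : ι → C(T2, ℂ)} {g : C(T2, ℂ)} (h : HasSum f g)
    (hf : ∀ i, f i ∈ posCone) : g ∈ posCone :=
  isClosed_posCone.mem_of_tendsto h (.of_forall fun _ => sum_mem fun i _ => hf i)

lemma expC_mem_posCone {f : C(T2, ℂ)} (hf : f ∈ posCone) : expC f ∈ posCone := by
  refine hasSum_mem_posCone (hasSum_expC f) fun n => ?_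
  have := smul_mem_posCone (r := ((n.factorial : ℝ))⁻¹) (by positivity) (pow_mem hf n)
  simpa using this

lemma expC_sub_one_mem_posCone {f : C(T2, ℂ)} (hf : f ∈ posCone) : expC f - 1 ∈ posCone := by
  have h := (hasSum_nat_add_iff' 1).2 (hasSum_expC f)
  simp only [Finset.range_one, Finset.sum_singleton, Nat.factorial_zero, Nat.cast_one, inv_one,
    pow_zero, one_smul] at h
  refine hasSum_mem_posCone h fun n => ?_
  have := smul_mem_posCone (r := (((n + 1).factorial : ℝ))⁻¹) (by positivity) (pow_mem hf (n + 1))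
  simpa using this

lemma continuous_coef (m : Freq) : Continuous fun f : C(T2, ℂ) => coef f m :=
  AddMonoidHomClass.continuous_of_bound
    ({ toFun := fun f : C(T2, ℂ) => coef f m
       map_zero' := by simp [coef]
       map_add' := fun f g => coef_add f g m } : C(T2, ℂ) →+ ℂ) 1 fun f => by
    rw [one_mul]; exact norm_coef_le (fun x => f.norm_coe_le_norm x) m

/-- A product of two generators r e_m is again one, so the generated semiring consists of their
finite sums, where the claim is evident; continuity of the coefficient handles the closure. -/
lemma coef_nonneg {f : C(T2, ℂ)} (hf : f ∈ posCone) (m : Freq) : 0 ≤ coef f m := by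
  have hcl : IsClosed {f : C(T2, ℂ) | 0 ≤ coef f m} :=
    isClosed_le continuous_const (continuous_coef m)
  refine closure_minimal (fun f hf => ?_) hcl hf
  rw [SetLike.mem_coe, Subsemiring.mem_closure_iff] at hf
  induction hf using AddSubmonoid.closure_induction with
  | mem f hf =>
    have : ∃ r : ℝ, 0 ≤ r ∧ ∃ m, f = (r : ℂ) • mFourier m := by
      induction hf using Submonoid.closure_induction with
      | mem f hf => exact hf
      | one => exact ⟨1, zero_le_one, 0, by simp [mFourier_zero]⟩
      | mul f g _ _ hf hg =>
        obtain ⟨r, hr, m, rfl⟩ := hf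
        obtain ⟨t, ht, l, rfl⟩ := hg
        refine ⟨r * t, mul_nonneg hr ht, m + l, ?_⟩
        rw [smul_mul_smul_comm, mFourier_mul_mFourier, Complex.ofReal_mul]
    obtain ⟨r, hr, l, rfl⟩ := this
    rw [Set.mem_ofPred_eq, coef_smul, coef_mFourier]
    refine mul_nonneg (by exact_mod_cast hr) ?_
    split_ifs <;> simp
  | zero => simp [coef]
  | add f g _ _ hf hg =>
    rw [Set.mem_ofPred_eq, coef_add]
    exact add_nonneg hf hg

/-- e^g - e^f = e^f (e^{g-f} - 1) is a product of two elements of the cone. -/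
lemma coef_expC_mono {f g : C(T2, ℂ)} (hf : f ∈ posCone) (hfg : g - f ∈ posCone) (m : Freq) :
    coef (expC f) m ≤ coef (expC g) m := by
  have h := coef_nonneg (mul_mem (expC_mem_posCone hf) (expC_sub_one_mem_posCone hfg)) m
  rw [mul_sub, mul_one, ← expC_add, add_sub_cancel, coef_sub] at h
  exact sub_nonneg.1 h

/-- The difference of the two sides is a coefficient of (e^f - 1)(e^g - 1). This will bound the
distance of a high-frequency factor to 1 by an increment of the full mass. -/
lemma coef_expC_sub_one_le {f g : C(T2, ℂ)} (hf : f ∈ posCone) (hg : g ∈ posCone) (m : Freq) :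
    coef (expC g - 1 : C(T2, ℂ)) m ≤ coef (expC (f + g) - expC f : C(T2, ℂ)) m := by
  have h := coef_nonneg (mul_mem (expC_sub_one_mem_posCone hf) (expC_sub_one_mem_posCone hg)) m
  rw [show (expC f - 1) * (expC g - 1) = (expC (f + g) - expC f) - (expC g - 1) by
    rw [expC_add]; ring, coef_sub] at h
  exact sub_nonneg.1 h

/-! ## The heat kernel on the circle -/

/-- The heat kernel `∑_n exp(-4 π² n² t) e_n(x)` on the circle. -/
def circleHeat (t : ℝ) (x : UnitAddCircle) : ℂ :=
  ∑' n : ℤ, ((Real.exp (-(4 * Real.pi ^ 2 * (n : ℝ) ^ 2 * t)) : ℝ) : ℂ) * fourier n x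

lemma circleHeat_term (t x : ℝ) (n : ℤ) :
    ((Real.exp (-(4 * Real.pi ^ 2 * (n : ℝ) ^ 2 * t)) : ℝ) : ℂ) *
      fourier n (x : UnitAddCircle) = jacobiTheta₂_term n x (4 * Real.pi * t * Complex.I) := by
  rw [fourier_coe_apply, jacobiTheta₂_term, Complex.ofReal_exp, ← Complex.exp_add]
  congr 1
  push_cast
  linear_combination (-(4 * (Real.pi : ℂ) ^ 2 * n ^ 2 * t)) * Complex.I_sq

lemma circleHeat_coe (t x : ℝ) :
    circleHeat t x = jacobiTheta₂ x (4 * Real.pi * t * Complex.I) :=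
  tsum_congr fun n => circleHeat_term t x n

lemma im_four_pi_mul (t : ℝ) : (4 * Real.pi * t * Complex.I : ℂ).im = 4 * Real.pi * t := by
  rw [show (4 * Real.pi * t * Complex.I : ℂ) = ((4 * Real.pi * t : ℝ) : ℂ) * Complex.I by
    push_cast; ring, Complex.im_ofReal_mul, Complex.I_im, mul_one]

lemma summable_exp_neg_sq {t : ℝ} (ht : 0 < t) :
    Summable fun n : ℤ => Real.exp (-(4 * Real.pi ^ 2 * (n : ℝ) ^ 2 * t)) := by
  have h := (hasSum_jacobiTheta₂_term ((0 : ℝ) : ℂ) (τ := 4 * Real.pi * t * Complex.I)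
    (by rw [im_four_pi_mul]; positivity)).summable.norm
  refine h.congr fun n => ?_
  rw [← circleHeat_term, norm_mul, Complex.norm_real, Real.norm_of_nonneg (Real.exp_pos _).le,
    fourier_apply, Circle.norm_coe, mul_one]

/-- `∑_{n ≠ 0} 16 / n²`. -/
def heatConst : ℝ := ∑' n : ℤ, 16 * (1 / (n : ℝ) ^ 2)

lemma heatConst_nonneg : 0 ≤ heatConst := tsum_nonneg fun n => by positivity

/-- An upper bound of the heat kernel on the circle at distance `r` from the origin. -/
def heatBound (t r : ℝ) : ℝ :=
  (4 * Real.pi * t) ^ (-(1 / 2) : ℝ) * Real.exp (-(r ^ 2 / (4 * t))) + heatConst * t ^ (1 / 2 : ℝ)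

/-- After Poisson summation the terms are Gaussians centered at the integers. -/
lemma norm_jacobi_dual_term (t x : ℝ) (ht : 0 < t) (n : ℤ) :
    ‖Complex.exp (-Real.pi * Complex.I * (x : ℂ) ^ 2 / (4 * Real.pi * t * Complex.I)) *
      jacobiTheta₂_term n (x / (4 * Real.pi * t * Complex.I))
        (-1 / (4 * Real.pi * t * Complex.I))‖ = Real.exp (-((n - x) ^ 2 / (4 * t))) := by
  have hpi : (Real.pi : ℂ) ≠ 0 := by exact_mod_cast Real.pi_ne_zero
  have ht' : (t : ℂ) ≠ 0 := by exact_mod_cast ht.ne'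
  rw [jacobiTheta₂_term, ← Complex.exp_add,
    show -Real.pi * Complex.I * (x : ℂ) ^ 2 / (4 * Real.pi * t * Complex.I) +
      (2 * Real.pi * Complex.I * n * (x / (4 * Real.pi * t * Complex.I)) +
        Real.pi * Complex.I * n ^ 2 * (-1 / (4 * Real.pi * t * Complex.I))) =
      ((-((n - x) ^ 2 / (4 * t)) : ℝ) : ℂ) by
        push_cast
        field_simp
        ring, Complex.norm_exp_ofReal]

/-- The functional equation of the theta function turns the kernel into a sum of Gaussians. The one
at 0 is kept; for n ≠ 0 one has |n - x| ≥ |n|/2, and e^{-v} ≤ 1/v bounds the term by 16t/n². With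
the prefactor of order t^{-1/2}, the remainder is of order t^{1/2}. -/
lemma norm_circleHeat_le {t x : ℝ} (ht : 0 < t) (hx : |x| ≤ 1 / 2) :
    ‖circleHeat t x‖ ≤ heatBound t x := by
  have hpi := Real.pi_pos
  have h4 : 0 < 4 * Real.pi * t := by positivity
  have hτ : 0 < (-1 / (4 * Real.pi * t * Complex.I) : ℂ).im := by
    have : (-1 / (4 * Real.pi * t * Complex.I) : ℂ) = ((1 / (4 * Real.pi * t) : ℝ) : ℂ) *
        Complex.I := by
      have h1 : (Real.pi : ℂ) ≠ 0 := by exact_mod_cast hpi.ne'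
      have h2 : (t : ℂ) ≠ 0 := by exact_mod_cast ht.ne'
      push_cast
      field_simp
      simp
    rw [this, Complex.im_ofReal_mul, Complex.I_im, mul_one]
    positivity
  have hsum := (hasSum_jacobiTheta₂_term (x / (4 * Real.pi * t * Complex.I)) hτ).mul_left
    (Complex.exp (-Real.pi * Complex.I * (x : ℂ) ^ 2 / (4 * Real.pi * t * Complex.I)))
  have hs16 : Summable fun n : ℤ => 16 * (1 / (n : ℝ) ^ 2) :=
    (Real.summable_one_div_int_pow.2 one_lt_two).mul_left _
  have hbound : ∀ n : ℤ, Real.exp (-((n - x) ^ 2 / (4 * t))) ≤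
      (if n = 0 then Real.exp (-(x ^ 2 / (4 * t))) else 0) + 16 * (1 / (n : ℝ) ^ 2) * t := by
    intro n
    by_cases hn : n = 0
    · subst hn
      simp
    rw [if_neg hn, zero_add]
    have hn1 : (1 : ℝ) ≤ |(n : ℝ)| := by exact_mod_cast Int.one_le_abs hn
    have h1 : (n : ℝ) ^ 2 / 4 ≤ (n - x) ^ 2 := by
      have h2 : |(n : ℝ)| / 2 ≤ |n - x| := by
        have := abs_sub_abs_le_abs_sub (n : ℝ) x
        linarith
      calc (n : ℝ) ^ 2 / 4 = (|(n : ℝ)| / 2) ^ 2 := by rw [div_pow, sq_abs]; norm_num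
        _ ≤ |n - x| ^ 2 := by gcongr
        _ = _ := sq_abs _
    have hn2 : 0 < (n : ℝ) ^ 2 := by
      rw [← sq_abs]; positivity
    set v := (n - x) ^ 2 / (4 * t) with hv
    have hvpos : 0 < v := by
      have : 0 < (n - x) ^ 2 := by linarith
      positivity
    calc Real.exp (-v) = (Real.exp v)⁻¹ := Real.exp_neg v
      _ ≤ v⁻¹ := inv_anti₀ hvpos (by linarith [Real.add_one_le_exp v])
      _ ≤ ((n : ℝ) ^ 2 / 4 / (4 * t))⁻¹ := by
        refine inv_anti₀ (by positivity) ?_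
        rw [hv]
        gcongr
      _ = 16 * (1 / (n : ℝ) ^ 2) * t := by field_simp; norm_num
  have hB : HasSum (fun n : ℤ => (if n = 0 then Real.exp (-(x ^ 2 / (4 * t))) else 0) +
      16 * (1 / (n : ℝ) ^ 2) * t) (Real.exp (-(x ^ 2 / (4 * t))) + heatConst * t) :=
    (hasSum_ite_eq 0 _).add (hs16.hasSum.mul_right t)
  have hle := hsum.norm_le_of_bounded hB fun n => by
    rw [norm_jacobi_dual_term t x ht n]; exact hbound n
  have hpre : ‖(1 : ℂ) / (-Complex.I * (4 * Real.pi * t * Complex.I)) ^ (1 / 2 : ℂ)‖ =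
      (4 * Real.pi * t) ^ (-(1 / 2) : ℝ) := by
    rw [show -Complex.I * (4 * Real.pi * t * Complex.I) = ((4 * Real.pi * t : ℝ) : ℂ) by
      push_cast
      linear_combination (-(4 * Real.pi * t : ℂ)) * Complex.I_sq,
      show (1 / 2 : ℂ) = ((1 / 2 : ℝ) : ℂ) by norm_num, ← Complex.ofReal_cpow h4.le, norm_div,
      norm_one, Complex.norm_real, Real.norm_of_nonneg (by positivity), Real.rpow_neg h4.le, one_div]
  rw [circleHeat_coe, jacobiTheta₂_functional_equation, mul_assoc, norm_mul, hpre, heatBound]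
  refine (mul_le_mul_of_nonneg_left hle (by positivity)).trans ?_
  rw [mul_add]
  refine add_le_add le_rfl ?_
  have h5 : (4 * Real.pi * t) ^ (-(1 / 2) : ℝ) ≤ t ^ (-(1 / 2) : ℝ) :=
    Real.rpow_le_rpow_of_nonpos ht (by nlinarith [Real.pi_gt_three]) (by norm_num)
  have h6 : t ^ (-(1 / 2) : ℝ) * t = t ^ (1 / 2 : ℝ) := by
    rw [← Real.rpow_add_one ht.ne']; norm_num
  calc (4 * Real.pi * t) ^ (-(1 / 2) : ℝ) * (heatConst * t)
      ≤ t ^ (-(1 / 2) : ℝ) * (heatConst * t) := by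
        gcongr
        exact mul_nonneg heatConst_nonneg ht.le
    _ = heatConst * (t ^ (-(1 / 2) : ℝ) * t) := by ring
    _ = _ := by rw [h6]

lemma exists_coe_eq_abs_eq_norm (x : UnitAddCircle) :
    ∃ y : ℝ, (y : UnitAddCircle) = x ∧ |y| = ‖x‖ ∧ |y| ≤ 1 / 2 := by
  obtain ⟨z, rfl⟩ := QuotientAddGroup.mk_surjective x
  refine ⟨z - round z, ?_, (UnitAddCircle.norm_eq (x := z)).symm, abs_sub_round z⟩
  have : (((round z : ℤ) : ℝ) : UnitAddCircle) = 0 :=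
    (AddCircle.coe_eq_zero_iff (p := (1 : ℝ))).2 ⟨round z, by simp⟩
  rw [AddCircle.coe_sub, this, sub_zero]

lemma heatBound_abs (t r : ℝ) : heatBound t |r| = heatBound t r := by
  simp [heatBound]

lemma norm_circleHeat_le' {t : ℝ} (ht : 0 < t) (x : UnitAddCircle) :
    ‖circleHeat t x‖ ≤ heatBound t ‖x‖ := by
  obtain ⟨y, rfl, h1, h2⟩ := exists_coe_eq_abs_eq_norm x
  rw [← h1, heatBound_abs]
  exact norm_circleHeat_le ht h2

lemma heatBound_nonneg {t : ℝ} (ht : 0 < t) (r : ℝ) : 0 ≤ heatBound t r := by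
  have := heatConst_nonneg
  have := Real.pi_pos
  unfold heatBound
  positivity

/-! ## The heat kernel on the torus -/

lemma exp_neg_mul_eigen (t : ℝ) (m : Freq) : Real.exp (-(t * eigen m)) = Real.exp (-t) *
    (Real.exp (-(4 * Real.pi ^ 2 * (m 0 : ℝ) ^ 2 * t)) *
      Real.exp (-(4 * Real.pi ^ 2 * (m 1 : ℝ) ^ 2 * t))) := by
  rw [← Real.exp_add, ← Real.exp_add]
  congr 1
  simp only [eigen, freqSq]
  push_cast
  ring

lemma summable_exp_neg_mul_eigen {t : ℝ} (ht : 0 < t) :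
    Summable fun m : Freq => Real.exp (-(t * eigen m)) := by
  simp only [exp_neg_mul_eigen]
  refine Summable.mul_left _ ?_
  rw [← (finTwoArrowEquiv ℤ).symm.summable_iff]
  exact (summable_exp_neg_sq ht).mul_of_nonneg (summable_exp_neg_sq ht)
    (fun _ => (Real.exp_pos _).le) (fun _ => (Real.exp_pos _).le)

/-- The continuous function with given summable Fourier coefficients. -/
def fourierSeries (c : Freq → ℝ) : C(T2, ℂ) := ∑' m, (c m : ℂ) • mFourier m

lemma hasSum_fourierSeries {c : Freq → ℝ} (hc : Summable c) :
    HasSum (fun m => (c m : ℂ) • mFourier m) (fourierSeries c) := by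
  refine Summable.hasSum (.of_norm_bounded hc.norm fun m => ?_)
  rw [norm_smul, mFourier_norm, mul_one, Complex.norm_real]

lemma hasSum_fourierSeries_apply {c : Freq → ℝ} (hc : Summable c) (x : T2) :
    HasSum (fun m => (c m : ℂ) * mFourier m x) (fourierSeries c x) := by
  simpa using (ContinuousMap.evalCLM ℂ x).hasSum (hasSum_fourierSeries hc)

/-- The kernel `∑_m exp(-t (1 + 4 π² |m|²)) e_m` of `exp(-t (1 - Δ))`. -/
def heat (t : ℝ) : C(T2, ℂ) := fourierSeries fun m => Real.exp (-(t * eigen m))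

lemma heat_apply {t : ℝ} (ht : 0 < t) (x : T2) :
    heat t x = (Real.exp (-t) : ℝ) * (circleHeat t (x 0) * circleHeat t (x 1)) := by
  have hsn : ∀ i : Fin 2, Summable fun n : ℤ =>
      ‖((Real.exp (-(4 * Real.pi ^ 2 * (n : ℝ) ^ 2 * t)) : ℝ) : ℂ) * fourier n (x i)‖ := by
    intro i
    refine (summable_exp_neg_sq ht).congr fun n => ?_
    rw [norm_mul, Complex.norm_real, Real.norm_of_nonneg (Real.exp_pos _).le,
      fourier_apply, Circle.norm_coe, mul_one]
  rw [heat, ← (hasSum_fourierSeries_apply (summable_exp_neg_mul_eigen ht) x).tsum_eq]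
  unfold circleHeat
  rw [tsum_mul_tsum_of_summable_norm (hsn 0) (hsn 1), ← tsum_mul_left,
    ← (finTwoArrowEquiv ℤ).tsum_eq]
  refine tsum_congr fun m => ?_
  have h0 : (finTwoArrowEquiv ℤ m).1 = m 0 := rfl
  have h1 : (finTwoArrowEquiv ℤ m).2 = m 1 := rfl
  simp only [h0, h1, exp_neg_mul_eigen, mFourier, ContinuousMap.coe_mk,
    Fin.prod_univ_two]
  push_cast
  ring

lemma norm_heat_le {t : ℝ} (ht : 0 < t) (x : T2) :
    ‖heat t x‖ ≤ Real.exp (-t) * (heatBound t ‖x 0‖ * heatBound t ‖x 1‖) := by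
  rw [heat_apply ht, norm_mul, norm_mul, Complex.norm_real,
    Real.norm_of_nonneg (Real.exp_pos _).le]
  gcongr
  · exact heatBound_nonneg ht _
  · exact norm_circleHeat_le' ht _
  · exact norm_circleHeat_le' ht _

/-! ## Integrals of the heat kernel bound -/

lemma haarAddCircle_eq_map : (AddCircle.haarAddCircle : Measure UnitAddCircle) =
    (volume.restrict (Set.Ioc (-(1 / 2) : ℝ) (1 / 2))).map (fun x : ℝ => (x : UnitAddCircle)) := by
  have h := (AddCircle.measurePreserving_mk (1 : ℝ) (-(1 / 2))).map_eq
  rw [AddCircle.volume_eq_smul_haarAddCircle, ENNReal.ofReal_one, one_smul] at h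
  rw [← h]
  norm_num

lemma measurable_coe_circle : Measurable fun x : ℝ => (x : UnitAddCircle) :=
  AddCircle.measurable_mk'

lemma norm_coe_circle {x : ℝ} (hx : x ∈ Set.Ioc (-(1 / 2) : ℝ) (1 / 2)) :
    ‖(x : UnitAddCircle)‖ = |x| :=
  (AddCircle.norm_coe_eq_abs_iff (1 : ℝ) one_ne_zero).2
    (by rw [abs_one, abs_le]; exact ⟨hx.1.le, hx.2⟩)

lemma ae_circle_ne_zero : ∀ᵐ y : UnitAddCircle ∂AddCircle.haarAddCircle, y ≠ 0 := by
  have hm : MeasurableSet {y : UnitAddCircle | y ≠ 0} :=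
    (isOpen_compl_singleton (x := (0 : UnitAddCircle))).measurableSet
  rw [haarAddCircle_eq_map, ae_map_iff measurable_coe_circle.aemeasurable hm]
  rw [ae_restrict_iff' measurableSet_Ioc]
  filter_upwards [Measure.ae_ne volume (0 : ℝ)] with x hx hx2 h
  have := norm_coe_circle hx2
  rw [h, norm_zero] at this
  exact hx (abs_eq_zero.1 this.symm)

lemma ae_torus_ne_zero : ∀ᵐ x : T2 ∂torusMeasure, ∀ i, x i ≠ 0 := by
  refine ae_all_iff.2 fun i => ?_
  exact (Measure.quasiMeasurePreserving_eval (fun _ : Fin 2 => AddCircle.haarAddCircle) i).ae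
    ae_circle_ne_zero

/-- The function `x^{-a} exp(-b x²)`. -/
def powGauss (a b x : ℝ) : ℝ := x ^ (-a) * Real.exp (-b * x ^ (2 : ℝ))

lemma integral_powGauss {a b : ℝ} (ha : a < 1) (hb : 0 < b) :
    ∫ x : ℝ, powGauss a b |x| = b ^ (-((1 - a) / 2)) * Real.Gamma ((1 - a) / 2) := by
  rw [integral_comp_abs]
  unfold powGauss
  rw [integral_rpow_mul_exp_neg_mul_rpow (by norm_num) (by linarith) hb,
    show -(-a + 1) / 2 = -((1 - a) / 2) by ring, show (-a + 1) / 2 = (1 - a) / 2 by ring]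
  ring

lemma integrable_powGauss {a b : ℝ} (ha : a < 1) (hb : 0 < b) :
    Integrable fun x : ℝ => powGauss a b |x| := by
  refine Integrable.of_integral_ne_zero ?_
  rw [integral_powGauss ha hb]
  have := Real.Gamma_pos_of_pos (s := (1 - a) / 2) (by linarith)
  positivity

lemma heatBound_mul_rpow_le {a t x : ℝ} (ht : 0 < t) (hx : |x| ≤ 1 / 2) :
    heatBound t |x| * |x| ^ (-a) ≤ (4 * Real.pi * t) ^ (-(1 / 2) : ℝ) * powGauss a (1 / (4 * t)) |x| +
      heatConst * t ^ (1 / 2 : ℝ) * Real.exp 1 * powGauss a 1 |x| := by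
  have hC := heatConst_nonneg
  -- On |x| ≤ 1/2 a harmless Gaussian factor is inserted in the remainder, so that it can be
  -- integrated over the whole line.
  have h1 : 1 ≤ Real.exp 1 * Real.exp (-1 * |x| ^ (2 : ℝ)) := by
    rw [← Real.exp_add]
    refine Real.one_le_exp ?_
    rw [Real.rpow_two]
    nlinarith [abs_nonneg x]
  have h2 : Real.exp (-(|x| ^ 2 / (4 * t))) = Real.exp (-(1 / (4 * t)) * |x| ^ (2 : ℝ)) := by
    rw [Real.rpow_two]
    congr 1
    ring
  have h3 : 0 ≤ |x| ^ (-a) := by positivity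
  unfold heatBound powGauss
  rw [h2, add_mul]
  refine add_le_add (le_of_eq (by ring)) ?_
  calc heatConst * t ^ (1 / 2 : ℝ) * |x| ^ (-a)
      ≤ (heatConst * t ^ (1 / 2 : ℝ) * |x| ^ (-a)) *
        (Real.exp 1 * Real.exp (-1 * |x| ^ (2 : ℝ))) :=
        le_mul_of_one_le_right (by positivity) h1
    _ = _ := by ring

lemma measurable_heatBound_mul_rpow (a t : ℝ) :
    Measurable fun r : ℝ => heatBound t r * r ^ (-a) := by
  unfold heatBound
  fun_prop

/-- By scaling, a normalized Gaussian of width √t integrates |x|^{-a} to order t^{-a/2}; the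
remainder of the heat bound contributes t^{1/2} since a < 1. -/
lemma circle_integral_heatBound {a : ℝ} (ha0 : 0 ≤ a) (ha : a < 1) : ∃ K, 0 ≤ K ∧ ∀ t, 0 < t →
    Integrable (fun y : UnitAddCircle => heatBound t ‖y‖ * ‖y‖ ^ (-a)) AddCircle.haarAddCircle ∧
    ∫ y : UnitAddCircle, heatBound t ‖y‖ * ‖y‖ ^ (-a) ∂AddCircle.haarAddCircle ≤
      K * (t ^ (-(a / 2)) + t ^ (1 / 2 : ℝ)) := by
  have hC := heatConst_nonneg
  have hG := Real.Gamma_pos_of_pos (s := (1 - a) / 2) (by linarith)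
  refine ⟨Real.Gamma ((1 - a) / 2) * (2 + heatConst * Real.exp 1), by positivity, fun t ht => ?_⟩
  have hpi := Real.pi_pos
  set M : ℝ → ℝ := fun x => (4 * Real.pi * t) ^ (-(1 / 2) : ℝ) * powGauss a (1 / (4 * t)) |x| +
      heatConst * t ^ (1 / 2 : ℝ) * Real.exp 1 * powGauss a 1 |x| with hM
  have hMi : Integrable M := ((integrable_powGauss ha (by positivity)).const_mul _).add
    ((integrable_powGauss ha one_pos).const_mul _)
  have hM0 : ∀ x, 0 ≤ M x := fun x => by
    simp only [hM, powGauss]; positivity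
  have hmeas := measurable_heatBound_mul_rpow a t
  have hsm : AEStronglyMeasurable (fun y : UnitAddCircle => heatBound t ‖y‖ * ‖y‖ ^ (-a))
      ((volume.restrict (Set.Ioc (-(1 / 2) : ℝ) (1 / 2))).map
        (fun x : ℝ => (x : UnitAddCircle))) :=
    (hmeas.comp measurable_norm).aestronglyMeasurable
  have hle : ∀ᵐ x : ℝ ∂(volume.restrict (Set.Ioc (-(1 / 2) : ℝ) (1 / 2))),
      ‖heatBound t ‖(x : UnitAddCircle)‖ * ‖(x : UnitAddCircle)‖ ^ (-a)‖ ≤ M x := by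
    rw [ae_restrict_iff' measurableSet_Ioc]
    refine .of_forall fun x hx => ?_
    rw [norm_coe_circle hx, Real.norm_of_nonneg
      (mul_nonneg (heatBound_nonneg ht _) (by positivity))]
    exact heatBound_mul_rpow_le ht (abs_le.2 ⟨hx.1.le, hx.2⟩)
  have hintg : Integrable (fun x : ℝ =>
      heatBound t ‖(x : UnitAddCircle)‖ * ‖(x : UnitAddCircle)‖ ^ (-a))
      (volume.restrict (Set.Ioc (-(1 / 2) : ℝ) (1 / 2))) :=
    hMi.restrict.mono' ((hmeas.comp measurable_norm).comp
      measurable_coe_circle).aestronglyMeasurable hle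
  rw [haarAddCircle_eq_map]
  refine ⟨(integrable_map_measure hsm measurable_coe_circle.aemeasurable).2 hintg, ?_⟩
  rw [integral_map measurable_coe_circle.aemeasurable hsm]
  have h1 : (4 * Real.pi * t) ^ (-(1 / 2) : ℝ) * (1 / (4 * t)) ^ (-((1 - a) / 2)) ≤
      2 * t ^ (-(a / 2)) := by
    have e1 : (4 * Real.pi * t) ^ (-(1 / 2) : ℝ) ≤ (4 * t) ^ (-(1 / 2) : ℝ) :=
      Real.rpow_le_rpow_of_nonpos (by positivity) (by nlinarith [Real.pi_gt_three]) (by norm_num)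
    have e2 : (4 * t) ^ (-(a / 2)) ≤ t ^ (-(a / 2)) :=
      Real.rpow_le_rpow_of_nonpos ht (by linarith) (by linarith)
    rw [one_div (4 * t), Real.inv_rpow (by positivity), ← Real.rpow_neg (by positivity), neg_neg]
    calc (4 * Real.pi * t) ^ (-(1 / 2) : ℝ) * (4 * t) ^ ((1 - a) / 2)
        ≤ (4 * t) ^ (-(1 / 2) : ℝ) * (4 * t) ^ ((1 - a) / 2) := by gcongr
      _ = (4 * t) ^ (-(a / 2)) := by
        rw [← Real.rpow_add (by positivity)]
        congr 1
        ring
      _ ≤ 2 * t ^ (-(a / 2)) := by linarith [Real.rpow_nonneg ht.le (-(a / 2))]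
  calc ∫ x in Set.Ioc (-(1 / 2) : ℝ) (1 / 2),
        heatBound t ‖(x : UnitAddCircle)‖ * ‖(x : UnitAddCircle)‖ ^ (-a)
      ≤ ∫ x in Set.Ioc (-(1 / 2) : ℝ) (1 / 2), M x :=
        integral_mono_ae hintg hMi.restrict (hle.mono fun x hx => (le_abs_self _).trans hx)
    _ ≤ ∫ x, M x := setIntegral_le_integral hMi (.of_forall hM0)
    _ = (4 * Real.pi * t) ^ (-(1 / 2) : ℝ) * (1 / (4 * t)) ^ (-((1 - a) / 2)) *
          Real.Gamma ((1 - a) / 2) +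
        heatConst * t ^ (1 / 2 : ℝ) * Real.exp 1 * Real.Gamma ((1 - a) / 2) := by
        rw [integral_add ((integrable_powGauss ha (by positivity)).const_mul _)
          ((integrable_powGauss ha one_pos).const_mul _), integral_const_mul, integral_const_mul,
          integral_powGauss ha (by positivity), integral_powGauss ha one_pos, Real.one_rpow]
        ring
    _ ≤ 2 * t ^ (-(a / 2)) * Real.Gamma ((1 - a) / 2) +
        heatConst * t ^ (1 / 2 : ℝ) * Real.exp 1 * Real.Gamma ((1 - a) / 2) := by gcongr
    _ ≤ _ := by
        have p1 : 0 ≤ t ^ (-(a / 2)) := by positivity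
        have p2 : 0 ≤ t ^ (1 / 2 : ℝ) := by positivity
        have p3 : 0 ≤ Real.exp 1 := by positivity
        have : 0 ≤ Real.Gamma ((1 - a) / 2) * (2 * t ^ (1 / 2 : ℝ) +
          heatConst * Real.exp 1 * t ^ (-(a / 2))) := by positivity
        linarith

/-- A majorant of `exp(-s) heatBound(s, r)²`. -/
def logMajorant (r s : ℝ) : ℝ :=
  (4 * Real.pi)⁻¹ * ((Set.Ioc 0 (r ^ 2)).indicator (fun _ => 2 / r ^ 2) s +
    (Set.Ioc (r ^ 2) 1).indicator (fun s => s⁻¹) s) +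
  ((1 + 2 * heatConst) * Real.exp (-s) + heatConst ^ 2 * (Real.exp (-s) * s ^ ((2 : ℝ) - 1)))

/-- In the square of the heat bound only the Gaussian term, of order E²/s, is singular: it is
handled by e^{-v} ≤ 1/v for s ≤ r², by 1/s on (r², 1], and by e^{-s} beyond. The cross term is
bounded because A R ≤ 1. -/
lemma exp_mul_heatBound_sq_le {r s : ℝ} (hr : 0 < r) (hs : 0 < s) :
    Real.exp (-s) * heatBound s r ^ 2 ≤ logMajorant r s := by
  have hC := heatConst_nonneg
  have hpi := Real.pi_gt_three
  set A := (4 * Real.pi * s) ^ (-(1 / 2) : ℝ) with hA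
  set E := Real.exp (-(r ^ 2 / (4 * s))) with hE
  set R := s ^ (1 / 2 : ℝ) with hR
  have hA2 : A ^ 2 = (4 * Real.pi)⁻¹ * s⁻¹ := by
    rw [hA, ← Real.rpow_mul_natCast (by positivity), ← mul_inv]
    norm_num [Real.rpow_neg_one]
  have hE2 : E ^ 2 = Real.exp (-(r ^ 2 / (2 * s))) := by
    rw [hE, ← Real.exp_nat_mul]
    congr 1
    push_cast
    field_simp
    norm_num
  have hR2 : R ^ 2 = s := by
    rw [hR, ← Real.rpow_mul_natCast hs.le]
    norm_num
  have hAR : A * R ≤ 1 := by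
    have h0 : 0 ≤ A := by positivity
    have h1 : 0 ≤ R := by positivity
    have h2 : (A * R) ^ 2 ≤ 1 := by
      rw [mul_pow, hA2, hR2, mul_assoc, inv_mul_cancel₀ hs.ne', mul_one]
      exact inv_le_one_of_one_le₀ (by linarith)
    exact (sq_le_one_iff₀ (by positivity)).1 h2
  have hE0 : 0 ≤ E := by positivity
  have hE1 : E ≤ 1 := Real.exp_le_one_iff.2 (by
    have : 0 ≤ r ^ 2 / (4 * s) := by positivity
    linarith)
  have hes : 0 < Real.exp (-s) := Real.exp_pos _
  have hes1 : Real.exp (-s) ≤ 1 := Real.exp_le_one_iff.2 (by linarith)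
  have hmain : Real.exp (-s) * (s⁻¹ * E ^ 2) ≤
      (Set.Ioc 0 (r ^ 2)).indicator (fun _ => 2 / r ^ 2) s +
      (Set.Ioc (r ^ 2) 1).indicator (fun s => s⁻¹) s + Real.exp (-s) := by
    have hE21 : E ^ 2 ≤ 1 := pow_le_one₀ hE0 hE1
    have hsi : 0 < s⁻¹ := by positivity
    have hprod : Real.exp (-s) * (s⁻¹ * E ^ 2) ≤ s⁻¹ * E ^ 2 :=
      mul_le_of_le_one_left (by positivity) hes1
    by_cases h1 : s ≤ r ^ 2
    · rw [Set.indicator_of_mem (Set.mem_Ioc.2 ⟨hs, h1⟩), Set.indicator_of_notMem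
        (fun h => absurd h.1 (not_lt.2 h1)), add_zero]
      have h2 : E ^ 2 ≤ 2 * s / r ^ 2 := by
        rw [hE2, Real.exp_neg, show 2 * s / r ^ 2 = (r ^ 2 / (2 * s))⁻¹ by rw [inv_div]]
        exact inv_anti₀ (by positivity) (by linarith [Real.add_one_le_exp (r ^ 2 / (2 * s))])
      calc _ ≤ s⁻¹ * E ^ 2 := hprod
        _ ≤ s⁻¹ * (2 * s / r ^ 2) := by gcongr
        _ = 2 / r ^ 2 := by field_simp
        _ ≤ _ := by linarith
    · push Not at h1
      rw [Set.indicator_of_notMem (fun h => absurd h.2 (not_le.2 h1)), zero_add]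
      by_cases h2 : s ≤ 1
      · rw [Set.indicator_of_mem (Set.mem_Ioc.2 ⟨h1, h2⟩)]
        have : s⁻¹ * E ^ 2 ≤ s⁻¹ := mul_le_of_le_one_right hsi.le hE21
        linarith
      · rw [Set.indicator_of_notMem (fun h => h2 h.2), zero_add]
        push Not at h2
        have h3 : s⁻¹ * E ^ 2 ≤ 1 := mul_le_one₀ (inv_le_one_of_one_le₀ h2.le) (by positivity) hE21
        exact mul_le_of_le_one_right hes.le h3
  have hpi4 : (4 * Real.pi)⁻¹ ≤ 1 := inv_le_one_of_one_le₀ (by linarith)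
  have hpi0 : 0 ≤ (4 * Real.pi)⁻¹ := by positivity
  have h1 : Real.exp (-s) * heatBound s r ^ 2 = (4 * Real.pi)⁻¹ * (Real.exp (-s) * (s⁻¹ * E ^ 2)) +
      2 * heatConst * (A * R * E) * Real.exp (-s) + heatConst ^ 2 * (Real.exp (-s) * s) := by
    have : heatBound s r = A * E + heatConst * R := rfl
    rw [this]
    linear_combination (Real.exp (-s) * E ^ 2) * hA2 + heatConst ^ 2 * Real.exp (-s) * hR2
  have h2 : 2 * heatConst * (A * R * E) * Real.exp (-s) ≤ 2 * heatConst * Real.exp (-s) := by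
    have : A * R * E ≤ 1 := mul_le_one₀ hAR hE0 hE1
    have := mul_le_mul_of_nonneg_left this (by positivity : 0 ≤ 2 * heatConst * Real.exp (-s))
    linarith
  have h3 := mul_le_mul_of_nonneg_left hmain hpi0
  have h4 : (4 * Real.pi)⁻¹ * Real.exp (-s) ≤ Real.exp (-s) := mul_le_of_le_one_left hes.le hpi4
  have h5 : s ^ ((2 : ℝ) - 1) = s := by norm_num
  rw [h1, logMajorant, h5]
  linarith

/-- The logarithm is the integral of 1/s over (r², 1]; all other pieces contribute constants. -/
lemma integrableOn_logMajorant {r : ℝ} (hr : 0 < r) (hr1 : r ≤ 1) :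
    IntegrableOn (logMajorant r) (Set.Ioi 0) ∧
    ∫ s in Set.Ioi 0, logMajorant r s =
      (4 * Real.pi)⁻¹ * (2 - 2 * Real.log r) + (1 + 2 * heatConst + heatConst ^ 2) := by
  have hr2 : 0 < r ^ 2 := by positivity
  have hr21 : r ^ 2 ≤ 1 := pow_le_one₀ hr.le hr1
  have i1 : IntegrableOn ((Set.Ioc 0 (r ^ 2)).indicator (fun _ => 2 / r ^ 2)) (Set.Ioi 0) :=
    ((integrableOn_const (by simp)).integrable_indicator measurableSet_Ioc).integrableOn
  have hinv : IntervalIntegrable (fun s : ℝ => s⁻¹) volume (r ^ 2) 1 :=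
    intervalIntegral.intervalIntegrable_inv (fun x hx => by
      rw [Set.uIcc_of_le hr21] at hx
      exact (hr2.trans_le hx.1).ne') continuousOn_id
  have i2 : IntegrableOn ((Set.Ioc (r ^ 2) 1).indicator (fun s : ℝ => s⁻¹)) (Set.Ioi 0) := by
    refine (IntegrableOn.integrable_indicator ?_ measurableSet_Ioc).integrableOn
    exact (intervalIntegrable_iff_integrableOn_Ioc_of_le hr21).1 hinv
  have i3 : IntegrableOn (fun s : ℝ => Real.exp (-s)) (Set.Ioi 0) := integrableOn_exp_neg_Ioi 0
  have i4 : IntegrableOn (fun s : ℝ => Real.exp (-s) * s ^ ((2 : ℝ) - 1)) (Set.Ioi 0) :=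
    Real.GammaIntegral_convergent two_pos
  have v1 : ∫ s in Set.Ioi 0, (Set.Ioc 0 (r ^ 2)).indicator (fun _ => 2 / r ^ 2) s = 2 := by
    rw [setIntegral_indicator measurableSet_Ioc, Set.inter_eq_self_of_subset_right
      (fun x hx => hx.1), setIntegral_const]
    simp only [measureReal_def, Real.volume_Ioc, sub_zero, ENNReal.toReal_ofReal hr2.le, smul_eq_mul]
    field_simp
  have v2 : ∫ s in Set.Ioi 0, (Set.Ioc (r ^ 2) 1).indicator (fun s : ℝ => s⁻¹) s =
      -2 * Real.log r := by
    rw [setIntegral_indicator measurableSet_Ioc, Set.inter_eq_self_of_subset_right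
      (fun x (hx : x ∈ Set.Ioc (r ^ 2) 1) => Set.mem_Ioi.2 (hr2.trans hx.1)), ← intervalIntegral.integral_of_le hr21, integral_inv,
      one_div, Real.log_inv, Real.log_pow]
    · push_cast; ring
    · rw [Set.uIcc_of_le hr21]
      exact fun h => absurd h.1 (not_le.2 hr2)
  have v4 : ∫ s in Set.Ioi 0, Real.exp (-s) * s ^ ((2 : ℝ) - 1) = 1 := by
    rw [← Real.Gamma_eq_integral two_pos, Real.Gamma_two]
  have j1 := (i1.add i2).const_mul (4 * Real.pi)⁻¹
  have j2 := (i3.const_mul (1 + 2 * heatConst)).add (i4.const_mul (heatConst ^ 2))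
  refine ⟨j1.add j2, ?_⟩
  calc ∫ s in Set.Ioi 0, logMajorant r s
      = (4 * Real.pi)⁻¹ * (2 + -2 * Real.log r) +
        ((1 + 2 * heatConst) * 1 + heatConst ^ 2 * 1) := by
        refine (integral_add j1 j2).trans ?_
        congr 1
        · refine (integral_const_mul _ _).trans ?_
          congr 1
          refine (integral_add i1 i2).trans ?_
          rw [v1, v2]
        · refine (integral_add (i3.const_mul (1 + 2 * heatConst))
            (i4.const_mul (heatConst ^ 2))).trans ?_
          rw [integral_const_mul, integral_const_mul, integral_exp_neg_Ioi_zero, v4]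
    _ = _ := by ring

/-! ## The summability bound for the covariance of the chaos -/

/-- The regularized Green's function `½ ∑_m exp(-ε (1 + 4 π² |m|²)) / (1 + 4 π² |m|²) e_m`. -/
def greenReg (ε : ℝ) : C(T2, ℂ) :=
  fourierSeries fun m => Real.exp (-(ε * eigen m)) / (2 * eigen m)

lemma summable_greenReg {ε : ℝ} (hε : 0 < ε) :
    Summable fun m => Real.exp (-(ε * eigen m)) / (2 * eigen m) := by
  refine (summable_exp_neg_mul_eigen hε).of_nonneg_of_le (fun m => ?_) fun m => ?_
  · have := eigen_pos m
    positivity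
  · exact div_le_self (Real.exp_pos _).le (by linarith [one_le_eigen m])

lemma integral_exp_neg_mul_Ioi {ε c : ℝ} (hc : 0 < c) :
    IntegrableOn (fun s => Real.exp (-(s * c))) (Set.Ioi ε) ∧
    ∫ s in Set.Ioi ε, Real.exp (-(s * c)) = Real.exp (-(ε * c)) / c := by
  have h := integrableOn_exp_mul_Ioi (a := -c) (by linarith) ε
  have h2 := integral_exp_mul_Ioi (a := -c) (by linarith) ε
  simp only [show ∀ s : ℝ, -c * s = -(s * c) from fun s => by ring] at h h2
  exact ⟨h, h2.trans (neg_div_neg_eq _ _)⟩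

/-- For each frequency the integral of e^{-sλ} over (ε, ∞) is e^{-ελ}/λ; sum and integral commute by
absolute convergence. -/
lemma greenReg_apply {ε : ℝ} (hε : 0 < ε) (x : T2) :
    greenReg ε x = ∫ s in Set.Ioi ε, (1 / 2 : ℂ) * heat s x := by
  set F : Freq → ℝ → ℂ := fun m s =>
    (1 / 2 : ℂ) * (((Real.exp (-(s * eigen m)) : ℝ) : ℂ) * mFourier m x) with hF
  have hn : ∀ m s, ‖F m s‖ = 1 / 2 * Real.exp (-(s * eigen m)) := by
    intro m s
    simp only [hF, norm_mul, norm_mFourier_apply, Complex.norm_real,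
      Real.norm_of_nonneg (Real.exp_pos _).le]
    norm_num
  have hFi : ∀ m, Integrable (F m) (volume.restrict (Set.Ioi ε)) := fun m =>
    (((integral_exp_neg_mul_Ioi (eigen_pos m)).1.ofReal (𝕜 := ℂ)).mul_const _).const_mul _
  have hval : ∀ m, ∫ s in Set.Ioi ε, F m s =
      ((Real.exp (-(ε * eigen m)) / (2 * eigen m) : ℝ) : ℂ) * mFourier m x := by
    intro m
    simp only [hF]
    rw [integral_const_mul, integral_mul_const, integral_complex_ofReal,
      (integral_exp_neg_mul_Ioi (eigen_pos m)).2]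
    push_cast
    have : (eigen m : ℂ) ≠ 0 := by exact_mod_cast (eigen_pos m).ne'
    field_simp
  have hs : Summable fun m => ∫ s in Set.Ioi ε, ‖F m s‖ := by
    refine (summable_greenReg hε).congr fun m => ?_
    simp only [hn]
    rw [integral_const_mul, (integral_exp_neg_mul_Ioi (eigen_pos m)).2]
    have := (eigen_pos m).ne'
    field_simp
  have h := hasSum_integral_of_summable_integral_norm hFi hs
  simp only [hval] at h
  rw [greenReg, (hasSum_fourierSeries_apply (summable_greenReg hε) x).unique h]
  refine setIntegral_congr_fun measurableSet_Ioi fun s hs => ?_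
  have hs0 : 0 < s := hε.trans hs
  exact ((hasSum_fourierSeries_apply (summable_exp_neg_mul_eigen hs0) x).mul_left _).tsum_eq

/-- The constant in the logarithmic bound of the Green's function. -/
def greenConst : ℝ := (4 * Real.pi)⁻¹ + (1 + 2 * heatConst + heatConst ^ 2) / 2

lemma circle_norm_le (x : UnitAddCircle) : ‖x‖ ≤ 1 := by
  obtain ⟨y, -, h1, h2⟩ := exists_coe_eq_abs_eq_norm x
  rw [← h1]
  linarith

/-- The heat kernel is a product over the two coordinates; bounding the product by half the sum of
squares separates them. The coefficient is ¼ · 2 · (4π)⁻¹ = (8π)⁻¹, which is where the threshold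
γ²/8π comes from. The bound is uniform in ε. -/
lemma norm_greenReg_le {ε : ℝ} (hε : 0 < ε) {x : T2} (hx : ∀ i, x i ≠ 0) :
    ‖greenReg ε x‖ ≤
      greenConst - (8 * Real.pi)⁻¹ * (Real.log ‖x 0‖ + Real.log ‖x 1‖) := by
  have hr : ∀ i, 0 < ‖x i‖ := fun i => norm_pos_iff.2 (hx i)
  have I0 := integrableOn_logMajorant (hr 0) (circle_norm_le _)
  have I1 := integrableOn_logMajorant (hr 1) (circle_norm_le _)
  have hI : IntegrableOn (fun s => 1 / 4 * (logMajorant ‖x 0‖ s + logMajorant ‖x 1‖ s))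
      (Set.Ioi 0) := (I0.1.add I1.1).const_mul _
  have hb : ∀ s, 0 < s → ‖(1 / 2 : ℂ) * heat s x‖ ≤
      1 / 4 * (logMajorant ‖x 0‖ s + logMajorant ‖x 1‖ s) := by
    intro s hs
    have h0 := exp_mul_heatBound_sq_le (hr 0) hs
    have h1 := exp_mul_heatBound_sq_le (hr 1) hs
    have h2 := norm_heat_le hs x
    have h3 : Real.exp (-s) * (heatBound s ‖x 0‖ * heatBound s ‖x 1‖) ≤
        1 / 2 * (Real.exp (-s) * heatBound s ‖x 0‖ ^ 2 +
          Real.exp (-s) * heatBound s ‖x 1‖ ^ 2) := by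
      nlinarith [mul_nonneg (Real.exp_pos (-s)).le
        (sq_nonneg (heatBound s ‖x 0‖ - heatBound s ‖x 1‖))]
    rw [norm_mul, show ‖(1 / 2 : ℂ)‖ = 1 / 2 by norm_num]
    linarith
  rw [greenReg_apply hε]
  calc ‖∫ s in Set.Ioi ε, (1 / 2 : ℂ) * heat s x‖
      ≤ ∫ s in Set.Ioi ε, 1 / 4 * (logMajorant ‖x 0‖ s + logMajorant ‖x 1‖ s) := by
        refine norm_integral_le_of_norm_le (hI.mono_set (Set.Ioi_subset_Ioi hε.le)) ?_
        rw [ae_restrict_iff' measurableSet_Ioi]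
        exact .of_forall fun s hs => hb s (hε.trans hs)
    _ ≤ ∫ s in Set.Ioi 0, 1 / 4 * (logMajorant ‖x 0‖ s + logMajorant ‖x 1‖ s) := by
        refine setIntegral_mono_set hI ?_ (Set.Ioi_subset_Ioi hε.le).eventuallyLE
        rw [EventuallyLE, ae_restrict_iff' measurableSet_Ioi]
        exact .of_forall fun s hs => (norm_nonneg _).trans (hb s hs)
    _ = _ := by
        rw [integral_const_mul, integral_add I0.1 I1.1, I0.2, I1.2, greenConst]
        have := Real.pi_ne_zero
        field_simp
        ring

/-! ### Comparison of truncated and regularized Green's functions -/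

/-- The truncated Green's function `½ ∑_{m ∈ F} e_m / (1 + 4 π² |m|²)`. -/
def greenPoly (F : Finset Freq) : C(T2, ℂ) :=
  ∑ m ∈ F, ((1 / (2 * eigen m) : ℝ) : ℂ) • mFourier m

lemma smul_greenPoly_mem_posCone {r : ℝ} (hr : 0 ≤ r) (F : Finset Freq) :
    (r : ℂ) • greenPoly F ∈ posCone :=
  smul_mem_posCone hr (sum_mem fun m _ => smul_mFourier_mem_posCone
    (by have := eigen_pos m; positivity) m)

lemma greenReg_sub_greenPoly_mem_posCone {ε b c : ℝ} (hε : 0 < ε) (hc : 0 ≤ c) (F : Finset Freq)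
    (h : ∀ m ∈ F, b ≤ c * Real.exp (-(ε * eigen m))) :
    (c : ℂ) • greenReg ε - (b : ℂ) • greenPoly F ∈ posCone := by
  classical
  have h1 := (hasSum_fourierSeries (summable_greenReg hε)).const_smul (c : ℂ)
  have h2 : HasSum (fun m => if m ∈ F then ((1 / (2 * eigen m) : ℝ) : ℂ) • mFourier m else 0)
      (greenPoly F) := by
    have : HasSum (fun m => if m ∈ F then ((1 / (2 * eigen m) : ℝ) : ℂ) • mFourier m else 0)
        (∑ m ∈ F, if m ∈ F then ((1 / (2 * eigen m) : ℝ) : ℂ) • mFourier m else 0) :=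
      hasSum_sum_of_ne_finset_zero fun m hm => if_neg hm
    rwa [Finset.sum_congr rfl (fun m hm => if_pos hm)] at this
  refine hasSum_mem_posCone (h1.sub (h2.const_smul (b : ℂ))) fun m => ?_
  have he := eigen_pos m
  split_ifs with hm
  · have : (c : ℂ) • ((Real.exp (-(ε * eigen m)) / (2 * eigen m) : ℝ) : ℂ) • mFourier m -
        (b : ℂ) • ((1 / (2 * eigen m) : ℝ) : ℂ) • mFourier m =
        (((c * Real.exp (-(ε * eigen m)) - b) / (2 * eigen m) : ℝ) : ℂ) • mFourier m := by
      ext x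
      simp only [ContinuousMap.sub_apply, ContinuousMap.smul_apply, smul_eq_mul]
      push_cast
      ring
    rw [this]
    exact smul_mFourier_mem_posCone (div_nonneg (sub_nonneg.2 (h m hm)) (by positivity)) m
  · rw [smul_zero, sub_zero, smul_smul, ← Complex.ofReal_mul]
    exact smul_mFourier_mem_posCone (by positivity) m

/-- The zeroth coefficient of the product collects the terms e^{-tλ_m} f̂(m), all nonnegative, so
any finite part of them is smaller. The proof removes that finite part from the heat kernel and
stays in the cone. -/
lemma sum_exp_mul_coef_le {t : ℝ} (ht : 0 < t) {f : C(T2, ℂ)} (hf : f ∈ posCone)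
    (B : Finset Freq) :
    ∑ m ∈ B, Real.exp (-(t * eigen m)) * (coef f m).re ≤ (coef (heat t * f : C(T2, ℂ)) 0).re := by
  classical
  have hsum := hasSum_fourierSeries (summable_exp_neg_mul_eigen ht)
  have hB : HasSum (fun m => if m ∈ B.map (Equiv.neg Freq).toEmbedding then
      ((Real.exp (-(t * eigen m)) : ℝ) : ℂ) • mFourier m else 0)
      (∑ m ∈ B, ((Real.exp (-(t * eigen m)) : ℝ) : ℂ) • mFourier (-m)) := by
    have : HasSum (fun m => if m ∈ B.map (Equiv.neg Freq).toEmbedding then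
        ((Real.exp (-(t * eigen m)) : ℝ) : ℂ) • mFourier m else 0)
        (∑ m ∈ B.map (Equiv.neg Freq).toEmbedding, if m ∈ B.map (Equiv.neg Freq).toEmbedding then
          ((Real.exp (-(t * eigen m)) : ℝ) : ℂ) • mFourier m else 0) :=
      hasSum_sum_of_ne_finset_zero fun m hm => if_neg hm
    rw [Finset.sum_congr rfl (fun m hm => if_pos hm), Finset.sum_map] at this
    simpa [eigen_neg] using this
  have hmem : heat t - ∑ m ∈ B, ((Real.exp (-(t * eigen m)) : ℝ) : ℂ) • mFourier (-m) ∈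
      posCone := by
    refine hasSum_mem_posCone (hsum.sub hB) fun m => ?_
    split_ifs
    · rw [sub_self]; exact zero_mem _
    · rw [sub_zero]; exact smul_mFourier_mem_posCone (Real.exp_pos _).le m
  have h := coef_nonneg (mul_mem hmem hf) 0
  rw [sub_mul, coef_sub, Finset.sum_mul] at h
  have hs : coef (∑ m ∈ B, ((Real.exp (-(t * eigen m)) : ℝ) : ℂ) • mFourier (-m) * f : C(T2, ℂ)) 0 =
      ∑ m ∈ B, ((Real.exp (-(t * eigen m)) : ℝ) : ℂ) * coef f m := by
    let L : C(T2, ℂ) →+ ℂ :=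
      { toFun := fun f : C(T2, ℂ) => coef f 0
        map_zero' := by simp [coef]
        map_add' := fun f g => coef_add f g 0 }
    refine (map_sum L _ _).trans (Finset.sum_congr rfl fun m _ => ?_)
    change coef (((Real.exp (-(t * eigen m)) : ℝ) : ℂ) • mFourier (-m) * f : C(T2, ℂ)) 0 = _
    rw [smul_mul_assoc, coef_smul, coef_mFourier_mul, zero_sub, neg_neg]
  rw [hs, sub_nonneg] at h
  have := (Complex.le_def.1 h).1
  rw [Complex.re_sum] at this
  simpa only [Complex.re_ofReal_mul] using this

lemma norm_expC_greenReg_le {ε a : ℝ} (hε : 0 < ε) (ha : 0 ≤ a) {x : T2} (hx : ∀ i, x i ≠ 0) :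
    ‖expC (((8 * Real.pi * a : ℝ) : ℂ) • greenReg ε) x‖ ≤
      Real.exp (8 * Real.pi * a * greenConst) * (‖x 0‖ ^ (-a) * ‖x 1‖ ^ (-a)) := by
  have hr : ∀ i, 0 < ‖x i‖ := fun i => norm_pos_iff.2 (hx i)
  have hpi := Real.pi_pos
  rw [expC_apply, Complex.norm_exp, Real.rpow_def_of_pos (hr 0), Real.rpow_def_of_pos (hr 1),
    ← Real.exp_add, ← Real.exp_add, Real.exp_le_exp]
  refine (Complex.re_le_norm _).trans ?_
  rw [ContinuousMap.smul_apply, norm_smul, Complex.norm_real, Real.norm_of_nonneg (by positivity)]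
  refine (mul_le_mul_of_nonneg_left (norm_greenReg_le hε hx) (by positivity)).trans (le_of_eq ?_)
  field_simp
  ring

/-- Both the heat kernel and the exponential of the Green's function are dominated by products over
the coordinates, so the torus integral is at most a constant times the square of a circle integral.
-/
lemma exists_norm_coef_heat_mul_le {a : ℝ} (ha : 0 ≤ a) (ha1 : a < 1) :
    ∃ K, 0 ≤ K ∧ ∀ ε t, 0 < ε → 0 < t →
      ‖coef (heat t * expC (((8 * Real.pi * a : ℝ) : ℂ) • greenReg ε) : C(T2, ℂ)) 0‖ ≤
        K * Real.exp (-t) * (t ^ (-a) + t) := by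
  obtain ⟨K, hK0, hK⟩ := circle_integral_heatBound ha ha1
  set D := Real.exp (8 * Real.pi * a * greenConst) with hD
  refine ⟨2 * D * K ^ 2, by positivity, fun ε t hε ht => ?_⟩
  obtain ⟨hi, hle⟩ := hK t ht
  set g := expC (((8 * Real.pi * a : ℝ) : ℂ) • greenReg ε) with hg
  set f : UnitAddCircle → ℝ := fun y => heatBound t ‖y‖ * ‖y‖ ^ (-a) with hf
  set J := ∫ y, f y ∂AddCircle.haarAddCircle with hJ
  have hJ0 : 0 ≤ J := integral_nonneg fun y =>
    mul_nonneg (heatBound_nonneg ht _) (by positivity)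
  have hintg : Integrable (fun x : T2 => Real.exp (-t) * D * ∏ i, f (x i)) torusMeasure :=
    (Integrable.fintype_prod (f := fun _ => f) fun _ => hi).const_mul _
  have h1 : ‖coef (heat t * g : C(T2, ℂ)) 0‖ ≤ Real.exp (-t) * D * J ^ 2 := by
    have h2 : ∫ x : T2, Real.exp (-t) * D * ∏ i, f (x i) ∂torusMeasure =
        Real.exp (-t) * D * J ^ 2 := by
      rw [integral_const_mul, integral_fintype_prod_eq_prod (fun _ => f), Fin.prod_univ_two, sq]
    rw [← h2]
    refine norm_integral_le_of_norm_le hintg ?_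
    filter_upwards [ae_torus_ne_zero] with x hx
    rw [norm_mul, norm_mFourier_apply, mul_one, ContinuousMap.mul_apply, norm_mul,
      Fin.prod_univ_two]
    calc ‖heat t x‖ * ‖g x‖ ≤ (Real.exp (-t) * (heatBound t ‖x 0‖ * heatBound t ‖x 1‖)) *
          (D * (‖x 0‖ ^ (-a) * ‖x 1‖ ^ (-a))) := by
          refine mul_le_mul (norm_heat_le ht x) (norm_expC_greenReg_le hε ha hx) (norm_nonneg _) ?_
          exact mul_nonneg (Real.exp_pos _).le
            (mul_nonneg (heatBound_nonneg ht _) (heatBound_nonneg ht _))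
      _ = _ := by simp only [hf]; ring
  have h3 : J ^ 2 ≤ K ^ 2 * (2 * (t ^ (-a) + t)) := by
    have e1 : (t ^ (-(a / 2))) ^ 2 = t ^ (-a) := by
      rw [← Real.rpow_mul_natCast ht.le]
      congr 1
      push_cast
      ring
    have e2 : (t ^ (1 / 2 : ℝ)) ^ 2 = t := by
      rw [← Real.rpow_mul_natCast ht.le]
      norm_num
    calc J ^ 2 ≤ (K * (t ^ (-(a / 2)) + t ^ (1 / 2 : ℝ))) ^ 2 := pow_le_pow_left₀ hJ0 hle 2
      _ ≤ K ^ 2 * (2 * ((t ^ (-(a / 2))) ^ 2 + (t ^ (1 / 2 : ℝ)) ^ 2)) := by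
        rw [mul_pow]
        gcongr
        exact add_sq_le
      _ = _ := by rw [e1, e2]
  calc _ ≤ Real.exp (-t) * D * J ^ 2 := h1
    _ ≤ Real.exp (-t) * D * (K ^ 2 * (2 * (t ^ (-a) + t))) := by gcongr
    _ = _ := by ring

/-- The Fourier coefficients of `exp(γ² ½ ∑_{m ∈ F} e_m / (1 + 4 π² |m|²))`, which are the second
moments of the Fourier coefficients of the truncated chaos. -/
def chaosCoef (γ : ℝ) (F : Finset Freq) (m : Freq) : ℝ :=
  (coef (expC (((γ ^ 2 : ℝ) : ℂ) • greenPoly F)) m).re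

/-- The uniform mass bound, and the only place where β > γ²/8π is needed. The weight is a Gamma
integral of e^{-tλ}, positivity replaces γ² G_F by 8πa times the regularized Green's function, and
the remaining integral of t^{β-1}(t^{-a} + t)e^{-t} is finite. -/
lemma exists_sum_chaosCoef_le {γ β : ℝ} (hγ : γ ≠ 0) (h1 : γ ^ 2 / (8 * Real.pi) < β) (h2 : β < 1) :
    ∃ K, ∀ F B : Finset Freq, ∑ m ∈ B, eigen m ^ (-β) * chaosCoef γ F m ≤ K := by
  have hpi := Real.pi_pos
  have hγ2 : 0 < γ ^ 2 := by positivity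
  -- The margin a > γ²/8π pays for the regularization; a < β < 1 gives convergence in t and in x.
  obtain ⟨a, ha1, ha2⟩ := exists_between h1
  have ha0 : 0 < a := lt_trans (by positivity) ha1
  have hβ : 0 < β := ha0.trans ha2
  rw [div_lt_iff₀ (by positivity)] at ha1
  obtain ⟨K, hK0, hK⟩ := exists_norm_coef_heat_mul_le ha0.le (ha2.trans h2)
  refine ⟨(Real.Gamma β)⁻¹ * (K * (Real.Gamma (β - a) + Real.Gamma (β + 1))), fun F B => ?_⟩
  -- As F is finite and γ² < 8πa, a small ε makes the regularized coefficients dominate on F. It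
  -- depends on F, but the bound `hK` does not depend on ε.
  obtain ⟨ε, hε, hεF⟩ : ∃ ε, 0 < ε ∧ ∀ m ∈ F, γ ^ 2 ≤ 8 * Real.pi * a *
      Real.exp (-(ε * eigen m)) := by
    have : ∀ᶠ ε in 𝓝[>] (0 : ℝ), ∀ m ∈ F, γ ^ 2 < 8 * Real.pi * a * Real.exp (-(ε * eigen m)) := by
      refine (Finset.eventually_all F).2 fun m _ => ?_
      have hc : Continuous fun ε : ℝ => 8 * Real.pi * a * Real.exp (-(ε * eigen m)) := by fun_prop
      have ht := (hc.tendsto 0).mono_left (nhdsWithin_le_nhds (s := Set.Ioi 0))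
      simp only [zero_mul, neg_zero, Real.exp_zero, mul_one] at ht
      exact ht.eventually (lt_mem_nhds (by linarith))
    obtain ⟨ε, h3, h4⟩ := (this.and self_mem_nhdsWithin).exists
    exact ⟨ε, h4, fun m hm => (h3 m hm).le⟩
  set f := expC (((8 * Real.pi * a : ℝ) : ℂ) • greenReg ε) with hf
  have hreg : ((8 * Real.pi * a : ℝ) : ℂ) • greenReg ε ∈ posCone := by
    refine smul_mem_posCone (by positivity) (hasSum_mem_posCone
      (hasSum_fourierSeries (summable_greenReg hε)) fun m => smul_mFourier_mem_posCone ?_ m)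
    have := eigen_pos m
    positivity
  have hfp : f ∈ posCone := expC_mem_posCone hreg
  have hle : ∀ m, chaosCoef γ F m ≤ (coef f m).re := fun m =>
    (Complex.le_def.1 (coef_expC_mono (smul_greenPoly_mem_posCone hγ2.le F)
      (greenReg_sub_greenPoly_mem_posCone hε (by positivity) F hεF) m)).1
  have hG : 0 < Real.Gamma β := Real.Gamma_pos_of_pos hβ
  have hval : ∀ m, ∫ t in Set.Ioi (0 : ℝ), t ^ (β - 1) * Real.exp (-(eigen m * t)) =
      eigen m ^ (-β) * Real.Gamma β := by
    intro m
    rw [Real.integral_rpow_mul_exp_neg_mul_Ioi hβ (eigen_pos m), one_div,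
      Real.inv_rpow (eigen_pos m).le, Real.rpow_neg (eigen_pos m).le]
  have hintg : ∀ m, IntegrableOn (fun t : ℝ => t ^ (β - 1) * Real.exp (-(eigen m * t)))
      (Set.Ioi 0) := by
    intro m
    refine Integrable.of_integral_ne_zero ?_
    rw [hval]
    have := eigen_pos m
    positivity
  have hGi : IntegrableOn (fun t : ℝ => K * (Real.exp (-t) * t ^ (β - a - 1) +
      Real.exp (-t) * t ^ (β + 1 - 1))) (Set.Ioi 0) :=
    ((Real.GammaIntegral_convergent (sub_pos.2 ha2)).add
      (Real.GammaIntegral_convergent (by linarith))).const_mul _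
  have hmain : Real.Gamma β * ∑ m ∈ B, eigen m ^ (-β) * (coef f m).re ≤
      K * (Real.Gamma (β - a) + Real.Gamma (β + 1)) := by
    calc Real.Gamma β * ∑ m ∈ B, eigen m ^ (-β) * (coef f m).re
        = ∫ t in Set.Ioi (0 : ℝ), ∑ m ∈ B,
            t ^ (β - 1) * Real.exp (-(eigen m * t)) * (coef f m).re := by
          rw [integral_finsetSum _ fun m _ => (hintg m).mul_const _, Finset.mul_sum]
          refine Finset.sum_congr rfl fun m _ => ?_
          rw [integral_mul_const, hval]
          ring
      _ ≤ ∫ t in Set.Ioi (0 : ℝ), K * (Real.exp (-t) * t ^ (β - a - 1) +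
            Real.exp (-t) * t ^ (β + 1 - 1)) := by
          refine setIntegral_mono_on (integrable_finsetSum _ fun m _ => (hintg m).mul_const _) hGi
            measurableSet_Ioi fun t ht => ?_
          have ht0 : 0 < t := ht
          have h3 := (sum_exp_mul_coef_le ht0 hfp B).trans
            ((Complex.re_le_norm _).trans (hK ε t hε ht0))
          have h4 := mul_le_mul_of_nonneg_left h3 (Real.rpow_nonneg ht0.le (β - 1))
          have e1 : t ^ (β - 1) * t ^ (-a) = t ^ (β - a - 1) := by
            rw [← Real.rpow_add ht0]; congr 1; ring
          have e2 : t ^ (β - 1) * t = t ^ (β + 1 - 1) := by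
            rw [← Real.rpow_add_one ht0.ne']; congr 1; ring
          calc _ = t ^ (β - 1) * ∑ m ∈ B, Real.exp (-(t * eigen m)) * (coef f m).re := by
                rw [Finset.mul_sum]
                refine Finset.sum_congr rfl fun m _ => ?_
                rw [mul_comm (eigen m) t]
                ring
            _ ≤ _ := h4
            _ = _ := by rw [← e1, ← e2]; ring
      _ = _ := by
          rw [integral_const_mul, integral_add (Real.GammaIntegral_convergent (sub_pos.2 ha2))
            (Real.GammaIntegral_convergent (by linarith)), ← Real.Gamma_eq_integral (by linarith),
            ← Real.Gamma_eq_integral (by linarith)]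
  rw [← div_eq_inv_mul, le_div_iff₀' hG]
  refine le_trans ?_ hmain
  gcongr with m
  · exact Real.rpow_nonneg (eigen_pos m).le _
  · exact hle m

/-! ## The Hartley basis -/

lemma sum_neg_freq {M : Type*} [AddCommMonoid M] {F : Finset Freq} (hF : ∀ m ∈ F, -m ∈ F)
    (f : Freq → M) : ∑ m ∈ F, f (-m) = ∑ m ∈ F, f m :=
  Finset.sum_nbij' (fun m => -m) (fun m => -m) hF hF (fun _ _ => neg_neg _) (fun _ _ => neg_neg _)
    (fun _ _ => rfl)

/-- The coefficient `(1 - i) / 2` of `e_m` in `cos(2 π m · x) + sin(2 π m · x)`. -/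
def casCoeff : ℂ := (1 - Complex.I) / 2

/-- The coefficient `(1 + i) / 2` of `e_{-m}` in `cos(2 π m · x) + sin(2 π m · x)`. -/
def casCoeff' : ℂ := (1 + Complex.I) / 2

lemma casCoeff_sq : casCoeff * casCoeff = -(Complex.I / 2) := by
  unfold casCoeff
  linear_combination (1 / 4 : ℂ) * Complex.I_sq

lemma casCoeff'_sq : casCoeff' * casCoeff' = Complex.I / 2 := by
  unfold casCoeff'
  linear_combination (1 / 4 : ℂ) * Complex.I_sq

lemma casCoeff_mul : casCoeff * casCoeff' = 1 / 2 := by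
  unfold casCoeff casCoeff'
  linear_combination (-1 / 4 : ℂ) * Complex.I_sq

/-- The terms U(m)V(m) and U(-m)V(-m) carry the factors -i/2 and i/2 and cancel after m ↦ -m; the
two mixed terms, ½ each, coincide after the same substitution. -/
lemma sum_cas {F : Finset Freq} (hF : ∀ m ∈ F, -m ∈ F) {w : Freq → ℂ} (hw : ∀ m, w (-m) = w m)
    (U V : Freq → ℂ) :
    ∑ m ∈ F, w m * ((casCoeff * U m + casCoeff' * U (-m)) *
      (casCoeff * V m + casCoeff' * V (-m))) = ∑ m ∈ F, w m * (U (-m) * V m) := by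
  have h1 : ∑ m ∈ F, w m * (U (-m) * V (-m)) = ∑ m ∈ F, w m * (U m * V m) := by
    rw [← sum_neg_freq hF fun m => w m * (U m * V m)]
    exact Finset.sum_congr rfl fun m _ => by rw [hw]
  have h2 : ∑ m ∈ F, w m * (U m * V (-m)) = ∑ m ∈ F, w m * (U (-m) * V m) := by
    rw [← sum_neg_freq hF fun m => w m * (U (-m) * V m)]
    exact Finset.sum_congr rfl fun m _ => by rw [hw, neg_neg]
  calc _ = ∑ m ∈ F, (-(Complex.I / 2) * (w m * (U m * V m)) +
        Complex.I / 2 * (w m * (U (-m) * V (-m))) + 1 / 2 * (w m * (U m * V (-m))) +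
        1 / 2 * (w m * (U (-m) * V m))) := by
        refine Finset.sum_congr rfl fun m _ => ?_
        linear_combination (w m * U m * V m) * casCoeff_sq +
          (w m * U (-m) * V (-m)) * casCoeff'_sq +
          (w m * (U m * V (-m) + U (-m) * V m)) * casCoeff_mul
    _ = _ := by
        simp only [Finset.sum_add_distrib, ← Finset.mul_sum, h1, h2]
        ring

/-- The Hartley function `cos(2 π m · x) + sin(2 π m · x)` as a continuous function. -/
def casFun (m : Freq) : C(T2, ℂ) := casCoeff • mFourier m + casCoeff' • mFourier (-m)

/-- The Hartley function `cos(2 π m · x) + sin(2 π m · x)`. -/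
def cas (m : Freq) (x : T2) : ℝ := (mFourier m x).re + (mFourier m x).im

lemma casFun_apply (m : Freq) (x : T2) :
    casFun m x = casCoeff * mFourier m x + casCoeff' * mFourier (-m) x := rfl

lemma casFun_eq_cas (m : Freq) (x : T2) : casFun m x = cas m x := by
  rw [casFun_apply, mFourier_neg, cas, casCoeff, casCoeff']
  apply Complex.ext <;> simp <;> ring

lemma continuous_cas (m : Freq) : Continuous (cas m) :=
  (Complex.continuous_re.comp (mFourier m).continuous).add
    (Complex.continuous_im.comp (mFourier m).continuous)

/-- The Hartley function `cos(2 π m · x) + sin(2 π m · x)` as a real test function. -/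
def casTest (m : Freq) : RealTestFunction :=
  ⟨casCoeff • char m + casCoeff' • char (-m), fun x => by
    change (casFun m x).im = 0
    rw [casFun_eq_cas, Complex.ofReal_im]⟩

lemma casTest_apply (m : Freq) (x : T2) : ((casTest m).1 : C(T2, ℂ)) x = casFun m x := rfl

lemma apply_casTest (u : Distr) (m : Freq) : (u : TestFunction →ₗ[ℂ] ℂ) (casTest m).1 =
    casCoeff * (u : TestFunction →ₗ[ℂ] ℂ) (char m) +
      casCoeff' * (u : TestFunction →ₗ[ℂ] ℂ) (char (-m)) := by
  change (u : TestFunction →ₗ[ℂ] ℂ) (casCoeff • char m + casCoeff' • char (-m)) = _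
  rw [map_add, map_smul, map_smul, smul_eq_mul, smul_eq_mul]

lemma mem_freqBall {n : ℕ} {m : Freq} : m ∈ freqBall n ↔
    (∀ i, -(n : ℤ) ≤ m i ∧ m i ≤ n) ∧ freqSq m ≤ (n : ℤ) ^ 2 := by
  rw [freqBall, Finset.mem_filter, Fintype.mem_piFinset]
  simp only [Finset.mem_Icc]

lemma freqBall_neg {n : ℕ} {m : Freq} (hm : m ∈ freqBall n) : -m ∈ freqBall n := by
  rw [mem_freqBall] at hm ⊢
  refine ⟨fun i => ⟨?_, ?_⟩, by simpa [freqSq] using hm.2⟩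
  · simpa using (hm.1 i).2
  · simpa [neg_le] using (hm.1 i).1

lemma truncate_eq_sum_cas (n : ℕ) (u : Distr) (x : T2) :
    truncate n u x = ∑ m ∈ freqBall n, (u : TestFunction →ₗ[ℂ] ℂ) (casTest m).1 * cas m x := by
  have h := sum_cas (fun m hm => freqBall_neg (n := n) hm) (w := fun _ => 1) (fun _ => rfl)
    (fun m => (u : TestFunction →ₗ[ℂ] ℂ) (char m)) (fun m => mFourier m x)
  simp only [one_mul] at h
  simp only [apply_casTest, ← casFun_eq_cas, casFun_apply]
  rw [h]
  simp [truncate, fourierCoeff]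

/-! ## The covariance of the Gaussian free field in the Hartley basis -/

lemma coef_greenFunction (m : Freq) : coef greenFunction m = ((1 / (2 * eigen m) : ℝ) : ℂ) := by
  rw [coef_eq_mFourierCoeff, ← mFourierBasis_repr, greenFunction,
    LinearIsometryEquiv.apply_symm_apply]

lemma integrable_greenFunction : Integrable greenFunction torusMeasure :=
  (Lp.memLp greenFunction).integrable one_le_two

lemma integrable_greenFunction_mul (f : C(T2, ℂ)) :
    Integrable (fun x => greenFunction x * f x) torusMeasure :=
  integrable_greenFunction.mul_bdd (c := ‖f‖) f.continuous.aestronglyMeasurable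
    (.of_forall fun x => f.norm_coe_le_norm x)

instance : (AddCircle.haarAddCircle (T := 1)).IsNegInvariant :=
  Measure.IsAddHaarMeasure.isNegInvariant_of_regular _

/-- The operator is a convolution, and its eigenvalues at m and -m agree, so the Hartley functions
are eigenfunctions. -/
lemma integral_greenKernel_casFun (l : Freq) (x : T2) :
    ∫ y, greenKernel x y * casFun l y ∂torusMeasure =
      ((1 / (2 * eigen l) : ℝ) : ℂ) * casFun l x := by
  have h1 : ∫ y, greenKernel x y * casFun l y ∂torusMeasure =
      ∫ w, greenFunction w * casFun l (x - w) ∂torusMeasure := by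
    rw [← integral_sub_left_eq_self (fun w => greenFunction w * casFun l (x - w)) torusMeasure x]
    simp [greenKernel]
  have h2 : ∀ w, greenFunction w * casFun l (x - w) =
      casCoeff * mFourier l x * (greenFunction w * mFourier (-l) w) +
      casCoeff' * mFourier (-l) x * (greenFunction w * mFourier (-(-l)) w) := by
    intro w
    rw [casFun_apply, sub_eq_add_neg, mFourier_add_apply, mFourier_add_apply, mFourier_neg_apply,
      mFourier_neg_apply]
    ring
  rw [h1]
  simp only [h2]
  rw [integral_add ((integrable_greenFunction_mul _).const_mul _)
    ((integrable_greenFunction_mul _).const_mul _), integral_const_mul, integral_const_mul,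
    show ∫ w, greenFunction w * mFourier (-l) w ∂torusMeasure = _ from coef_greenFunction l,
    show ∫ w, greenFunction w * mFourier (-(-l)) w ∂torusMeasure = _ from coef_greenFunction (-l),
    eigen_neg, casFun_apply]
  ring

lemma integral_casFun_mul (m l : Freq) :
    ∫ x, casFun m x * casFun l x ∂torusMeasure = if m = l then 1 else 0 := by
  have h0 : ∫ x, casFun m x * casFun l x ∂torusMeasure = coef (casFun m * casFun l : C(T2, ℂ)) 0 := by
    simp [coef, mFourier_zero]
  have h1 : casFun m * casFun l = (casCoeff * casCoeff) • mFourier (m + l) +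
      (casCoeff * casCoeff') • mFourier (m + -l) + ((casCoeff * casCoeff') • mFourier (-m + l) +
      (casCoeff' * casCoeff') • mFourier (-m + -l)) := by
    ext x
    simp only [ContinuousMap.mul_apply, casFun_apply, ContinuousMap.add_apply,
      ContinuousMap.smul_apply, smul_eq_mul, mFourier_add]
    ring
  rw [h0, h1, coef_add, coef_add, coef_add, coef_smul, coef_smul, coef_smul, coef_smul,
    coef_mFourier, coef_mFourier, coef_mFourier, coef_mFourier, casCoeff_sq, casCoeff'_sq,
    casCoeff_mul]
  have e1 : (-m + -l = 0) ↔ (m + l = 0) := by rw [← neg_add, neg_eq_zero]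
  have e2 : (m + -l = 0) ↔ (m = l) := by rw [← sub_eq_add_neg, sub_eq_zero]
  have e3 : (-m + l = 0) ↔ (m = l) := by rw [neg_add_eq_zero]
  simp only [e1, e2, e3]
  split_ifs <;> ring

lemma green_covariance (m l : Freq) :
    ∫ x, ∫ y, greenKernel x y * ((casTest m).1 : C(T2, ℂ)) x * ((casTest l).1 : C(T2, ℂ)) y
      ∂torusMeasure ∂torusMeasure = if m = l then ((1 / (2 * eigen l) : ℝ) : ℂ) else 0 := by
  have h1 : ∀ x, ∫ y, greenKernel x y * ((casTest m).1 : C(T2, ℂ)) x *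
      ((casTest l).1 : C(T2, ℂ)) y ∂torusMeasure =
      ((1 / (2 * eigen l) : ℝ) : ℂ) * (casFun m x * casFun l x) := by
    intro x
    simp only [casTest_apply]
    rw [show (fun y => greenKernel x y * casFun m x * casFun l y) =
      fun y => casFun m x * (greenKernel x y * casFun l y) from by funext y; ring,
      integral_const_mul, integral_greenKernel_casFun]
    ring
  simp only [h1]
  rw [integral_const_mul, integral_casFun_mul]
  split_ifs <;> simp

/-! ## The Gaussian free field as a random Hartley series -/

/-- The variance `1 / (2 (1 + 4 π² |m|²))` of the Hartley coefficients. -/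
def greenVar (m : Freq) : NNReal := ⟨1 / (2 * eigen m), by have := eigen_pos m; positivity⟩

/-- The real random variables `ξ_m`, `m ∈ ℤ²`, are independent and centered Gaussian with
variances `1 / (2 (1 + 4 π² |m|²))`. -/
structure IsGaussianCoeffs {Ω : Type*} [MeasurableSpace Ω] (P : Measure Ω) (ξ : Freq → Ω → ℝ) :
    Prop where
  measurable : ∀ m, Measurable (ξ m)
  indep : iIndepFun ξ P
  law : ∀ m, P.map (ξ m) = gaussianReal 0 (greenVar m)

/-- The Hartley functions are orthonormal eigenfunctions of the covariance, so the corresponding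
coefficients are uncorrelated, and jointly Gaussian, hence independent. -/
lemma exists_gaussianCoeffs {Ω : Type*} [MeasurableSpace Ω] {P : Measure Ω} [IsProbabilityMeasure P]
    {X : Ω → Distr} (hX : IsMassiveGFF X P) : ∃ ξ : Freq → Ω → ℝ, IsGaussianCoeffs P ξ ∧
      ∀ᵐ ω ∂P, ∀ n x, truncate n (X ω) x = ((∑ m ∈ freqBall n, ξ m ω * cas m x : ℝ) : ℂ) := by
  set η : Freq → Ω → ℝ := fun m ω => ((X ω : TestFunction →ₗ[ℂ] ℂ) (casTest m).1).re with hη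
  have hproc : IsGaussianProcess η P := hX.gaussian.comp_right casTest
  have hmean : ∀ m, ∫ ω, η m ω ∂P = 0 := fun m => hX.centered (casTest m)
  have hcov2 : ∀ m l, ∫ ω, η m ω * η l ω ∂P = if m = l then 1 / (2 * eigen l) else 0 := by
    intro m l
    have h := hX.covariance (casTest m) (casTest l)
    rw [green_covariance] at h
    have h' : ((∫ ω, η m ω * η l ω ∂P : ℝ) : ℂ) =
        ((if m = l then 1 / (2 * eigen l) else 0 : ℝ) : ℂ) := by
      refine h.trans ?_
      split_ifs <;> simp
    exact_mod_cast h'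
  have hL2 : ∀ m, MemLp (η m) 2 P := fun m => (hproc.hasGaussianLaw_eval m).memLp_two
  have hcov : ∀ m l, cov[η m, η l; P] = if m = l then 1 / (2 * eigen l) else 0 := by
    intro m l
    rw [covariance_eq_sub (hL2 m) (hL2 l), hmean, hmean, mul_zero, sub_zero]
    exact hcov2 m l
  have hind : iIndepFun η P := by
    -- The criterion concerns families of processes; each coefficient is regarded as a process
    -- indexed by a point.
    have h := IsGaussianProcess.iIndepFun_of_covariance_eq_zero (T := Freq) (S := fun _ => Unit)
      (X := fun m _ => η m) (P := P) (hproc.comp_right (fun p : (_ : Freq) × Unit => p.1))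
      (fun m _ => hproc.aemeasurable m)
      (fun m l hml _ _ => by rw [hcov, if_neg hml])
    exact h.comp (fun _ f => f ()) fun _ => measurable_pi_apply ()
  have hlaw : ∀ m, P.map (η m) = gaussianReal 0 (greenVar m) := by
    intro m
    rw [(hproc.hasGaussianLaw_eval m).map_eq_gaussianReal, hmean,
      ← covariance_self (hproc.aemeasurable m), hcov, if_pos rfl]
    congr 1
    exact Real.toNNReal_of_nonneg _
  have hae : ∀ m, η m =ᵐ[P] (hproc.aemeasurable m).mk (η m) := fun m =>
    (hproc.aemeasurable m).ae_eq_mk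
  -- The coefficients are only almost everywhere measurable, so measurable versions are used.
  refine ⟨fun m => (hproc.aemeasurable m).mk (η m),
    ⟨fun m => (hproc.aemeasurable m).measurable_mk, hind.congr hae, fun m => ?_⟩, ?_⟩
  · rw [← Measure.map_congr (hae m), hlaw]
  · filter_upwards [ae_all_iff.2 hae, ae_all_iff.2 fun m => hX.isReal (casTest m)] with ω h1 h2 n x
    rw [truncate_eq_sum_cas]
    push_cast
    refine Finset.sum_congr rfl fun m _ => ?_
    rw [← h1 m]
    congr 1
    apply Complex.ext
    · simp [hη]
    · simpa using h2 m

/-! ## The truncated chaos as a function of the Hartley coefficients -/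

/-- The function `exp(γ ∑_{m ∈ F} z_m cas_m - (γ² / 2) ∑_{m ∈ F} Var(ξ_m))`. -/
def chaosReal (γ : ℝ) (F : Finset Freq) (z : Freq → ℝ) (x : T2) : ℝ :=
  Real.exp (γ * ∑ m ∈ F, z m * cas m x - γ ^ 2 / 2 * ∑ m ∈ F, (greenVar m : ℝ))

/-- The truncated chaos as a continuous function on the torus. -/
def chaosTrunc (γ : ℝ) (F : Finset Freq) (z : Freq → ℝ) : C(T2, ℂ) :=
  expC (∑ m ∈ F, ((γ * z m : ℝ) : ℂ) • casFun m -
    ((γ ^ 2 / 2 * ∑ m ∈ F, (greenVar m : ℝ) : ℝ) : ℂ) • 1)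

lemma chaosTrunc_apply (γ : ℝ) (F : Finset Freq) (z : Freq → ℝ) (x : T2) :
    chaosTrunc γ F z x = (chaosReal γ F z x : ℂ) := by
  rw [chaosTrunc, chaosReal, expC_apply, Complex.ofReal_exp]
  congr 1
  simp only [ContinuousMap.sub_apply, ContinuousMap.coe_sum, Finset.sum_apply,
    ContinuousMap.smul_apply, ContinuousMap.one_apply, smul_eq_mul, mul_one, casFun_eq_cas]
  push_cast
  simp only [Finset.mul_sum, mul_assoc]

lemma chaosTrunc_empty (γ : ℝ) (z : Freq → ℝ) : chaosTrunc γ ∅ z = 1 := by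
  ext x
  simp [chaosTrunc_apply, chaosReal]

lemma chaosReal_pos (γ : ℝ) (F : Finset Freq) (z : Freq → ℝ) (x : T2) : 0 < chaosReal γ F z x :=
  Real.exp_pos _

lemma continuous_chaosReal (γ : ℝ) (F : Finset Freq) :
    Continuous fun p : (Freq → ℝ) × T2 => chaosReal γ F p.1 p.2 := by
  have := continuous_cas
  unfold chaosReal
  fun_prop

lemma continuous_chaosTrunc (γ : ℝ) (F : Finset Freq) : Continuous (chaosTrunc γ F) := by
  refine continuous_expC.comp ((continuous_finsetSum _ fun m _ => ?_).sub continuous_const)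
  have : Continuous fun z : Freq → ℝ => ((γ * z m : ℝ) : ℂ) := by fun_prop
  exact this.smul continuous_const

section Moments

variable {Ω : Type*} [MeasurableSpace Ω] {P : Measure Ω} {ξ : Freq → Ω → ℝ}

lemma IsGaussianCoeffs.isProbabilityMeasure (hξ : IsGaussianCoeffs P ξ) : IsProbabilityMeasure P :=
  hξ.indep.isProbabilityMeasure

lemma IsGaussianCoeffs.measurable_pi (hξ : IsGaussianCoeffs P ξ) :
    Measurable fun ω m => ξ m ω :=
  measurable_pi_lambda _ hξ.measurable

lemma IsGaussianCoeffs.stronglyMeasurable_chaosTrunc (hξ : IsGaussianCoeffs P ξ) (γ : ℝ)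
    (F : Finset Freq) : StronglyMeasurable fun ω => chaosTrunc γ F fun m => ξ m ω :=
  (continuous_chaosTrunc γ F).stronglyMeasurable.comp_measurable hξ.measurable_pi

lemma IsGaussianCoeffs.integral_exp_sum (hξ : IsGaussianCoeffs P ξ) (F : Finset Freq)
    (b : Freq → ℝ) : Integrable (fun ω => Real.exp (∑ m ∈ F, b m * ξ m ω)) P ∧
    ∫ ω, Real.exp (∑ m ∈ F, b m * ξ m ω) ∂P = Real.exp (∑ m ∈ F, greenVar m * b m ^ 2 / 2) := by
  have := hξ.isProbabilityMeasure
  have hind : iIndepFun (fun m ω => b m * ξ m ω) P :=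
    hξ.indep.comp (fun m y => b m * y) fun m => measurable_const_mul _
  have hmeas : ∀ m, Measurable fun ω => b m * ξ m ω := fun m => (hξ.measurable m).const_mul _
  have hmgf : ∀ m, mgf (fun ω => b m * ξ m ω) P 1 = Real.exp (greenVar m * b m ^ 2 / 2) := by
    intro m
    have := mgf_gaussianReal (hξ.law m) (b m)
    simp only [zero_mul, zero_add] at this
    rw [← this]
    simp [mgf]
  have hintg : ∀ m ∈ F, Integrable (fun ω => Real.exp (1 * (b m * ξ m ω))) P := by
    intro m _
    refine Integrable.of_integral_ne_zero ?_
    rw [show ∫ ω, Real.exp (1 * (b m * ξ m ω)) ∂P = _ from hmgf m]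
    exact (Real.exp_pos _).ne'
  have h1 := hind.integrable_exp_mul_sum hmeas hintg
  have h2 := hind.mgf_sum (t := 1) hmeas F
  simp only [mgf, Finset.sum_apply, one_mul] at h1 h2 hmgf
  refine ⟨h1, h2.trans ?_⟩
  rw [Finset.prod_congr rfl fun m _ => hmgf m, Real.exp_sum]

/-- Stationarity of the truncated field: over a symmetric set of frequencies its covariance depends
on x - y only. -/
lemma greenPoly_sub_apply {F : Finset Freq} (hF : ∀ m ∈ F, -m ∈ F) (x y : T2) :
    ((∑ m ∈ F, (greenVar m : ℝ) * (cas m x * cas m y) : ℝ) : ℂ) = greenPoly F (x - y) := by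
  have hw : ∀ m, ((greenVar (-m) : ℝ) : ℂ) = ((greenVar m : ℝ) : ℂ) := fun m => by
    simp only [greenVar, eigen_neg]
  have h := sum_cas (w := fun m => ((greenVar m : ℝ) : ℂ)) hF hw (fun m => mFourier m y) (fun m => mFourier m x)
  simp only [← casFun_apply, casFun_eq_cas] at h
  push_cast
  calc _ = ∑ m ∈ F, ((greenVar m : ℝ) : ℂ) * (cas m y * cas m x) :=
        Finset.sum_congr rfl fun m _ => by ring
    _ = _ := h
    _ = _ := by
        simp only [greenPoly, ContinuousMap.coe_sum, Finset.sum_apply, ContinuousMap.smul_apply,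
          smul_eq_mul]
        refine Finset.sum_congr rfl fun m _ => ?_
        rw [sub_eq_add_neg, mFourier_add_apply, mFourier_neg_apply, mul_comm (mFourier (-m) y)]
        rfl

lemma sum_greenVar_mul_cas_sq {F : Finset Freq} (hF : ∀ m ∈ F, -m ∈ F) (x : T2) :
    ∑ m ∈ F, (greenVar m : ℝ) * (cas m x * cas m x) = ∑ m ∈ F, (greenVar m : ℝ) := by
  have h := greenPoly_sub_apply hF x x
  have h2 : greenPoly F (x - x) = ((∑ m ∈ F, (greenVar m : ℝ) : ℝ) : ℂ) := by
    simp only [greenPoly, sub_self, ContinuousMap.coe_sum, Finset.sum_apply,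
      ContinuousMap.smul_apply, smul_eq_mul, Complex.ofReal_sum]
    refine Finset.sum_congr rfl fun m _ => ?_
    rw [show mFourier m (0 : T2) = 1 by simp [mFourier], mul_one]
    rfl
  rw [h2] at h
  exact_mod_cast h

/-- In the Gaussian exponential moment the two variances cancel the normalizations; what remains is
the covariance of the two truncations, carried by the common frequencies. -/
lemma IsGaussianCoeffs.integral_chaosReal_mul (hξ : IsGaussianCoeffs P ξ) (γ : ℝ)
    {F F' : Finset Freq} (hF : ∀ m ∈ F, -m ∈ F) (hF' : ∀ m ∈ F', -m ∈ F') (x y : T2) :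
    Integrable (fun ω => chaosReal γ F (fun m => ξ m ω) x * chaosReal γ F' (fun m => ξ m ω) y) P ∧
    ∫ ω, chaosReal γ F (fun m => ξ m ω) x * chaosReal γ F' (fun m => ξ m ω) y ∂P =
      Real.exp (γ ^ 2 * ∑ m ∈ F ∩ F', (greenVar m : ℝ) * (cas m x * cas m y)) := by
  classical
  set b : Freq → ℝ := fun m => γ * ((if m ∈ F then cas m x else 0) + if m ∈ F' then cas m y else 0)
    with hb
  set R := γ ^ 2 / 2 * ∑ m ∈ F, (greenVar m : ℝ) + γ ^ 2 / 2 * ∑ m ∈ F', (greenVar m : ℝ) with hR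
  obtain ⟨hi, hv⟩ := hξ.integral_exp_sum (F ∪ F') b
  have e1 : ∀ f : Freq → ℝ, ∑ m ∈ F ∪ F', (if m ∈ F then f m else 0) = ∑ m ∈ F, f m := fun f => by
    rw [← Finset.sum_filter]
    congr 1
    ext m
    simp only [Finset.mem_filter, Finset.mem_union]
    tauto
  have e2 : ∀ f : Freq → ℝ, ∑ m ∈ F ∪ F', (if m ∈ F' then f m else 0) = ∑ m ∈ F', f m := fun f => by
    rw [← Finset.sum_filter]
    congr 1
    ext m
    simp only [Finset.mem_filter, Finset.mem_union]
    tauto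
  have e3 : ∀ f : Freq → ℝ, ∑ m ∈ F ∪ F', (if m ∈ F ∩ F' then f m else 0) = ∑ m ∈ F ∩ F', f m :=
    fun f => by
    rw [← Finset.sum_filter]
    congr 1
    ext m
    simp only [Finset.mem_filter, Finset.mem_union, Finset.mem_inter]
    tauto
  have hprod : ∀ ω, chaosReal γ F (fun m => ξ m ω) x * chaosReal γ F' (fun m => ξ m ω) y =
      Real.exp (∑ m ∈ F ∪ F', b m * ξ m ω) * Real.exp (-R) := by
    intro ω
    rw [chaosReal, chaosReal, ← Real.exp_add, ← Real.exp_add]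
    congr 1
    have : ∑ m ∈ F ∪ F', b m * ξ m ω =
        γ * ∑ m ∈ F, ξ m ω * cas m x + γ * ∑ m ∈ F', ξ m ω * cas m y := by
      rw [← e1, ← e2, ← mul_add, ← Finset.sum_add_distrib, Finset.mul_sum]
      refine Finset.sum_congr rfl fun m _ => ?_
      simp only [hb]
      split_ifs <;> ring
    rw [this, hR]
    ring
  simp only [hprod]
  refine ⟨hi.mul_const _, ?_⟩
  rw [integral_mul_const, hv, ← Real.exp_add]
  congr 1
  have : ∑ m ∈ F ∪ F', (greenVar m : ℝ) * b m ^ 2 / 2 =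
      γ ^ 2 / 2 * ∑ m ∈ F, (greenVar m : ℝ) * (cas m x * cas m x) +
      γ ^ 2 / 2 * ∑ m ∈ F', (greenVar m : ℝ) * (cas m y * cas m y) +
      γ ^ 2 * ∑ m ∈ F ∩ F', (greenVar m : ℝ) * (cas m x * cas m y) := by
    rw [← e1, ← e2, ← e3, Finset.mul_sum, Finset.mul_sum, Finset.mul_sum,
      ← Finset.sum_add_distrib, ← Finset.sum_add_distrib]
    refine Finset.sum_congr rfl fun m _ => ?_
    simp only [hb, Finset.mem_inter]
    by_cases h1 : m ∈ F <;> by_cases h2 : m ∈ F' <;> simp only [h1, h2, if_true, if_false,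
      and_self, and_true, and_false] <;> ring
  rw [this, sum_greenVar_mul_cas_sq hF, sum_greenVar_mul_cas_sq hF', hR]
  ring

/-! ## Second moments of the Fourier coefficients -/

lemma integral_convolution_mFourier (H : C(T2, ℂ)) (m : Freq) :
    ∫ p : T2 × T2, H (p.1 - p.2) * (mFourier (-m) p.1 * mFourier m p.2)
      ∂(torusMeasure.prod torusMeasure) = coef H m := by
  have hc : Continuous fun p : T2 × T2 => H (p.1 - p.2) * (mFourier (-m) p.1 * mFourier m p.2) := by
    fun_prop
  rw [integral_prod_symm _ (hc.integrable_of_hasCompactSupport (HasCompactSupport.of_compactSpace _))]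
  have h1 : ∀ y : T2, ∫ x, H (x - y) * (mFourier (-m) x * mFourier m y) ∂torusMeasure =
      coef H m := by
    intro y
    have h2 : ∀ x, H (x - y) * (mFourier (-m) x * mFourier m y) =
        (fun w => H w * mFourier (-m) w) (x - y) := by
      intro x
      simp only
      rw [sub_eq_add_neg x y, mFourier_add_apply, mFourier_neg_apply, neg_neg]
    simp only [h2]
    exact integral_sub_right_eq_self (fun w => H w * mFourier (-m) w) y
  simp only [h1]
  simp

/-- Fubini reduces the product of coefficients to the two-point function, which depends on x - y
only; integrating it against the characters gives a Fourier coefficient. -/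
lemma IsGaussianCoeffs.integral_coef_mul (hξ : IsGaussianCoeffs P ξ) (γ : ℝ)
    {F F' : Finset Freq} (hF : ∀ m ∈ F, -m ∈ F) (hF' : ∀ m ∈ F', -m ∈ F') (m : Freq) :
    Integrable (fun ω => coef (chaosTrunc γ F fun m => ξ m ω) m *
      coef (chaosTrunc γ F' fun m => ξ m ω) (-m)) P ∧
    ∫ ω, coef (chaosTrunc γ F fun m => ξ m ω) m * coef (chaosTrunc γ F' fun m => ξ m ω) (-m) ∂P =
      coef (expC (((γ ^ 2 : ℝ) : ℂ) • greenPoly (F ∩ F'))) m := by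
  classical
  have := hξ.isProbabilityMeasure
  have hFF : ∀ m ∈ F ∩ F', -m ∈ F ∩ F' := fun m hm => by
    rw [Finset.mem_inter] at hm ⊢
    exact ⟨hF m hm.1, hF' m hm.2⟩
  set ν := (torusMeasure.prod torusMeasure : Measure (T2 × T2)) with hν
  set f : Ω → T2 × T2 → ℂ := fun ω p =>
    ((chaosReal γ F (fun m => ξ m ω) p.1 * chaosReal γ F' (fun m => ξ m ω) p.2 : ℝ) : ℂ) *
      (mFourier (-m) p.1 * mFourier m p.2) with hf
  set H := expC (((γ ^ 2 : ℝ) : ℂ) • greenPoly (F ∩ F')) with hH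
  have hprod : ∀ ω, coef (chaosTrunc γ F fun m => ξ m ω) m *
      coef (chaosTrunc γ F' fun m => ξ m ω) (-m) = ∫ p, f ω p ∂ν := by
    intro ω
    rw [coef, coef, hν, ← integral_prod_mul]
    refine integral_congr_ae (.of_forall fun p => ?_)
    simp only [hf, chaosTrunc_apply, neg_neg]
    push_cast
    ring
  have hval : ∀ p : T2 × T2, ∫ ω, f ω p ∂P = H (p.1 - p.2) * (mFourier (-m) p.1 * mFourier m p.2) := by
    intro p
    simp only [hf]
    rw [integral_mul_const, integral_complex_ofReal, (hξ.integral_chaosReal_mul γ hF hF' _ _).2]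
    congr 1
    rw [hH, expC_apply, ContinuousMap.smul_apply, ← greenPoly_sub_apply hFF, smul_eq_mul]
    push_cast
    rfl
  have hmeas : AEStronglyMeasurable (Function.uncurry f) (P.prod ν) := by
    have hc : Continuous fun q : (Freq → ℝ) × (T2 × T2) =>
        ((chaosReal γ F q.1 q.2.1 * chaosReal γ F' q.1 q.2.2 : ℝ) : ℂ) *
          (mFourier (-m) q.2.1 * mFourier m q.2.2) := by
      have h1 := (continuous_chaosReal γ F).comp
        (continuous_fst.prodMk (continuous_fst.comp continuous_snd) :
          Continuous fun q : (Freq → ℝ) × (T2 × T2) => (q.1, q.2.1))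
      have h2 := (continuous_chaosReal γ F').comp
        (continuous_fst.prodMk (continuous_snd.comp continuous_snd) :
          Continuous fun q : (Freq → ℝ) × (T2 × T2) => (q.1, q.2.2))
      exact (Complex.continuous_ofReal.comp (h1.mul h2)).mul (by fun_prop)
    have hm : Measurable fun q : Ω × (T2 × T2) => ((fun m => ξ m q.1, q.2) :
        (Freq → ℝ) × (T2 × T2)) :=
      (hξ.measurable_pi.comp measurable_fst).prodMk measurable_snd
    exact (hc.measurable.comp hm).aestronglyMeasurable
  have hintg : Integrable (Function.uncurry f) (P.prod ν) := by
    rw [integrable_prod_iff' hmeas]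
    have hn : ∀ (p : T2 × T2) ω, ‖f ω p‖ =
        chaosReal γ F (fun m => ξ m ω) p.1 * chaosReal γ F' (fun m => ξ m ω) p.2 := by
      intro p ω
      simp only [hf]
      rw [norm_mul, norm_mul, norm_mFourier_apply, norm_mFourier_apply, Complex.norm_real,
        Real.norm_of_nonneg (mul_nonneg (chaosReal_pos _ _ _ _).le (chaosReal_pos _ _ _ _).le)]
      ring
    have hi : ∀ p : T2 × T2, Integrable (fun ω => f ω p) P := fun p =>
      ((hξ.integral_chaosReal_mul γ hF hF' p.1 p.2).1.ofReal (𝕜 := ℂ)).mul_const _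
    refine ⟨.of_forall hi, ?_⟩
    simp only [Function.uncurry_apply_pair, hn, (hξ.integral_chaosReal_mul γ hF hF' _ _).2]
    have hc : Continuous fun p : T2 × T2 =>
        Real.exp (γ ^ 2 * ∑ m ∈ F ∩ F', (greenVar m : ℝ) * (cas m p.1 * cas m p.2)) := by
      have := continuous_cas
      fun_prop
    exact hc.integrable_of_hasCompactSupport (HasCompactSupport.of_compactSpace _)
  simp only [hprod]
  refine ⟨hintg.integral_prod_left, ?_⟩
  rw [integral_integral_swap hintg]
  simp only [hval]
  exact integral_convolution_mFourier H m

lemma chaosCoef_eq (γ : ℝ) (F : Finset Freq) (m : Freq) :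
    coef (expC (((γ ^ 2 : ℝ) : ℂ) • greenPoly F)) m = (chaosCoef γ F m : ℂ) := by
  have h := coef_nonneg (expC_mem_posCone (smul_greenPoly_mem_posCone (sq_nonneg γ) F)) m
  rw [chaosCoef]
  exact Complex.ext rfl (by rw [Complex.ofReal_im]; exact (Complex.le_def.1 h).2.symm)

lemma chaosCoef_nonneg (γ : ℝ) (F : Finset Freq) (m : Freq) : 0 ≤ chaosCoef γ F m :=
  (Complex.le_def.1
    (coef_nonneg (expC_mem_posCone (smul_greenPoly_mem_posCone (sq_nonneg γ) F)) m)).1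

lemma norm_sq_coef_of_real {D : C(T2, ℂ)} (hD : ∀ x, (D x).im = 0) (m : Freq) :
    ((‖coef D m‖ ^ 2 : ℝ) : ℂ) = coef D m * coef D (-m) := by
  have h : coef D (-m) = (starRingEnd ℂ) (coef D m) := by
    rw [coef, coef, ← integral_conj]
    refine integral_congr_ae (.of_forall fun x => ?_)
    simp only [map_mul, ← mFourier_neg, Complex.conj_eq_iff_im.2 (hD x)]
  rw [h, Complex.mul_conj, Complex.normSq_eq_norm_sq]

/-- Orthogonality of increments: for F ⊆ F' the cross moments equal the moment of the smaller
truncation, because F ∩ F' = F. -/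
lemma IsGaussianCoeffs.integral_norm_sq_coef_sub (hξ : IsGaussianCoeffs P ξ) (γ : ℝ)
    {F F' : Finset Freq} (hF : ∀ m ∈ F, -m ∈ F) (hF' : ∀ m ∈ F', -m ∈ F') (hFF : F ⊆ F')
    (m : Freq) :
    Integrable (fun ω => ‖coef (chaosTrunc γ F' (fun m => ξ m ω) -
      chaosTrunc γ F (fun m => ξ m ω) : C(T2, ℂ)) m‖ ^ 2) P ∧
    ∫ ω, ‖coef (chaosTrunc γ F' (fun m => ξ m ω) -
      chaosTrunc γ F (fun m => ξ m ω) : C(T2, ℂ)) m‖ ^ 2 ∂P =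
      chaosCoef γ F' m - chaosCoef γ F m := by
  obtain ⟨i1, v1⟩ := hξ.integral_coef_mul γ hF' hF' m
  obtain ⟨i2, v2⟩ := hξ.integral_coef_mul γ hF' hF m
  obtain ⟨i3, v3⟩ := hξ.integral_coef_mul γ hF hF' m
  obtain ⟨i4, v4⟩ := hξ.integral_coef_mul γ hF hF m
  rw [Finset.inter_self, chaosCoef_eq] at v1 v4
  rw [Finset.inter_eq_right.2 hFF, chaosCoef_eq] at v2
  rw [Finset.inter_eq_left.2 hFF, chaosCoef_eq] at v3
  have hexp : ∀ ω, ((‖coef (chaosTrunc γ F' (fun m => ξ m ω) -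
      chaosTrunc γ F (fun m => ξ m ω) : C(T2, ℂ)) m‖ ^ 2 : ℝ) : ℂ) =
      (coef (chaosTrunc γ F' fun m => ξ m ω) m * coef (chaosTrunc γ F' fun m => ξ m ω) (-m) -
        coef (chaosTrunc γ F' fun m => ξ m ω) m * coef (chaosTrunc γ F fun m => ξ m ω) (-m)) -
      (coef (chaosTrunc γ F fun m => ξ m ω) m * coef (chaosTrunc γ F' fun m => ξ m ω) (-m) -
        coef (chaosTrunc γ F fun m => ξ m ω) m * coef (chaosTrunc γ F fun m => ξ m ω) (-m)) := by
    intro ω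
    rw [norm_sq_coef_of_real (fun x => by
      rw [ContinuousMap.sub_apply, chaosTrunc_apply, chaosTrunc_apply, ← Complex.ofReal_sub,
        Complex.ofReal_im]), coef_sub, coef_sub]
    ring
  have hi : Integrable (fun ω => ((‖coef (chaosTrunc γ F' (fun m => ξ m ω) -
      chaosTrunc γ F (fun m => ξ m ω) : C(T2, ℂ)) m‖ ^ 2 : ℝ) : ℂ)) P := by
    simp only [hexp]
    exact (i1.sub i2).sub (i3.sub i4)
  refine ⟨hi.re.congr (.of_forall fun ω => Complex.ofReal_re _), ?_⟩
  have : ((∫ ω, ‖coef (chaosTrunc γ F' (fun m => ξ m ω) -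
      chaosTrunc γ F (fun m => ξ m ω) : C(T2, ℂ)) m‖ ^ 2 ∂P : ℝ) : ℂ) =
      ((chaosCoef γ F' m - chaosCoef γ F m : ℝ) : ℂ) := by
    rw [← integral_complex_ofReal]
    simp only [hexp]
    refine (integral_sub (i1.sub i2) (i3.sub i4)).trans ?_
    refine (congrArg₂ (· - ·) (integral_sub i1 i2) (integral_sub i3 i4)).trans ?_
    rw [v1, v2, v3, v4]
    push_cast
    ring
  exact_mod_cast this

end Moments

/-! ## The second moment of the chaos in Sobolev norm -/

/-- The second moment `∑_m (1 + 4 π² |m|²)^s 𝔼|Ŵ_F(m)|²` of the truncated chaos in `H^s`. -/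
def chaosMass (γ s : ℝ) (F : Finset Freq) : ℝ := ∑' m, eigen m ^ s * chaosCoef γ F m

section ChaosMass

variable {γ s K : ℝ}

lemma summable_chaosCoef
    (hK : ∀ F B : Finset Freq, ∑ m ∈ B, eigen m ^ s * chaosCoef γ F m ≤ K)
    (F : Finset Freq) : Summable fun m => eigen m ^ s * chaosCoef γ F m :=
  summable_of_sum_le (fun m => mul_nonneg (Real.rpow_nonneg (eigen_pos m).le _)
    (chaosCoef_nonneg γ F m)) (hK F)

lemma chaosMass_le
    (hK : ∀ F B : Finset Freq, ∑ m ∈ B, eigen m ^ s * chaosCoef γ F m ≤ K)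
    (F : Finset Freq) : chaosMass γ s F ≤ K :=
  (summable_chaosCoef hK F).tsum_le_of_sum_le (hK F)

end ChaosMass

/-! ### Monotonicity of the mass and distances in L²(P; H^s) -/

lemma greenPoly_sdiff_add {F F' : Finset Freq} (h : F ⊆ F') :
    greenPoly (F' \ F) + greenPoly F = greenPoly F' := Finset.sum_sdiff h

lemma smul_greenPoly_add {c : ℂ} {F F' : Finset Freq} (h : F ⊆ F') :
    c • greenPoly F + c • greenPoly (F' \ F) = c • greenPoly F' := by
  rw [← greenPoly_sdiff_add h, add_comm (greenPoly (F' \ F))]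
  exact (smul_add c (greenPoly F) (greenPoly (F' \ F))).symm

/-- The left side is the second moment of a coefficient of W_{F' \ F} - 1: the block F' \ F is no
farther from 1 than W_{F'} is from W_F. -/
lemma chaosCoef_sdiff_sub_le (γ : ℝ) {F F' : Finset Freq} (h : F ⊆ F') (m : Freq) :
    chaosCoef γ (F' \ F) m - chaosCoef γ ∅ m ≤ chaosCoef γ F' m - chaosCoef γ F m := by
  have hp := fun F => smul_greenPoly_mem_posCone (sq_nonneg γ) F
  have h1 := coef_expC_sub_one_le (hp F) (hp (F' \ F)) m
  rw [smul_greenPoly_add h] at h1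
  have h0 : expC (((γ ^ 2 : ℝ) : ℂ) • greenPoly ∅) = 1 := by
    simp [greenPoly, expC_zero]
  rw [← h0, coef_sub, coef_sub, chaosCoef_eq, chaosCoef_eq, chaosCoef_eq, chaosCoef_eq] at h1
  exact_mod_cast h1

lemma chaosCoef_mono (γ : ℝ) {F F' : Finset Freq} (h : F ⊆ F') (m : Freq) :
    chaosCoef γ F m ≤ chaosCoef γ F' m := by
  have hp := fun F => smul_greenPoly_mem_posCone (sq_nonneg γ) F
  have h1 := coef_expC_mono (hp F) (g := ((γ ^ 2 : ℝ) : ℂ) • greenPoly F')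
    (by rw [← smul_greenPoly_add h, add_sub_cancel_left]; exact hp _) m
  rw [chaosCoef_eq, chaosCoef_eq] at h1
  exact_mod_cast h1

section ChaosMass

variable {γ s K : ℝ}

lemma chaosMass_mono
    (hK : ∀ F B : Finset Freq, ∑ m ∈ B, eigen m ^ s * chaosCoef γ F m ≤ K)
    {F F' : Finset Freq} (h : F ⊆ F') : chaosMass γ s F ≤ chaosMass γ s F' :=
  (summable_chaosCoef hK F).tsum_le_tsum (fun m => mul_le_mul_of_nonneg_left
    (chaosCoef_mono γ h m) (Real.rpow_nonneg (eigen_pos m).le _)) (summable_chaosCoef hK F')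

lemma hasSum_chaosMass_sub
    (hK : ∀ F B : Finset Freq, ∑ m ∈ B, eigen m ^ s * chaosCoef γ F m ≤ K)
    (F F' : Finset Freq) :
    HasSum (fun m => eigen m ^ s * (chaosCoef γ F' m - chaosCoef γ F m))
      (chaosMass γ s F' - chaosMass γ s F) := by
  simp only [mul_sub]
  exact (summable_chaosCoef hK F').hasSum.sub (summable_chaosCoef hK F).hasSum

lemma chaosMass_sdiff_sub_le
    (hK : ∀ F B : Finset Freq, ∑ m ∈ B, eigen m ^ s * chaosCoef γ F m ≤ K)
    {F F' : Finset Freq} (h : F ⊆ F') :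
    chaosMass γ s (F' \ F) - chaosMass γ s ∅ ≤ chaosMass γ s F' - chaosMass γ s F :=
  hasSum_le (fun m => mul_le_mul_of_nonneg_left (chaosCoef_sdiff_sub_le γ h m)
    (Real.rpow_nonneg (eigen_pos m).le _)) (hasSum_chaosMass_sub hK _ _)
    (hasSum_chaosMass_sub hK _ _)

/-- Parseval in H^s and Tonelli reduce this to the orthogonality of increments at each frequency. -/
lemma IsGaussianCoeffs.eLpNorm_sub_sq
    (hK : ∀ F B : Finset Freq, ∑ m ∈ B, eigen m ^ s * chaosCoef γ F m ≤ K)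
    {Ω : Type*} [MeasurableSpace Ω] {P : Measure Ω}
    {ξ : Freq → Ω → ℝ} (hξ : IsGaussianCoeffs P ξ) (hs : s ≤ 0) {F F' : Finset Freq}
    (hF : ∀ m ∈ F, -m ∈ F) (hF' : ∀ m ∈ F', -m ∈ F') (hFF : F ⊆ F') :
    eLpNorm (fun ω => toSobolev hs (chaosTrunc γ F' (fun m => ξ m ω) -
      chaosTrunc γ F (fun m => ξ m ω))) 2 P ^ 2 =
      ENNReal.ofReal (chaosMass γ s F' - chaosMass γ s F) := by
  have h1 := eLpNorm_nnreal_pow_eq_lintegral (p := 2) (μ := P) (f := fun ω =>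
    toSobolev hs (chaosTrunc γ F' (fun m => ξ m ω) - chaosTrunc γ F (fun m => ξ m ω))) two_ne_zero
  have h2 : ∀ ω, ‖toSobolev hs (chaosTrunc γ F' (fun m => ξ m ω) -
      chaosTrunc γ F (fun m => ξ m ω))‖ₑ ^ 2 = ∑' m, ENNReal.ofReal (eigen m ^ s *
        ‖coef (chaosTrunc γ F' (fun m => ξ m ω) - chaosTrunc γ F (fun m => ξ m ω) : C(T2, ℂ)) m‖
          ^ 2) := by
    intro ω
    have h := hasSum_norm_toSobolev_sq hs
      (chaosTrunc γ F' (fun m => ξ m ω) - chaosTrunc γ F (fun m => ξ m ω))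
    rw [← ENNReal.ofReal_tsum_of_nonneg (fun m => mul_nonneg (Real.rpow_nonneg (eigen_pos m).le _)
      (sq_nonneg _)) h.summable, h.tsum_eq, ENNReal.ofReal_pow (norm_nonneg _), ofReal_norm]
  have h3 := fun m => hξ.integral_norm_sq_coef_sub γ hF hF' hFF m
  norm_num at h1
  rw [h1]
  simp only [h2]
  rw [lintegral_tsum fun m => ((h3 m).1.aestronglyMeasurable.aemeasurable.const_mul _).ennreal_ofReal]
  have h4 : ∀ m, ∫⁻ ω, ENNReal.ofReal (eigen m ^ s *
      ‖coef (chaosTrunc γ F' (fun m => ξ m ω) - chaosTrunc γ F (fun m => ξ m ω) : C(T2, ℂ)) m‖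
        ^ 2) ∂P = ENNReal.ofReal (eigen m ^ s * (chaosCoef γ F' m - chaosCoef γ F m)) := by
    intro m
    rw [← (h3 m).2, ← integral_const_mul, ofReal_integral_eq_lintegral_ofReal ((h3 m).1.const_mul _)]
    exact .of_forall fun ω => mul_nonneg (Real.rpow_nonneg (eigen_pos m).le _) (sq_nonneg _)
  simp only [h4]
  have h5 := hasSum_chaosMass_sub hK F F'
  rw [← ENNReal.ofReal_tsum_of_nonneg (fun m => mul_nonneg (Real.rpow_nonneg (eigen_pos m).le _)
    (sub_nonneg.2 (chaosCoef_mono γ hFF m))) h5.summable, h5.tsum_eq]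

lemma eLpNorm_toEll2 {Ω : Type*} [MeasurableSpace Ω] {P : Measure Ω} {s : ℝ} (W : Ω → Sobolev s) :
    eLpNorm (fun ω => Sobolev.toEll2 s (W ω)) 2 P = eLpNorm W 2 P :=
  eLpNorm_congr_enorm_ae (.of_forall fun _ => rfl)

lemma IsGaussianCoeffs.memLp_toSobolev
    (hK : ∀ F B : Finset Freq, ∑ m ∈ B, eigen m ^ s * chaosCoef γ F m ≤ K)
    {Ω : Type*} [MeasurableSpace Ω] {P : Measure Ω}
    {ξ : Freq → Ω → ℝ} (hξ : IsGaussianCoeffs P ξ) (hs : s ≤ 0) {F : Finset Freq}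
    (hF : ∀ m ∈ F, -m ∈ F) :
    MemLp (fun ω => toSobolev hs (chaosTrunc γ F fun m => ξ m ω)) 2 P := by
  have := hξ.isProbabilityMeasure
  refine ⟨((continuous_toSobolev hs).comp_stronglyMeasurable
    (hξ.stronglyMeasurable_chaosTrunc γ F)).aestronglyMeasurable, ?_⟩
  -- The empty truncation is the constant 1, so the distance formula already bounds W_F - 1.
  have h1 : MemLp (fun ω => Sobolev.toEll2 s
      (toSobolev hs (chaosTrunc γ F (fun m => ξ m ω) - 1))) 2 P := by
    refine ⟨(((isometry_toEll2 s).continuous.comp (continuous_toSobolev hs)).comp_stronglyMeasurable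
      ((hξ.stronglyMeasurable_chaosTrunc γ F).sub stronglyMeasurable_const)).aestronglyMeasurable,
      ?_⟩
    rw [eLpNorm_toEll2]
    have h := hξ.eLpNorm_sub_sq hK hs (F := ∅) (by simp) hF (Finset.empty_subset F)
    simp only [chaosTrunc_empty] at h
    refine lt_top_iff_ne_top.2 fun hc => ?_
    rw [hc, ENNReal.top_pow two_ne_zero] at h
    exact ENNReal.ofReal_ne_top h.symm
  have h2 : (fun ω => Sobolev.toEll2 s (toSobolev hs (chaosTrunc γ F fun m => ξ m ω))) =
      (fun ω => Sobolev.toEll2 s (toSobolev hs (chaosTrunc γ F (fun m => ξ m ω) - 1))) +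
        fun _ => Sobolev.toEll2 s (toSobolev hs 1) := by
    funext ω
    rw [Pi.add_apply, ← map_add, ← toSobolev_add, sub_add_cancel]
  rw [← eLpNorm_toEll2, h2]
  exact (h1.add (memLp_const _)).2

end ChaosMass

/-! ### Limits in L²(P; H^s) -/

lemma freqBall_mono {n k : ℕ} (h : n ≤ k) : freqBall n ⊆ freqBall k := by
  intro m hm
  rw [mem_freqBall] at hm ⊢
  have h' : (n : ℤ) ≤ k := by exact_mod_cast h
  exact ⟨fun i => ⟨by linarith [(hm.1 i).1], (hm.1 i).2.trans h'⟩,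
    hm.2.trans (by nlinarith)⟩

/-- `S` is only seminormed and not assumed complete: the Cauchy sequence is moved to L² with values
in the complete space `E`, and the limit is pulled back by the right inverse `R`, itself an
isometry. -/
lemma exists_limit_of_isometry {Ω S E : Type*} [MeasurableSpace Ω] {P : Measure Ω}
    [SeminormedAddCommGroup S] [NormedAddCommGroup E] [CompleteSpace E] {T : S →+ E} {R : E → S}
    (hT : ∀ u, ‖T u‖ = ‖u‖) (hTR : ∀ e, T (R e) = e) {W : ℕ → Ω → S}
    (hW : ∀ n, MemLp (W n) 2 P) {b : ℕ → ℝ} (hb : Tendsto b atTop (𝓝 0))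
    (h : ∀ N n, N ≤ n → eLpNorm (W n - W N) 2 P ≤ ENNReal.ofReal (b N)) :
    ∃ M : Ω → S, MemLp M 2 P ∧ Tendsto (fun n => eLpNorm (W n - M) 2 P) atTop (𝓝 0) := by
  have hTi : Isometry T := AddMonoidHomClass.isometry_of_norm T hT
  have hRi : Isometry R := fun a b => by rw [← hTi.edist_eq, hTR, hTR]
  have hn : ∀ U : Ω → S, eLpNorm (fun ω => T (U ω)) 2 P = eLpNorm U 2 P := fun U =>
    eLpNorm_congr_enorm_ae (.of_forall fun ω => by
      rw [← ofReal_norm, ← ofReal_norm, hT])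
  have hsub : ∀ U V : Ω → S, eLpNorm ((fun ω => T (U ω)) - fun ω => T (V ω)) 2 P =
      eLpNorm (U - V) 2 P := fun U V => by
    rw [← hn (U - V)]
    congr 1
    funext ω
    simp
  have hV : ∀ n, MemLp (fun ω => T (W n ω)) 2 P := fun n =>
    ⟨hTi.continuous.comp_aestronglyMeasurable (hW n).1, (hn (W n)).trans_lt (hW n).2⟩
  set f : ℕ → Lp E 2 P := fun n => (hV n).toLp with hf
  have hdist : ∀ N n, N ≤ n → dist (f N) (f n) ≤ max (b N) 0 := by
    intro N n hn
    rw [dist_comm, dist_eq_norm, hf, ← MemLp.toLp_sub, Lp.norm_toLp, hsub]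
    exact ENNReal.toReal_le_of_le_ofReal (le_max_right _ _)
      ((h N n hn).trans (ENNReal.ofReal_le_ofReal (le_max_left _ _)))
  have hb' : Tendsto (fun N => max (b N) 0) atTop (𝓝 0) := by
    simpa using hb.max (tendsto_const_nhds (x := (0 : ℝ)))
  obtain ⟨g, hg⟩ := cauchySeq_tendsto_of_complete (cauchySeq_of_le_tendsto_0' _ hdist hb')
  have hg2 : Tendsto (fun n => eLpNorm (⇑(f n) - ⇑g) 2 P) atTop (𝓝 0) :=
    (Lp.tendsto_Lp_iff_tendsto_eLpNorm' f g).1 hg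
  refine ⟨fun ω => R (g ω), ⟨hRi.continuous.comp_aestronglyMeasurable (Lp.memLp g).1, ?_⟩, ?_⟩
  · rw [← hn]
    simp only [hTR]
    exact (Lp.memLp g).2
  · refine hg2.congr fun n => ?_
    rw [← hsub]
    simp only [hTR]
    exact eLpNorm_congr_ae ((hV n).coeFn_toLp.sub (.refl _ _))

lemma exists_limit_sobolev {Ω : Type*} [MeasurableSpace Ω] {P : Measure Ω} {s : ℝ} (hs : -2 ≤ s)
    {W : ℕ → Ω → Sobolev s} (hW : ∀ n, MemLp (W n) 2 P) {b : ℕ → ℝ} (hb : Tendsto b atTop (𝓝 0))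
    (h : ∀ N n, N ≤ n → eLpNorm (W n - W N) 2 P ≤ ENNReal.ofReal (b N)) :
    ∃ M : Ω → Sobolev s, MemLp M 2 P ∧ Tendsto (fun n => eLpNorm (W n - M) 2 P) atTop (𝓝 0) :=
  exists_limit_of_isometry (T := (Sobolev.toEll2 s).toAddMonoidHom) (R := ofEll2 hs)
    norm_toEll2 (toEll2_ofEll2 hs) hW hb h

/-! ## The truncated Wick exponentials -/

section Wick

variable {Ω : Type*} [MeasurableSpace Ω] {P : Measure Ω} {ξ : Freq → Ω → ℝ} {X : Ω → Distr}

lemma cas_zero_right (m : Freq) : cas m 0 = 1 := by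
  simp [cas, mFourier]

lemma IsGaussianCoeffs.memLp_two (hξ : IsGaussianCoeffs P ξ) (m : Freq) : MemLp (ξ m) 2 P := by
  have h : MemLp id 2 (P.map (ξ m)) := by
    rw [hξ.law]
    exact memLp_id_gaussianReal 2
  exact (memLp_map_measure_iff aestronglyMeasurable_id (hξ.measurable m).aemeasurable).1 h

lemma IsGaussianCoeffs.integral_eq_zero (hξ : IsGaussianCoeffs P ξ) (m : Freq) :
    ∫ ω, ξ m ω ∂P = 0 := by
  have h := integral_map (μ := P) (hξ.measurable m).aemeasurable (f := id) aestronglyMeasurable_id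
  rw [hξ.law] at h
  exact h.symm.trans integral_id_gaussianReal

lemma IsGaussianCoeffs.variance_eq (hξ : IsGaussianCoeffs P ξ) (m : Freq) :
    Var[ξ m; P] = greenVar m := by
  have h := variance_id_map (μ := P) (hξ.measurable m).aemeasurable
  rw [hξ.law, variance_id_gaussianReal] at h
  exact h.symm

lemma IsGaussianCoeffs.integral_sum_sq (hξ : IsGaussianCoeffs P ξ) (F : Finset Freq) :
    ∫ ω, (∑ m ∈ F, ξ m ω) ^ 2 ∂P = ∑ m ∈ F, (greenVar m : ℝ) := by
  have := hξ.isProbabilityMeasure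
  have h0 : ∫ ω, ∑ m ∈ F, ξ m ω ∂P = 0 := by
    rw [integral_finsetSum _ fun m _ => (hξ.memLp_two m).integrable one_le_two]
    simp [hξ.integral_eq_zero]
  have h1 := variance_of_integral_eq_zero
    (Finset.measurable_sum F fun m _ => hξ.measurable m).aemeasurable h0
  rw [show (fun ω => ∑ m ∈ F, ξ m ω) = ∑ m ∈ F, ξ m by ext; simp, IndepFun.variance_sum (fun m _ => hξ.memLp_two m)
    (fun m _ l _ hml => hξ.indep.indepFun hml)] at h1
  simp only [hξ.variance_eq] at h1
  exact h1.symm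

lemma IsGaussianCoeffs.wickExp_eq (hξ : IsGaussianCoeffs P ξ)
    (hX : ∀ᵐ ω ∂P, ∀ n x, truncate n (X ω) x = ((∑ m ∈ freqBall n, ξ m ω * cas m x : ℝ) : ℂ))
    (γ : ℝ) : ∀ᵐ ω ∂P, ∀ n, wickExp X P γ n ω = chaosTrunc γ (freqBall n) fun m => ξ m ω := by
  have hvar : ∀ n, truncVariance X P n = ((∑ m ∈ freqBall n, (greenVar m : ℝ) : ℝ) : ℂ) := by
    intro n
    rw [truncVariance, ← hξ.integral_sum_sq, ← integral_complex_ofReal]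
    refine integral_congr_ae ?_
    filter_upwards [hX] with ω hω
    rw [hω n 0]
    simp [cas_zero_right]
  filter_upwards [hX] with ω hω n
  ext x
  rw [chaosTrunc_apply, chaosReal]
  change Complex.exp _ = _
  rw [hω n x, hvar n]
  push_cast
  rfl

end Wick

/-! ## Supports of limits in `L²` -/

section SupportLimit

variable {Ω S : Type*} [MeasurableSpace Ω] {P : Measure Ω} [SeminormedAddCommGroup S]
  {W : ℕ → Ω → S} {M : Ω → S}

lemma tendsto_measure_le_norm_sub (hW : ∀ n, AEStronglyMeasurable (W n) P)
    (hM : AEStronglyMeasurable M P) (h : Tendsto (fun n => eLpNorm (W n - M) 2 P) atTop (𝓝 0))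
    {ε : ℝ} (hε : 0 < ε) : Tendsto (fun n => P {ω | ε ≤ ‖W n ω - M ω‖}) atTop (𝓝 0) := by
  have h1 : ∀ n, P {ω | ε ≤ ‖W n ω - M ω‖} ≤
      (ENNReal.ofReal ε)⁻¹ ^ (2 : ℝ) * eLpNorm (W n - M) 2 P ^ (2 : ℝ) := by
    intro n
    have h2 := meas_ge_le_mul_pow_eLpNorm_enorm P two_ne_zero ENNReal.ofNat_ne_top ((hW n).sub hM)
      (ε := ENNReal.ofReal ε) (by simpa using hε) (fun h => absurd h (by finiteness))
    refine (measure_mono fun ω hω => ?_).trans h2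
    change ENNReal.ofReal ε ≤ ‖W n ω - M ω‖ₑ
    rw [← ofReal_norm]
    exact ENNReal.ofReal_le_ofReal hω
  have h3 := ENNReal.Tendsto.const_mul (a := (ENNReal.ofReal ε)⁻¹ ^ (2 : ℝ))
    (((ENNReal.continuous_rpow_const (y := 2)).tendsto 0).comp h) (.inr (by simp [hε]))
  rw [ENNReal.zero_rpow_of_pos two_pos, mul_zero] at h3
  exact tendsto_of_tendsto_of_tendsto_of_le_of_le tendsto_const_nhds h3 (fun _ => zero_le) h1

variable [MeasurableSpace S] [BorelSpace S]

/-- A ball around a point outside `C` with half the distance margin can meet `M` only where `W n`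
and `M` are far apart, an event of vanishing probability. -/
lemma support_map_subset_of_tendsto (hW : ∀ n, AEStronglyMeasurable (W n) P)
    (hM : AEStronglyMeasurable M P) (h : Tendsto (fun n => eLpNorm (W n - M) 2 P) atTop (𝓝 0))
    {C : Set S} (hC : IsClosed C) (hWC : ∀ n, ∀ᵐ ω ∂P, W n ω ∈ C) : (P.map M).support ⊆ C := by
  intro f hf
  by_contra hfC
  obtain ⟨ε, hε, hball⟩ := Metric.isOpen_iff.1 hC.isOpen_compl f hfC
  have h1 := (Measure.mem_support_iff_forall f).1 hf _ (Metric.ball_mem_nhds f (half_pos hε))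
  rw [Measure.map_apply_of_aemeasurable hM.aemeasurable Metric.isOpen_ball.measurableSet] at h1
  refine h1.ne' (le_antisymm (ge_of_tendsto'
    (tendsto_measure_le_norm_sub hW hM h (half_pos hε)) fun n => ?_) zero_le)
  refine measure_mono_ae ?_
  filter_upwards [hWC n] with ω hω (hMω : M ω ∈ Metric.ball f (ε / 2))
  change ε / 2 ≤ ‖W n ω - M ω‖
  by_contra! hlt
  refine hball (a := W n ω) ?_ hω
  rw [Metric.mem_ball] at hMω ⊢
  rw [← dist_eq_norm] at hlt
  linarith [dist_triangle (W n ω) (M ω) f]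

/-- The lower bound `c` is uniform in large n, so it survives the removal of the event that `W n`
and `M` differ by ε/2, whose probability tends to 0. -/
lemma mem_support_map_of_tendsto (hW : ∀ n, AEStronglyMeasurable (W n) P)
    (hM : AEStronglyMeasurable M P) (h : Tendsto (fun n => eLpNorm (W n - M) 2 P) atTop (𝓝 0))
    {f : S} (hf : ∀ ε > 0, ∃ c > 0, ∀ᶠ n in atTop, c ≤ P {ω | ‖W n ω - f‖ ≤ ε}) :
    f ∈ (P.map M).support := by
  refine (Measure.mem_support_iff_forall f).2 fun U hU => ?_
  obtain ⟨ε, hε, hball⟩ := Metric.mem_nhds_iff.1 hU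
  refine lt_of_lt_of_le ?_ (measure_mono hball)
  rw [Measure.map_apply_of_aemeasurable hM.aemeasurable Metric.isOpen_ball.measurableSet]
  obtain ⟨c, hc, hev⟩ := hf (ε / 2) (half_pos hε)
  have h1 := (tendsto_measure_le_norm_sub hW hM h (half_pos hε)).eventually (gt_mem_nhds hc)
  obtain ⟨n, hn1, hn2⟩ := (hev.and h1).exists
  refine pos_iff_ne_zero.2 fun h0 => ?_
  have h2 : P {ω | ‖W n ω - f‖ ≤ ε / 2} ≤
      P (M ⁻¹' Metric.ball f ε) + P {ω | ε / 2 ≤ ‖W n ω - M ω‖} := by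
    refine (measure_mono fun ω hω => ?_).trans (measure_union_le _ _)
    by_contra hcon
    simp only [Set.mem_union, Set.mem_preimage, Metric.mem_ball, Set.mem_ofPred_eq, not_or, not_lt,
      not_le] at hcon hω
    rw [← dist_eq_norm] at hω hcon
    linarith [dist_triangle_left (M ω) f (W n ω)]
  rw [h0, zero_add] at h2
  exact absurd (hn1.trans h2) (not_le.2 hn2)

end SupportLimit

/-! ## Small balls -/

section SmallBalls

variable {Ω : Type*} [MeasurableSpace Ω] {P : Measure Ω} {ξ : Freq → Ω → ℝ}

lemma greenVar_ne_zero (m : Freq) : greenVar m ≠ 0 := by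
  have h : (0 : ℝ) < greenVar m := by
    have := eigen_pos m
    change 0 < 1 / (2 * eigen m)
    positivity
  exact_mod_cast h.ne'

lemma IsGaussianCoeffs.measure_preimage_closedBall_pos (hξ : IsGaussianCoeffs P ξ) (m : Freq)
    (a : ℝ) {r : ℝ} (hr : 0 < r) : 0 < P (ξ m ⁻¹' Metric.closedBall a r) := by
  rw [← Measure.map_apply (hξ.measurable m) Metric.isClosed_closedBall.measurableSet, hξ.law]
  refine pos_iff_ne_zero.2 fun h => ?_
  have h1 := gaussianReal_absolutelyContinuous' 0 (greenVar_ne_zero m) h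
  exact (Metric.measure_closedBall_pos volume a hr).ne' h1

lemma IsGaussianCoeffs.measure_biInter_pos (hξ : IsGaussianCoeffs P ξ) (F : Finset Freq)
    (a : Freq → ℝ) {r : Freq → ℝ} (hr : ∀ m, 0 < r m) :
    0 < P (⋂ m ∈ F, ξ m ⁻¹' Metric.closedBall (a m) (r m)) := by
  rw [hξ.indep.measure_inter_preimage_eq_mul F
    fun m _ => Metric.isClosed_closedBall.measurableSet]
  exact pos_iff_ne_zero.2 (Finset.prod_ne_zero_iff.2 fun m _ =>
    (hξ.measure_preimage_closedBall_pos m (a m) (hr m)).ne')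

lemma chaosTrunc_congr (γ : ℝ) {F : Finset Freq} {z z' : Freq → ℝ} (h : ∀ m ∈ F, z m = z' m) :
    chaosTrunc γ F z = chaosTrunc γ F z' := by
  unfold chaosTrunc
  congr 2
  exact Finset.sum_congr rfl fun m hm => by rw [h m hm]

/-- The two events depend on disjoint blocks of independent coefficients. -/
lemma IsGaussianCoeffs.measure_inter_chaosTrunc (hξ : IsGaussianCoeffs P ξ) {s : ℝ} (hs : s ≤ 0)
    (γ η : ℝ) {F G : Finset Freq} (hFG : Disjoint F G) (a r : Freq → ℝ) :
    P ((⋂ m ∈ F, ξ m ⁻¹' Metric.closedBall (a m) (r m)) ∩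
      {ω | ‖toSobolev hs (chaosTrunc γ G (fun m => ξ m ω) - 1)‖ ≤ η}) =
    P (⋂ m ∈ F, ξ m ⁻¹' Metric.closedBall (a m) (r m)) *
      P {ω | ‖toSobolev hs (chaosTrunc γ G (fun m => ξ m ω) - 1)‖ ≤ η} := by
  classical
  -- Extension by zero exhibits the truncated chaos over `G` as a continuous function of the
  -- coefficients in `G`.
  set e : (G → ℝ) → Freq → ℝ := fun y m => if h : m ∈ G then y ⟨m, h⟩ else 0 with he
  have hec : Continuous e := continuous_pi fun m => by
    by_cases h : m ∈ G
    · simpa [he, h] using continuous_apply _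
    · simpa [he, h] using continuous_const
  set A : Set (F → ℝ) := ⋂ m : F, (fun y => y m) ⁻¹' Metric.closedBall (a m) (r m) with hA
  set B : Set (G → ℝ) := {y | ‖toSobolev hs (chaosTrunc γ G (e y) - 1)‖ ≤ η} with hB
  have hAm : MeasurableSet A := .iInter fun m =>
    (measurable_pi_apply m) Metric.isClosed_closedBall.measurableSet
  have hBm : MeasurableSet B := by
    refine IsClosed.measurableSet (isClosed_le (continuous_norm.comp ((continuous_toSobolev hs).comp
      (((continuous_chaosTrunc γ G).comp hec).sub continuous_const))) continuous_const)
  have h := (hξ.indep.indepFun_finset F G hFG hξ.measurable).measure_inter_preimage_eq_mul A B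
    hAm hBm
  have e1 : (fun ω (m : F) => ξ m ω) ⁻¹' A =
      ⋂ m ∈ F, ξ m ⁻¹' Metric.closedBall (a m) (r m) := by
    ext ω
    simp [hA]
  have e2 : (fun ω (m : G) => ξ m ω) ⁻¹' B =
      {ω | ‖toSobolev hs (chaosTrunc γ G (fun m => ξ m ω) - 1)‖ ≤ η} := by
    ext ω
    rw [Set.mem_preimage, hB, Set.mem_ofPred_eq, Set.mem_ofPred_eq,
      chaosTrunc_congr γ fun m hm => show e (fun i : G => ξ i ω) m = ξ m ω by simp [he, hm]]
  rwa [e1, e2] at h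

lemma norm_toSobolev_sum_cas_mul_le {s : ℝ} (hs : s ≤ 0) (hs2 : -2 ≤ s) (F : Finset Freq)
    (a : Freq → ℝ) (w : C(T2, ℂ)) :
    ‖toSobolev hs ((∑ m ∈ F, (a m : ℂ) • casFun m) * w)‖ ≤
      (∑ m ∈ F, |a m| * (4 * eigen m)) * ‖toSobolev hs w‖ := by
  have hc : ‖casCoeff‖ ≤ 1 ∧ ‖casCoeff'‖ ≤ 1 := by
    have h1 : ‖(1 : ℂ) - Complex.I‖ ≤ 2 := (norm_sub_le _ _).trans (by norm_num)
    have h2 : ‖(1 : ℂ) + Complex.I‖ ≤ 2 := (norm_add_le _ _).trans (by norm_num)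
    constructor
    · rw [casCoeff, norm_div, Complex.norm_ofNat]; linarith
    · rw [casCoeff', norm_div, Complex.norm_ofNat]; linarith
  have h1 : ∀ m, ‖toSobolev hs (((a m : ℂ) • casFun m) * w)‖ ≤
      |a m| * (4 * eigen m) * ‖toSobolev hs w‖ := by
    intro m
    have h2 := norm_toSobolev_mFourier_mul_le hs hs2 m w
    have h3 := norm_toSobolev_mFourier_mul_le hs hs2 (-m) w
    have hm := eigen_pos m
    rw [eigen_neg] at h3
    have h4 : ((a m : ℂ) • casFun m) * w =
        (a m : ℂ) • (casCoeff • (mFourier m * w) + casCoeff' • (mFourier (-m) * w)) := by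
      rw [smul_mul_assoc, casFun, add_mul, smul_mul_assoc, smul_mul_assoc]
    rw [h4, norm_toSobolev_smul, Complex.norm_real, Real.norm_eq_abs, toSobolev_add, mul_assoc]
    refine mul_le_mul_of_nonneg_left ((norm_add_le _ _).trans ?_) (abs_nonneg _)
    rw [norm_toSobolev_smul, norm_toSobolev_smul]
    have h5 := mul_le_mul hc.1 h2 (norm_nonneg _) zero_le_one
    have h6 := mul_le_mul hc.2 h3 (norm_nonneg _) zero_le_one
    linarith
  rw [Finset.sum_mul, show toSobolev hs (∑ m ∈ F, (a m : ℂ) • casFun m * w) =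
    ∑ m ∈ F, toSobolev hs ((a m : ℂ) • casFun m * w) from map_sum (toSobolevₗ hs) _ _,
    Finset.sum_mul]
  exact (norm_sum_le _ _).trans (Finset.sum_le_sum fun m _ => h1 m)

lemma chaosTrunc_sdiff (γ : ℝ) {F F' : Finset Freq} (h : F ⊆ F') (z : Freq → ℝ) :
    chaosTrunc γ F' z = chaosTrunc γ F z * chaosTrunc γ (F' \ F) z := by
  rw [chaosTrunc, chaosTrunc, chaosTrunc, ← expC_add, ← Finset.sum_sdiff h, ← Finset.sum_sdiff h,
    mul_add, Complex.ofReal_add]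
  congr 1
  ext x
  simp only [ContinuousMap.sub_apply, ContinuousMap.add_apply, ContinuousMap.smul_apply,
    smul_eq_mul]
  ring

lemma casFun_zero : casFun 0 = 1 := by
  ext x
  rw [casFun_eq_cas]
  simp [cas, mFourier_zero]

/-- The frequency 0 has constant Hartley function 1, so the normalizing constant is absorbed into
its coefficient; this is why 0 must lie in `F`. -/
lemma chaosTrunc_eq_expC_mul (γ : ℝ) {F : Finset Freq} (h0 : 0 ∈ F) (z t : Freq → ℝ) :
    chaosTrunc γ F z = expC (∑ m ∈ F, ((γ * (z m - t m) -
      if m = 0 then γ ^ 2 / 2 * ∑ l ∈ F, (greenVar l : ℝ) else 0 : ℝ) : ℂ) • casFun m) *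
      expC (∑ m ∈ F, ((γ * t m : ℝ) : ℂ) • casFun m) := by
  rw [chaosTrunc, ← expC_add, ← Finset.sum_add_distrib]
  congr 1
  generalize γ ^ 2 / 2 * ∑ m ∈ F, (greenVar m : ℝ) = R
  have h1 : (R : ℂ) • (1 : C(T2, ℂ)) =
      ∑ m ∈ F, ((if m = 0 then R else 0 : ℝ) : ℂ) • casFun m := by
    rw [Finset.sum_eq_single_of_mem 0 h0 fun m _ hm => by
      rw [if_neg hm, Complex.ofReal_zero]; exact zero_smul ℂ (casFun m), if_pos rfl, casFun_zero]
  rw [h1, ← Finset.sum_sub_distrib]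
  refine Finset.sum_congr rfl fun m _ => ?_
  ext x
  simp only [ContinuousMap.sub_apply, ContinuousMap.add_apply, ContinuousMap.smul_apply,
    smul_eq_mul]
  push_cast
  ring

end SmallBalls

lemma exists_subset_freqBall (F : Finset Freq) : ∃ n, F ⊆ freqBall n := by
  refine ⟨∑ m ∈ F, ((m 0).natAbs + (m 1).natAbs), fun m hm => ?_⟩
  have h1 : (m 0).natAbs + (m 1).natAbs ≤ ∑ m ∈ F, ((m 0).natAbs + (m 1).natAbs) :=
    Finset.single_le_sum (f := fun m : Freq => (m 0).natAbs + (m 1).natAbs)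
      (fun _ _ => Nat.zero_le _) hm
  set n := ∑ m ∈ F, ((m 0).natAbs + (m 1).natAbs)
  have h2 : |m 0| + |m 1| ≤ (n : ℤ) := by
    rw [Int.abs_eq_natAbs, Int.abs_eq_natAbs]
    exact_mod_cast h1
  have a0 := abs_nonneg (m 0)
  have a1 := abs_nonneg (m 1)
  refine mem_freqBall.2 ⟨fun i => abs_le.1 ?_, ?_⟩
  · fin_cases i
    · exact (le_add_of_nonneg_right a1).trans h2
    · exact (le_add_of_nonneg_left a0).trans h2
  · rw [freqSq, ← sq_abs (m 0), ← sq_abs (m 1)]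
    nlinarith

lemma zero_mem_freqBall (n : ℕ) : (0 : Freq) ∈ freqBall n :=
  mem_freqBall.2 ⟨fun i => by simp, by simp [freqSq]⟩

/-! ### Probability of staying near a given exponential -/

section ChaosMass

variable {γ s K : ℝ}

lemma exists_tendsto_chaosMass
    (hK : ∀ F B : Finset Freq, ∑ m ∈ B, eigen m ^ s * chaosCoef γ F m ≤ K) :
    ∃ L, (∀ n, chaosMass γ s (freqBall n) ≤ L) ∧
      Tendsto (fun n => chaosMass γ s (freqBall n)) atTop (𝓝 L) := by
  have hmono : Monotone fun n => chaosMass γ s (freqBall n) := fun n k hnk =>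
    chaosMass_mono hK (freqBall_mono hnk)
  have hbdd : BddAbove (Set.range fun n => chaosMass γ s (freqBall n)) :=
    ⟨K, by rintro _ ⟨n, rfl⟩; exact chaosMass_le hK _⟩
  exact ⟨_, fun n => le_ciSup hbdd n, tendsto_atTop_ciSup hmono hbdd⟩

variable {Ω : Type*} [MeasurableSpace Ω] {P : Measure Ω} {ξ : Freq → Ω → ℝ}

/-- Chebyshev's inequality: the second moment of the distance of the block F' \ F to 1 is at most
the mass increment, hence at most η²/2. -/
lemma IsGaussianCoeffs.half_le_measure
    (hK : ∀ F B : Finset Freq, ∑ m ∈ B, eigen m ^ s * chaosCoef γ F m ≤ K)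
    (hξ : IsGaussianCoeffs P ξ) (hs : s ≤ 0) {F F' : Finset Freq}
    (hF : ∀ m ∈ F, -m ∈ F) (hF' : ∀ m ∈ F', -m ∈ F') (hFF : F ⊆ F') {η : ℝ} (hη : 0 < η)
    (h : chaosMass γ s F' - chaosMass γ s F ≤ η ^ 2 / 2) :
    1 / 2 ≤ P {ω | ‖toSobolev hs (chaosTrunc γ (F' \ F) (fun m => ξ m ω) - 1)‖ ≤ η} := by
  have := hξ.isProbabilityMeasure
  have hsymm : ∀ m ∈ F' \ F, -m ∈ F' \ F := fun m hm => by
    rw [Finset.mem_sdiff] at hm ⊢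
    exact ⟨hF' m hm.1, fun hn => hm.2 (by simpa using hF _ hn)⟩
  have hsm : StronglyMeasurable fun ω =>
      toSobolev hs (chaosTrunc γ (F' \ F) (fun m => ξ m ω) - 1) :=
    (continuous_toSobolev hs).comp_stronglyMeasurable
      ((hξ.stronglyMeasurable_chaosTrunc γ (F' \ F)).sub stronglyMeasurable_const)
  have h1 := hξ.eLpNorm_sub_sq hK hs (F := ∅) (by simp) hsymm (Finset.empty_subset _)
  simp only [chaosTrunc_empty] at h1
  have h2 := meas_ge_le_mul_pow_eLpNorm_enorm P two_ne_zero ENNReal.ofNat_ne_top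
    hsm.aestronglyMeasurable (ε := ENNReal.ofReal η) (by simpa using hη)
    (fun h => absurd h (by finiteness))
  rw [ENNReal.toReal_ofNat, ENNReal.rpow_two, ENNReal.rpow_two, h1,
    ← ENNReal.ofReal_inv_of_pos hη, ← ENNReal.ofReal_pow (by positivity),
    ← ENNReal.ofReal_mul (by positivity)] at h2
  have h3 : P {ω | η < ‖toSobolev hs (chaosTrunc γ (F' \ F) (fun m => ξ m ω) - 1)‖} ≤ 1 / 2 := by
    refine (measure_mono fun ω hω => ?_).trans (h2.trans ?_)
    · change ENNReal.ofReal η ≤ ‖_‖ₑ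
      rw [← ofReal_norm]
      exact ENNReal.ofReal_le_ofReal (le_of_lt hω)
    · rw [show (1 / 2 : ℝ≥0∞) = ENNReal.ofReal (1 / 2) by
        rw [ENNReal.ofReal_div_of_pos two_pos]; simp]
      refine ENNReal.ofReal_le_ofReal ?_
      calc η⁻¹ ^ 2 * (chaosMass γ s (F' \ F) - chaosMass γ s ∅)
          ≤ η⁻¹ ^ 2 * (η ^ 2 / 2) := by
            gcongr
            exact (chaosMass_sdiff_sub_le hK hFF).trans h
        _ = 1 / 2 := by field_simp
  have hmeas : MeasurableSet
      {ω | ‖toSobolev hs (chaosTrunc γ (F' \ F) (fun m => ξ m ω) - 1)‖ ≤ η} :=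
    (continuous_norm.measurable.comp hsm.measurable) measurableSet_Iic
  have h4 : P {ω | ‖toSobolev hs (chaosTrunc γ (F' \ F) (fun m => ξ m ω) - 1)‖ ≤ η}ᶜ ≤ 1 / 2 := by
    simpa only [Set.compl_ofPred, not_le] using h3
  have h5 := prob_add_prob_compl (μ := P) hmeas
  by_contra! hlt
  have h6 : P {ω | ‖toSobolev hs (chaosTrunc γ (F' \ F) (fun m => ξ m ω) - 1)‖ ≤ η} +
      P {ω | ‖toSobolev hs (chaosTrunc γ (F' \ F) (fun m => ξ m ω) - 1)‖ ≤ η}ᶜ < 1 / 2 + 1 / 2 :=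
    ENNReal.add_lt_add_of_lt_of_le (by finiteness) hlt h4
  rw [h5, ENNReal.add_halves] at h6
  exact lt_irrefl _ h6

/-- With e the error at low frequencies, w the target and Z the high-frequency factor, ewZ - w = (e
- 1)(wZ) + w(Z - 1), and multiplication by w and by e - 1 is bounded on H^s. -/
lemma norm_toSobolev_chaosTrunc_sub_le {γ s : ℝ} (hs : s ≤ 0) (hs2 : -2 ≤ s) {F F' : Finset Freq}
    (hFF : F ⊆ F') (h0 : 0 ∈ F) {z t : Freq → ℝ} {C δ η : ℝ}
    (hC : ∀ v, ‖toSobolev hs (expC (∑ m ∈ F, ((γ * t m : ℝ) : ℂ) • casFun m) * v)‖ ≤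
      C * ‖toSobolev hs v‖) (hC0 : 0 ≤ C) (hδ : 0 ≤ δ)
    (hsum : ∑ m ∈ F, |γ * (z m - t m) - if m = 0 then γ ^ 2 / 2 * ∑ l ∈ F, (greenVar l : ℝ) else 0| *
      (4 * eigen m) ≤ δ)
    (hZ : ‖toSobolev hs (chaosTrunc γ (F' \ F) z - 1)‖ ≤ η) :
    ‖toSobolev hs (chaosTrunc γ F' z) -
      toSobolev hs (expC (∑ m ∈ F, ((γ * t m : ℝ) : ℂ) • casFun m))‖ ≤
      (Real.exp δ - 1) * (C * (1 + η)) + C * η := by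
  have hF' : chaosTrunc γ F' z = _ := chaosTrunc_sdiff γ hFF z
  rw [chaosTrunc_eq_expC_mul γ h0 z t] at hF'
  have hg := fun v => (norm_toSobolev_sum_cas_mul_le hs hs2 F (fun m => γ * (z m - t m) -
    if m = 0 then γ ^ 2 / 2 * ∑ l ∈ F, (greenVar l : ℝ) else 0) v).trans
      (mul_le_mul_of_nonneg_right hsum (norm_nonneg _))
  rw [hF']
  clear hF'
  generalize expC (∑ m ∈ F, ((γ * t m : ℝ) : ℂ) • casFun m) = w at hC ⊢
  generalize chaosTrunc γ (F' \ F) z = Z at hZ ⊢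
  have h1 := fun v => norm_toSobolev_expC_sub_one_mul_le hs hg hδ v
  generalize expC (∑ m ∈ F, ((γ * (z m - t m) -
    if m = 0 then γ ^ 2 / 2 * ∑ l ∈ F, (greenVar l : ℝ) else 0 : ℝ) : ℂ) • casFun m) = e at h1 ⊢
  have hZn : ‖toSobolev hs Z‖ ≤ 1 + η := by
    have h4 : toSobolev hs Z = toSobolev hs 1 + toSobolev hs (Z - 1) := by
      rw [← toSobolev_add, add_sub_cancel]
    rw [h4]
    refine (norm_add_le _ _).trans (add_le_add ((norm_toSobolev_le hs 1).trans ?_) hZ)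
    simp
  have h5 : e * w * Z - w = (e - 1) * (w * Z) + w * (Z - 1) := by ring
  rw [← toSobolev_sub, h5, toSobolev_add]
  refine (norm_add_le _ _).trans (add_le_add ((h1 _).trans ?_) ((hC _).trans ?_))
  · exact mul_le_mul_of_nonneg_left ((hC Z).trans (mul_le_mul_of_nonneg_left hZn hC0))
      (sub_nonneg.2 (Real.one_le_exp hδ))
  · exact mul_le_mul_of_nonneg_left hZ hC0

-- The low coefficients fall in small intervals with positive probability, and independently the
-- high-frequency factor is near 1 with probability at least 1/2. The cutoff n is fixed before k, so
-- the bound does not depend on k.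
set_option maxHeartbeats 400000 in
lemma IsGaussianCoeffs.exists_le_measure
    (hK : ∀ F B : Finset Freq, ∑ m ∈ B, eigen m ^ s * chaosCoef γ F m ≤ K)
    (hξ : IsGaussianCoeffs P ξ) (hγ : γ ≠ 0) (hs : s ≤ 0) (hs2 : -2 ≤ s) (F : Finset Freq)
    (t : Freq → ℝ) {ε : ℝ} (hε : 0 < ε) :
    ∃ c > 0, ∀ᶠ k in atTop, c ≤ P {ω | ‖toSobolev hs (chaosTrunc γ (freqBall k) fun m => ξ m ω) -
      toSobolev hs (expC (∑ m ∈ F, ((γ * t m : ℝ) : ℂ) • casFun m))‖ ≤ ε} := by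
  set w := expC (∑ m ∈ F, ((γ * t m : ℝ) : ℂ) • casFun m) with hw
  set C := Real.exp (∑ m ∈ F, |γ * t m| * (4 * eigen m)) with hC
  have hC0 : 0 < C := Real.exp_pos _
  have hwC : ∀ v, ‖toSobolev hs (w * v)‖ ≤ C * ‖toSobolev hs v‖ :=
    norm_toSobolev_expC_mul_le hs (norm_toSobolev_sum_cas_mul_le hs hs2 F fun m => γ * t m)
      (Finset.sum_nonneg fun m _ => mul_nonneg (abs_nonneg _) (by linarith [eigen_pos m]))
  obtain ⟨L, hL, hLt⟩ := exists_tendsto_chaosMass hK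
  -- η, ρ and δ are such that the two error terms Cη and (e^δ - 1)C(1 + η) both equal ε/2.
  set η := ε / (2 * C) with hη
  have hη0 : 0 < η := by positivity
  set ρ := ε / (2 * C * (1 + η)) with hρ
  have hρ0 : 0 < ρ := by positivity
  set δ := Real.log (1 + ρ) with hδ
  have hδ0 : 0 < δ := Real.log_pos (by linarith)
  obtain ⟨n1, hn1⟩ := exists_subset_freqBall F
  have h1 : ∀ᶠ n in atTop, L - η ^ 2 / 2 < chaosMass γ s (freqBall n) :=
    hLt.eventually (lt_mem_nhds (by linarith [pow_pos hη0 2]))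
  -- Beyond this n the mass grows by less than η²/2 whatever the later truncation.
  obtain ⟨n, hn, hn'⟩ := (h1.and (eventually_ge_atTop n1)).exists
  have hFn : F ⊆ freqBall n := hn1.trans (freqBall_mono hn')
  classical
  set t' : Freq → ℝ := fun m => if m ∈ F then t m else 0 with ht'
  have hw' : w = expC (∑ m ∈ freqBall n, ((γ * t' m : ℝ) : ℂ) • casFun m) := by
    rw [hw, ← Finset.sum_subset hFn (f := fun m => ((γ * t' m : ℝ) : ℂ) • casFun m)
      fun m _ hm => by
        simp only [ht', if_neg hm, mul_zero, Complex.ofReal_zero]; exact zero_smul ℂ (casFun m)]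
    congr 1
    exact Finset.sum_congr rfl fun m hm => by simp [ht', hm]
  set R := γ ^ 2 / 2 * ∑ l ∈ freqBall n, (greenVar l : ℝ) with hR
  -- The target coefficients, with the one at frequency 0 raised by R/γ to cancel the normalization
  -- of the chaos.
  set a : Freq → ℝ := fun m => t' m + (if m = 0 then R else 0) / γ with ha
  set N : ℝ := ((freqBall n).card : ℝ) with hN
  have hN0 : 0 < N := by
    rw [hN]
    exact_mod_cast Finset.card_pos.2 ⟨0, zero_mem_freqBall n⟩
  -- These radii give each of the N low frequencies a share δ/N of the permitted error.
  set r : Freq → ℝ := fun m => δ / (N * (4 * eigen m) * |γ|) with hr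
  have hr0 : ∀ m, 0 < r m := fun m => by
    have := eigen_pos m
    have := abs_pos.2 hγ
    positivity
  have hA := hξ.measure_biInter_pos (freqBall n) a hr0
  refine ⟨P (⋂ m ∈ freqBall n, ξ m ⁻¹' Metric.closedBall (a m) (r m)) * (1 / 2),
    ENNReal.mul_pos hA.ne' (by simp), ?_⟩
  filter_upwards [eventually_ge_atTop n] with k hk
  have hnk := freqBall_mono hk
  refine (mul_le_mul_right (hξ.half_le_measure hK hs (fun m => freqBall_neg)
    (fun m => freqBall_neg) hnk hη0 (by linarith [hL k])) _).trans ?_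
  rw [← hξ.measure_inter_chaosTrunc hs γ η Finset.disjoint_sdiff a r]
  refine measure_mono ?_
  rintro ω ⟨hω1, hω2⟩
  simp only [Set.mem_iInter, Set.mem_preimage, Metric.mem_closedBall, Real.dist_eq] at hω1
  rw [Set.mem_ofPred_eq] at hω2 ⊢
  set b : Freq → ℝ := fun m => γ * (ξ m ω - t' m) - if m = 0 then R else 0 with hb
  have hsum : ∑ m ∈ freqBall n, |b m| * (4 * eigen m) ≤ δ := by
    calc ∑ m ∈ freqBall n, |b m| * (4 * eigen m) ≤ ∑ m ∈ freqBall n, δ / N := by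
          refine Finset.sum_le_sum fun m hm => ?_
          have hb' : b m = γ * (ξ m ω - a m) := by
            simp only [hb, ha]
            field_simp
            ring
          have he := eigen_pos m
          have hg0 := abs_pos.2 hγ
          rw [hb', abs_mul]
          calc |γ| * |ξ m ω - a m| * (4 * eigen m) ≤ |γ| * r m * (4 * eigen m) := by
                gcongr
                exact hω1 m hm
            _ = δ / N := by
                simp only [hr]
                field_simp
      _ = δ := by
          rw [Finset.sum_const, nsmul_eq_mul, ← hN]
          field_simp
  rw [hw']
  refine (norm_toSobolev_chaosTrunc_sub_le hs hs2 hnk (zero_mem_freqBall n) (hw' ▸ hwC) hC0.le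
    hδ0.le hsum hω2).trans (le_of_eq ?_)
  rw [hδ, Real.exp_log (by linarith), hρ, hη]
  field_simp
  ring

end ChaosMass

/-! ## Fejér means of nonnegative distributions -/

/-- The square `{0, …, N - 1}²`. -/
def freqBox (N : ℕ) : Finset Freq := Fintype.piFinset fun _ => Finset.Ico 0 (N : ℤ)

lemma card_freqBox (N : ℕ) : (freqBox N).card = N ^ 2 := by
  simp [freqBox, Fintype.card_piFinset]

/-- The multiplier of the Fejér mean. -/
def fejerWeight (N : ℕ) (p : Freq) : ℝ :=
  ((freqBox N).filter fun m => m - p ∈ freqBox N).card / (freqBox N).card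

lemma fejerWeight_nonneg (N : ℕ) (p : Freq) : 0 ≤ fejerWeight N p := by
  unfold fejerWeight
  positivity

lemma fejerWeight_le_one (N : ℕ) (p : Freq) : fejerWeight N p ≤ 1 :=
  div_le_one_of_le₀ (by exact_mod_cast Finset.card_filter_le _ _) (by positivity)

lemma filter_freqBox (N : ℕ) (p : Freq) :
    ((freqBox N).filter fun m => m - p ∈ freqBox N) =
      Fintype.piFinset fun i => Finset.Ico (max 0 (p i)) (min (N : ℤ) (N + p i)) := by
  ext m
  simp only [freqBox, Finset.mem_filter, Fintype.mem_piFinset, Finset.mem_Ico, Pi.sub_apply,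
    max_le_iff, lt_min_iff]
  refine ⟨fun h i => ?_, fun h => ⟨fun i => ?_, fun i => ?_⟩⟩
  · have h1 := h.1 i
    have h2 := h.2 i
    omega
  · have := h i
    omega
  · have := h i
    omega

/-- For large N the weight is the product of the factors 1 - |p_i|/N, by counting lattice points in
the intersection of two translated squares. -/
lemma tendsto_fejerWeight (p : Freq) : Tendsto (fun N => fejerWeight N p) atTop (𝓝 1) := by
  have h1 : ∀ i, Tendsto (fun N : ℕ => 1 - (|p i| : ℝ) / N) atTop (𝓝 1) := fun i => by
    simpa using (tendsto_const_div_atTop_nhds_zero_nat (|p i| : ℝ)).const_sub 1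
  have h2 := tendsto_finsetProd (Finset.univ : Finset (Fin 2)) fun i _ => h1 i
  rw [Finset.prod_const_one] at h2
  refine h2.congr' ?_
  filter_upwards [eventually_gt_atTop 0, eventually_ge_atTop (p 0).natAbs,
    eventually_ge_atTop (p 1).natAbs] with N hN h0 h1
  have hp : ∀ i, (p i).natAbs ≤ N := by
    intro i
    fin_cases i
    · exact h0
    · exact h1
  have hN' : (0 : ℝ) < N := by exact_mod_cast hN
  have h3 : ∀ i, (((Finset.Ico (max 0 (p i)) (min (N : ℤ) (N + p i))).card : ℕ) : ℝ) =
      N - |(p i : ℝ)| := by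
    intro i
    have h4 := hp i
    have h5 : ((Finset.Ico (max 0 (p i)) (min (N : ℤ) (N + p i))).card : ℤ) = N - |p i| := by
      rw [Int.card_Ico, Int.abs_eq_natAbs]
      omega
    exact_mod_cast congrArg (fun z : ℤ => (z : ℝ)) h5
  rw [fejerWeight, filter_freqBox, Fintype.card_piFinset, card_freqBox, Nat.cast_prod]
  simp only [h3, Fin.prod_univ_two]
  push_cast
  field_simp

/-- The Fejér mean of a distribution. -/
def fejer (N : ℕ) (u : Distr) : C(T2, ℂ) :=
  ((freqBox N).card : ℂ)⁻¹ • ∑ m ∈ freqBox N, ∑ l ∈ freqBox N,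
    fourierCoeff u (m - l) • mFourier (m - l)

/-- The linear form `f ↦ f̂(m)` on continuous functions. -/
def coefₗ (m : Freq) : C(T2, ℂ) →ₗ[ℂ] ℂ where
  toFun f := coef f m
  map_add' f g := coef_add f g m
  map_smul' c f := coef_smul c f m

lemma coef_fejer (N : ℕ) (u : Distr) (p : Freq) :
    coef (fejer N u) p = fejerWeight N p * fourierCoeff u p := by
  have h1 : coef (fejer N u) p = ((freqBox N).card : ℂ)⁻¹ * ∑ m ∈ freqBox N, ∑ l ∈ freqBox N,
      fourierCoeff u (m - l) * coef (mFourier (m - l)) p := by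
    change coefₗ p (fejer N u) = _
    simp only [fejer, map_smul, map_sum, smul_eq_mul]
    rfl
  have h2 : ∀ m ∈ freqBox N, ∑ l ∈ freqBox N, fourierCoeff u (m - l) * coef (mFourier (m - l)) p =
      if m - p ∈ freqBox N then fourierCoeff u p else 0 := by
    intro m _
    rw [← Finset.sum_ite_eq' (freqBox N) (m - p) fun _ => fourierCoeff u p]
    refine Finset.sum_congr rfl fun l _ => ?_
    have h3 : m - l = p ↔ l = m - p := by
      rw [sub_eq_iff_eq_add, eq_sub_iff_add_eq, add_comm, eq_comm]
    rw [coef_mFourier]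
    by_cases h : l = m - p
    · rw [if_pos h, if_pos (h3.2 h), h3.2 h, mul_one]
    · rw [if_neg h, if_neg (fun h' => h (h3.1 h')), mul_zero]
  rw [h1, Finset.sum_congr rfl h2, ← Finset.sum_filter, Finset.sum_const, nsmul_eq_mul, fejerWeight]
  push_cast
  ring

lemma toEll2_sub {s : ℝ} (u v : Sobolev s) :
    Sobolev.toEll2 s (u - v) = Sobolev.toEll2 s u - Sobolev.toEll2 s v :=
  LinearMap.map_sub _ u v

/-- The multipliers lie in [0, 1] and tend to 1, so dominated convergence applies to the squared
norm. -/
lemma tendsto_fejer {s : ℝ} (hs : s ≤ 0) (u : Sobolev s) :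
    Tendsto (fun N => toSobolev hs (fejer N u)) atTop (𝓝 u) := by
  have h1 : ∀ N p, Sobolev.toEll2 s (toSobolev hs (fejer N u) - u) p =
      ((fejerWeight N p - 1 : ℝ) : ℂ) * Sobolev.toEll2 s u p := by
    intro N p
    rw [toEll2_sub]
    change ((eigen p ^ (s / 2) : ℝ) : ℂ) * coef (fejer N u) p -
      ((eigen p ^ (s / 2) : ℝ) : ℂ) * fourierCoeff u p =
      _ * (((eigen p ^ (s / 2) : ℝ) : ℂ) * fourierCoeff u p)
    rw [coef_fejer]
    push_cast
    ring
  have h2 : ∀ N, ‖toSobolev hs (fejer N u) - u‖ ^ 2 =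
      ∑' p, (fejerWeight N p - 1) ^ 2 * ‖Sobolev.toEll2 s u p‖ ^ 2 := by
    intro N
    rw [← norm_toEll2, ← (ell2_norm_sq _).tsum_eq]
    refine tsum_congr fun p => ?_
    rw [h1, norm_mul, mul_pow, Complex.norm_real, Real.norm_eq_abs, sq_abs]
  have h3 : Tendsto (fun N => ‖toSobolev hs (fejer N u) - u‖ ^ 2) atTop
      (𝓝 (∑' p : Freq, (1 - 1) ^ 2 * ‖Sobolev.toEll2 s u p‖ ^ 2)) := by
    simp only [h2]
    refine tendsto_tsum_of_dominated_convergence (ell2_norm_sq (Sobolev.toEll2 s u)).summable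
      (fun p => ((((tendsto_fejerWeight p).sub_const 1).pow 2).mul_const _))
      (.of_forall fun N p => ?_)
    have h4 := fejerWeight_nonneg N p
    have h5 := fejerWeight_le_one N p
    rw [Real.norm_of_nonneg (by positivity)]
    exact mul_le_of_le_one_left (by positivity) (by nlinarith)
  have h4 := (Real.continuous_sqrt.tendsto _).comp h3
  simp only [sub_self, ne_eq, OfNat.ofNat_ne_zero, not_false_eq_true, zero_pow, zero_mul, tsum_zero,
    Real.sqrt_zero] at h4
  rw [tendsto_iff_norm_sub_tendsto_zero]
  exact h4.congr fun N => Real.sqrt_sq (norm_nonneg _)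

/-- The Fejér mean at x is, up to a positive factor, u tested against |∑ e_m(x - y)|² as a function
of y, a nonnegative trigonometric polynomial. -/
lemma fejer_nonneg {u : Distr} (hu : IsNonneg u) (N : ℕ) (x : T2) : 0 ≤ fejer N u x := by
  set φ : TestFunction := ∑ m ∈ freqBox N, ∑ l ∈ freqBox N, mFourier (m - l) x • char (-(m - l))
    with hφ
  have h1 : ∀ y, (φ : C(T2, ℂ)) y =
      (∑ m ∈ freqBox N, mFourier m (x - y)) * (starRingEnd ℂ) (∑ m ∈ freqBox N, mFourier m (x - y)) := by
    intro y
    have h2 : (φ : C(T2, ℂ)) =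
        ∑ m ∈ freqBox N, ∑ l ∈ freqBox N, mFourier (m - l) x • mFourier (-(m - l)) := by
      simp only [hφ, Submodule.coe_sum, Submodule.coe_smul]
      rfl
    rw [h2, map_sum, Finset.sum_mul_sum]
    simp only [ContinuousMap.coe_sum, Finset.sum_apply, ContinuousMap.smul_apply, smul_eq_mul]
    refine Finset.sum_congr rfl fun m _ => Finset.sum_congr rfl fun l _ => ?_
    rw [← mFourier_neg, ← mFourier_add, ← sub_eq_add_neg m l, sub_eq_add_neg x y,
      mFourier_add_apply, mFourier_neg_apply]
  have h2 : fejer N u x = ((freqBox N).card : ℂ)⁻¹ * (u : TestFunction →ₗ[ℂ] ℂ) φ := by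
    simp only [hφ, map_sum, map_smul, fejer, ContinuousMap.smul_apply, ContinuousMap.coe_sum,
      Finset.sum_apply, smul_eq_mul]
    congr 1
    refine Finset.sum_congr rfl fun m _ => Finset.sum_congr rfl fun l _ => ?_
    rw [mul_comm]
    rfl
  rw [h2]
  refine mul_nonneg ?_ (hu φ fun y => ?_)
  · rw [inv_nonneg]
    exact_mod_cast Nat.cast_nonneg _
  · rw [h1]
    exact mul_star_self_nonneg _

/-! ## Real trigonometric polynomials -/

lemma mFourier_eq_casFun (m : Freq) :
    mFourier m = casCoeff' • casFun m + casCoeff • casFun (-m) := by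
  ext x
  simp only [ContinuousMap.add_apply, ContinuousMap.smul_apply, smul_eq_mul, casFun_apply, neg_neg]
  linear_combination (-2 * mFourier m x) * casCoeff_mul - mFourier (-m) x * casCoeff_sq -
    mFourier (-m) x * casCoeff'_sq

lemma span_casFun_closure_eq_top :
    (Submodule.span ℂ (Set.range casFun)).topologicalClosure = ⊤ := by
  rw [eq_top_iff, ← span_mFourier_closure_eq_top]
  refine Submodule.topologicalClosure_mono (Submodule.span_le.2 ?_)
  rintro _ ⟨m, rfl⟩
  rw [mFourier_eq_casFun]
  exact add_mem (Submodule.smul_mem _ _ (Submodule.subset_span ⟨m, rfl⟩))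
    (Submodule.smul_mem _ _ (Submodule.subset_span ⟨-m, rfl⟩))

/-- The span of the Hartley functions equals that of the characters, hence is dense. As the Hartley
functions and u are real, replacing the coefficients by their real parts does not increase the
distance to u. -/
lemma mem_closure_real_cas {u : C(T2, ℂ)} (hu : ∀ x, (u x).im = 0) :
    u ∈ closure {p : C(T2, ℂ) | ∃ (F : Finset Freq) (t : Freq → ℝ),
      p = ∑ m ∈ F, (t m : ℂ) • casFun m} := by
  rw [Metric.mem_closure_iff]
  intro ε hε
  have h1 : u ∈ closure (Submodule.span ℂ (Set.range casFun) : Set C(T2, ℂ)) := by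
    rw [← Submodule.topologicalClosure_coe, span_casFun_closure_eq_top]
    trivial
  obtain ⟨p, hp, hpu⟩ := Metric.mem_closure_iff.1 h1 ε hε
  obtain ⟨c, rfl⟩ := (Finsupp.mem_span_range_iff_exists_finsupp).1 hp
  refine ⟨_, ⟨c.support, fun m => (c m).re, rfl⟩, lt_of_le_of_lt ?_ hpu⟩
  rw [dist_eq_norm, dist_eq_norm, ContinuousMap.norm_le _ (norm_nonneg _)]
  intro x
  refine le_trans ?_ ((u - c.sum fun i a => a • casFun i).norm_coe_le_norm x)
  have h2 : (u - ∑ m ∈ c.support, (((c m).re : ℝ) : ℂ) • casFun m) x =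
      (((u - c.sum fun i a => a • casFun i) x).re : ℂ) := by
    simp only [ContinuousMap.sub_apply, ContinuousMap.coe_sum, Finset.sum_apply,
      ContinuousMap.smul_apply, smul_eq_mul, casFun_eq_cas, Finsupp.sum, Complex.sub_re,
      Complex.re_sum, Complex.re_mul_ofReal, Complex.ofReal_sub, Complex.ofReal_sum,
      Complex.ofReal_mul]
    congr 1
    exact Complex.ext rfl (hu x)
  rw [h2, Complex.norm_real, Real.norm_eq_abs]
  exact Complex.abs_re_le_norm _

/-! ## Density of the exponentials of real trigonometric polynomials -/

/-- The elements `exp(γ p)` of `H^s`, `p` being a real trigonometric polynomial. -/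
def expTrig {s : ℝ} (hs : s ≤ 0) (γ : ℝ) : Set (Sobolev s) :=
  {f | ∃ (F : Finset Freq) (t : Freq → ℝ),
    f = toSobolev hs (expC (∑ m ∈ F, ((γ * t m : ℝ) : ℂ) • casFun m))}

/-- Write w = exp(γu) with u = (log w)/γ continuous by positivity; uniform approximation of u passes
through the exponential and the embedding. -/
lemma toSobolev_mem_closure_expTrig {s γ : ℝ} (hs : s ≤ 0) (hγ : γ ≠ 0) {w : C(T2, ℂ)}
    (hw : ∀ x, 0 < w x) : toSobolev hs w ∈ closure (expTrig hs γ) := by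
  have hre : ∀ x, 0 < (w x).re := fun x => (Complex.lt_def.1 (hw x)).1
  set u : C(T2, ℂ) := ⟨fun x => ((Real.log (w x).re / γ : ℝ) : ℂ), by
    refine Complex.continuous_ofReal.comp (Continuous.div_const (Continuous.log ?_ ?_) _)
    · exact Complex.continuous_re.comp w.continuous
    · exact fun x => (hre x).ne'⟩ with hu
  have h1 : w = expC ((γ : ℂ) • u) := by
    ext x
    change w x = Complex.exp ((γ : ℂ) * ((Real.log (w x).re / γ : ℝ) : ℂ))
    rw [← Complex.ofReal_mul, mul_div_cancel₀ _ hγ, ← Complex.ofReal_exp, Real.exp_log (hre x)]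
    exact Complex.ext rfl (Complex.lt_def.1 (hw x)).2.symm
  have hc : Continuous fun p : C(T2, ℂ) => toSobolev hs (expC ((γ : ℂ) • p)) :=
    (continuous_toSobolev hs).comp (continuous_expC.comp (continuous_const_smul (γ : ℂ)))
  rw [h1]
  refine map_mem_closure (f := fun p : C(T2, ℂ) => toSobolev hs (expC ((γ : ℂ) • p))) hc (mem_closure_real_cas (u := u) fun x => Complex.ofReal_im _) ?_
  rintro _ ⟨F, t, rfl⟩
  refine ⟨F, t, ?_⟩
  refine congrArg (fun p => toSobolev hs (expC p)) ?_
  rw [Finset.smul_sum]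
  refine Finset.sum_congr rfl fun m _ => ?_
  rw [smul_smul, Complex.ofReal_mul]

/-- The Fejér mean plus 1/(N + 1) is strictly positive and converges to f in H^s. -/
lemma mem_closure_expTrig {s γ : ℝ} (hs : s ≤ 0) (hγ : γ ≠ 0) {f : Sobolev s} (hf : IsNonneg f) :
    f ∈ closure (expTrig hs γ) := by
  have h1 : Tendsto (fun N : ℕ => toSobolev hs ((1 / ((N : ℝ) + 1) : ℝ) • (1 : C(T2, ℂ)))) atTop
      (𝓝 (toSobolev hs ((0 : ℝ) • (1 : C(T2, ℂ))))) :=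
    ((continuous_toSobolev hs).tendsto _).comp (tendsto_one_div_add_atTop_nhds_zero_nat.smul_const _)
  have h0 : toSobolev hs ((0 : ℝ) • (1 : C(T2, ℂ))) = 0 := by
    rw [show (0 : ℝ) • (1 : C(T2, ℂ)) = 0 by ext x; simp]
    exact map_zero (toSobolevₗ hs)
  rw [h0] at h1
  have h2 := (tendsto_fejer hs f).add h1
  rw [add_zero] at h2
  simp only [← toSobolev_add] at h2
  refine isClosed_closure.mem_of_tendsto h2 (.of_forall fun N => ?_)
  refine toSobolev_mem_closure_expTrig hs hγ fun x => ?_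
  refine add_pos_of_nonneg_of_pos (fejer_nonneg hf N x) ?_
  change (0 : ℂ) < (1 / ((N : ℝ) + 1) : ℝ) • (1 : ℂ)
  rw [Complex.real_smul, mul_one]
  exact_mod_cast Nat.one_div_pos_of_nat (α := ℝ)

/-! ## Existence and support of the Gaussian multiplicative chaos -/

lemma isNonneg_ofContinuous {w : C(T2, ℂ)} (hw : ∀ x, 0 ≤ w x) : IsNonneg (ofContinuous w) := by
  intro φ hφ
  change 0 ≤ ∫ x, w x * (φ : C(T2, ℂ)) x ∂torusMeasure
  have h : ∀ x, w x * (φ : C(T2, ℂ)) x = (((w x * (φ : C(T2, ℂ)) x).re : ℝ) : ℂ) := fun x =>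
    Complex.ext rfl (Complex.le_def.1 (mul_nonneg (hw x) (hφ x))).2.symm
  rw [integral_congr_ae (.of_forall h), integral_complex_ofReal]
  exact_mod_cast integral_nonneg fun x => (Complex.le_def.1 (mul_nonneg (hw x) (hφ x))).1

section Chaos

variable {Ω : Type*} [MeasurableSpace Ω] {P : Measure Ω} {ξ : Freq → Ω → ℝ} {X : Ω → Distr}
  {γ s K : ℝ}

/-- The masses of the balls increase to a finite limit L, and the distance from W_N to any later W_n
is at most √(L - mass_N); hence the sequence is Cauchy. -/
lemma IsGaussianCoeffs.exists_isGMC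
    (hK : ∀ F B : Finset Freq, ∑ m ∈ B, eigen m ^ s * chaosCoef γ F m ≤ K)
    (hξ : IsGaussianCoeffs P ξ) (hs : s ≤ 0) (hs2 : -2 ≤ s)
    (hX : ∀ᵐ ω ∂P, ∀ n, wickExp X P γ n ω = chaosTrunc γ (freqBall n) fun m => ξ m ω) :
    ∃ M : Ω → Sobolev s, IsGMC X P γ s M := by
  set W : ℕ → Ω → Sobolev s := fun n ω => toSobolev hs (wickExp X P γ n ω)
  have hWξ : ∀ n, W n =ᵐ[P] fun ω => toSobolev hs (chaosTrunc γ (freqBall n) fun m => ξ m ω) :=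
    fun n => by
      filter_upwards [hX] with ω hω
      exact congrArg (toSobolev hs) (hω n)
  have hmem : ∀ n, MemLp (W n) 2 P := fun n =>
    (hξ.memLp_toSobolev hK hs fun m => freqBall_neg).ae_eq (hWξ n).symm
  obtain ⟨L, hL, hLt⟩ := exists_tendsto_chaosMass hK
  have hb : Tendsto (fun n => Real.sqrt (L - chaosMass γ s (freqBall n))) atTop (𝓝 0) := by
    have h := (Real.continuous_sqrt.tendsto _).comp (hLt.const_sub L)
    rw [sub_self, Real.sqrt_zero] at h
    exact h
  obtain ⟨M, hM, hWM⟩ := exists_limit_sobolev hs2 hmem hb fun N n hNn => by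
    have h1 : eLpNorm (W n - W N) 2 P = eLpNorm (fun ω =>
        toSobolev hs (chaosTrunc γ (freqBall n) (fun m => ξ m ω) -
          chaosTrunc γ (freqBall N) (fun m => ξ m ω))) 2 P := by
      refine eLpNorm_congr_ae ?_
      filter_upwards [hWξ n, hWξ N] with ω h1 h2
      rw [Pi.sub_apply, h1, h2, ← toSobolev_sub]
    have h2 := hξ.eLpNorm_sub_sq hK hs (fun m => freqBall_neg) (fun m => freqBall_neg)
      (freqBall_mono hNn)
    rw [h1, ← ENNReal.pow_le_pow_left_iff two_ne_zero, h2, ← ENNReal.ofReal_pow (Real.sqrt_nonneg _),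
      Real.sq_sqrt (sub_nonneg.2 (hL N))]
    exact ENNReal.ofReal_le_ofReal (by linarith [hL n])
  exact ⟨M, hM, W, fun n ω => rfl, hmem, hWM⟩

/-- The support is closed, so one inclusion follows from the closedness of the cone and the other
from the density of the exponentials, each of which lies in the support. -/
lemma IsGaussianCoeffs.support_eq
    (hK : ∀ F B : Finset Freq, ∑ m ∈ B, eigen m ^ s * chaosCoef γ F m ≤ K)
    (hξ : IsGaussianCoeffs P ξ) (hγ : γ ≠ 0) (hs : s ≤ 0) (hs2 : -2 ≤ s)
    (hX : ∀ᵐ ω ∂P, ∀ n, wickExp X P γ n ω = chaosTrunc γ (freqBall n) fun m => ξ m ω)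
    {M : Ω → Sobolev s} (hM : IsGMC X P γ s M) :
    (P.map M).support = {f : Sobolev s | IsNonneg f} := by
  obtain ⟨hM2, W, hWX, hW2, hWM⟩ := hM
  have hW : ∀ᵐ ω ∂P, ∀ n, W n ω = toSobolev hs (chaosTrunc γ (freqBall n) fun m => ξ m ω) := by
    filter_upwards [hX] with ω hω n
    exact Subtype.ext (by rw [hWX, hω]; rfl)
  refine Set.Subset.antisymm ?_ ?_
  · refine support_map_subset_of_tendsto (fun n => (hW2 n).1) hM2.1 hWM (isClosed_isNonneg hs2)
      fun n => ?_
    filter_upwards [hW] with ω hω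
    rw [hω n]
    exact isNonneg_ofContinuous fun x => by
      rw [chaosTrunc_apply]
      exact_mod_cast (chaosReal_pos _ _ _ _).le
  · intro f hf
    refine closure_minimal ?_ Measure.isClosed_support (mem_closure_expTrig hs hγ hf)
    rintro _ ⟨F, t, rfl⟩
    refine mem_support_map_of_tendsto (fun n => (hW2 n).1) hM2.1 hWM fun ε hε => ?_
    obtain ⟨c, hc, hev⟩ := hξ.exists_le_measure hK hγ hs hs2 F t hε
    refine ⟨c, hc, hev.mono fun n hn => hn.trans (measure_mono_ae ?_)⟩
    filter_upwards [hW] with ω hω h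
    change ‖W n ω - _‖ ≤ ε
    rw [hω n]
    exact h

end Chaos

end TorusGMC

end

theorem mainTheorem4 {Ω : Type*} [MeasurableSpace Ω] (P : Measure Ω) [IsProbabilityMeasure P]
    (X : Ω → TorusGMC.Distr) (hX : TorusGMC.IsMassiveGFF X P)
    (γ : ℝ) (hγ : |γ| < Real.sqrt (8 * Real.pi)) (hγ0 : γ ≠ 0)
    (β : ℝ) (hβ : β ∈ Set.Ioo (γ ^ 2 / (8 * Real.pi)) 1) :
    (∃ M : Ω → TorusGMC.Sobolev (-β), TorusGMC.IsGMC X P γ (-β) M) ∧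
    ∀ M : Ω → TorusGMC.Sobolev (-β), TorusGMC.IsGMC X P γ (-β) M →
      (P.map M).support = {f : TorusGMC.Sobolev (-β) | TorusGMC.IsNonneg f} := by
  have hβ0 : -β ≤ 0 := by
    have h : 0 ≤ γ ^ 2 / (8 * Real.pi) := by positivity
    linarith [hβ.1]
  have hβ2 : -2 ≤ -β := by linarith [hβ.2]
  obtain ⟨K, hK⟩ := TorusGMC.exists_sum_chaosCoef_le hγ0 hβ.1 hβ.2
  obtain ⟨ξ, hξ, hXξ⟩ := TorusGMC.exists_gaussianCoeffs hX
  have hW := hξ.wickExp_eq hXξ γ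
  exact ⟨hξ.exists_isGMC hK hβ0 hβ2 hW, fun M hM => hξ.support_eq hK hγ0 hβ0 hβ2 hW hM⟩
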